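/- Let $k$ be an algebraically closed field of characteristic $p>0$, $V$ a $d$-dimensional $k$-vector space and $G\subset GL(V)$ a finite subgroup whose order is not divisible by $p$. Let $S=S^{\bullet}V$ be the symmetric algebra with its natural $G$-action, $\mathfrak m=S^{>0}V$ its homogeneous maximal ideal and $R=S^{G}$ the ring of invariants. For $q=p^{e}$, $e\ge 0$, let $\mathfrak m^{[q]}\subset S$ be the ideal generated by all $f^{q}$, $f\in\mathfrak m$. For a commutative $k$-algebra $A$ put $A^{q}:=\{f^{q}\mid f\in A\}$ and $D_{A,e}:=\operatorname{End}_{A^{q}}(A)$. Call $q$ *large enough* if the $G$-representation $S/\mathfrak m^{[q]}$ contains every irreducible representation of $G$ over $k$ as a direct summand. Then: 1. There is $e_0$ such that $q=p^{e}$ is large enough for all $e\ge e_0$; moreover, if $G$ is abelian, every $q=p^e\ge \# G$ is large enough. 2. If $q=p^e$ is large enough, then the ring $D_{R,e}$ has (left) global dimension $d$, and $D_{R,e}$ is a Cohen–Macaulay $R^{q}$-module. 3. If $q=p^e$ is large enough and $\hat R$ denotes the completion of $R$ with respect to the maximal ideal $\mathfrak m\cap R$, then likewise $D_{\hat R,e}$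 has (left) global dimension $d$ and is a Cohen–Macaulay $\hat R^{q}$-module. -/

import Mathlib

noncomputable section

namespace QuotientSing

universe u v w

/-! ### Homological notions -/

/-- The (left) global dimension of a ring `A`: the supremum of the projective dimensions of all
left `A`-modules. -/
def globalDimension (A : Type u) [Ring A] : WithBot ℕ∞ :=
  ⨆ M : ModuleCat.{u} A, CategoryTheory.projectiveDimension M

/-- The supremum of the lengths of the `M`-regular sequences contained in the maximal ideal of the
local ring `A`; for a nonzero finitely generated module over a Noetherian local ring this is the
depth of `M`. -/
def depth (A : Type u) [CommRing A] [IsLocalRing A] (M : Type v) [AddCommGroup M] [Module A M] :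
    WithBot ℕ∞ :=
  ⨆ rs : {rs : List A // (∀ r ∈ rs, r ∈ IsLocalRing.maximalIdeal A) ∧
    RingTheory.Sequence.IsRegular M rs}, ((rs.1.length : ℕ∞) : WithBot ℕ∞)

/-- Cohen-Macaulay modules over a (Noetherian) commutative ring `A`: finitely generated modules
`M` such that, for every maximal ideal `𝔫` in the support of `M`, the depth of `M_𝔫` over `A_𝔫`
equals the dimension of `M_𝔫`, i.e. the Krull dimension of its support. -/
def IsCohenMacaulayModule (A : Type u) [CommRing A] (M : Type v) [AddCommGroup M] [Module A M] :
    Prop :=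
  Module.Finite A M ∧
    ∀ (n : Ideal A) [n.IsMaximal], Nontrivial (LocalizedModule n.primeCompl M) →
      depth (Localization.AtPrime n) (LocalizedModule n.primeCompl M) =
        Module.supportDim (Localization.AtPrime n) (LocalizedModule n.primeCompl M)

/-! ### Frobenius -/

/-- In a commutative algebra over a field of characteristic `p`, the map `f ↦ f ^ (p ^ e)` is
additive (the zero ring is allowed). -/
theorem add_pow_char_pow' (k : Type u) [Field k] (p : ℕ) [Fact p.Prime] [CharP k p] (e : ℕ)
    {R : Type v} [CommRing R] [Algebra k R] (f g : R) :
    (f + g) ^ (p ^ e) = f ^ (p ^ e) + g ^ (p ^ e) := by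
  nontriviality R
  have : CharP R p := charP_of_injective_algebraMap (algebraMap k R).injective p
  exact add_pow_char_pow f g p e

/-- For a commutative algebra `R` over a field `k` of characteristic `p`, and `q = p ^ e`, the
subring `R^q = {f ^ q | f ∈ R}` of `R`. -/
def powSubring (k : Type u) [Field k] (p : ℕ) [Fact p.Prime] [CharP k p] (e : ℕ)
    (R : Type v) [CommRing R] [Algebra k R] : Subring R where
  carrier := {x | ∃ f : R, f ^ (p ^ e) = x}
  mul_mem' := by
    rintro _ _ ⟨f, rfl⟩ ⟨g, rfl⟩
    exact ⟨f * g, mul_pow f g _⟩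
  one_mem' := ⟨1, one_pow _⟩
  add_mem' := by
    rintro _ _ ⟨f, rfl⟩ ⟨g, rfl⟩
    exact ⟨f + g, add_pow_char_pow' k p e f g⟩
  zero_mem' := ⟨0, zero_pow (pow_ne_zero _ (Fact.out : p.Prime).ne_zero)⟩
  neg_mem' := by
    rintro _ ⟨f, rfl⟩
    refine ⟨-f, eq_neg_of_add_eq_zero_left ?_⟩
    rw [← add_pow_char_pow' k p e, neg_add_cancel,
      zero_pow (pow_ne_zero _ (Fact.out : p.Prime).ne_zero)]

/-- `D_{R,e} = End_{R^q}(R)`, `q = p ^ e`, with composition as multiplication. -/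
abbrev DiffOp (k : Type u) [Field k] (p : ℕ) [Fact p.Prime] [CharP k p] (e : ℕ)
    (R : Type v) [CommRing R] [Algebra k R] : Type v :=
  Module.End (powSubring k p e R) R

/-- `D_{R,e}` is a Cohen-Macaulay `R^q`-module, for `(a • φ) f = a * φ f`, `a ∈ R^q`. -/
def DiffOpIsCohenMacaulay (k : Type u) [Field k] (p : ℕ) [Fact p.Prime] [CharP k p] (e : ℕ)
    (R : Type v) [CommRing R] [Algebra k R] : Prop :=
  IsCohenMacaulayModule (powSubring k p e R) (DiffOp k p e R)

/-- The ideal `I^[q]` generated by the `q`-th powers of the elements of `I`. -/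
def frobPow {A : Type v} [CommRing A] (I : Ideal A) (q : ℕ) : Ideal A :=
  Ideal.span {x | ∃ f ∈ I, f ^ q = x}

/-! ### The linear action on the symmetric algebra and its invariants -/

variable (k : Type u) [Field k] (V : Type v) [AddCommGroup V] [Module k V]

/-- The action of `GL(V)` on `S = S^•V` by `k`-algebra endomorphisms which extends the given action
on `V`. -/
def symAct : LinearMap.GeneralLinearGroup k V →*
    (SymmetricAlgebra k V →ₐ[k] SymmetricAlgebra k V) where
  toFun g := SymmetricAlgebra.lift (SymmetricAlgebra.ι k V ∘ₗ (g : V →ₗ[k] V))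
  map_one' := by
    apply SymmetricAlgebra.algHom_ext
    ext x
    simp
  map_mul' g h := by
    apply SymmetricAlgebra.algHom_ext
    ext x
    simp

/-- The homogeneous maximal ideal `𝔪 = S^{>0}V` of `S`, generated by `V`. -/
def irrelevant : Ideal (SymmetricAlgebra k V) :=
  Ideal.span (Set.range (SymmetricAlgebra.ι k V))

variable {k V} (G : Subgroup (LinearMap.GeneralLinearGroup k V))

/-- The invariant ring `R = S^G`. -/
def invariantRing : Subalgebra k (SymmetricAlgebra k V) where
  carrier := {s | ∀ g ∈ G, symAct k V g s = s}
  mul_mem' := fun {a b} ha hb g hg => by rw [map_mul, ha g hg, hb g hg]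
  add_mem' := fun {a b} ha hb g hg => by rw [map_add, ha g hg, hb g hg]
  algebraMap_mem' := fun r g _ => AlgHom.commutes _ r

/-- The maximal ideal `𝔪 ∩ R` of `R = S^G`. -/
def invariantIdeal : Ideal (invariantRing G) :=
  (irrelevant k V).comap (algebraMap (invariantRing G) (SymmetricAlgebra k V))

/-- The completion of `R = S^G` with respect to the maximal ideal `𝔪 ∩ R`. -/
abbrev completedInvariantRing : Type (max u v) :=
  AdicCompletion (invariantIdeal G) (invariantRing G)

/-- `S` as a representation of `G`. -/
def symRep : Representation k G (SymmetricAlgebra k V) where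
  toFun g := (symAct k V g).toLinearMap
  map_one' := by rw [OneMemClass.coe_one, map_one]; rfl
  map_mul' g h := by rw [Subgroup.coe_mul, map_mul]; rfl

theorem symAct_irrelevant (g : LinearMap.GeneralLinearGroup k V) :
    irrelevant k V ≤ (irrelevant k V).comap (symAct k V g) := by
  rw [irrelevant, Ideal.span_le]
  rintro _ ⟨x, rfl⟩
  refine Ideal.subset_span ⟨(g : V →ₗ[k] V) x, ?_⟩
  exact (SymmetricAlgebra.lift_ι_apply (SymmetricAlgebra.ι k V ∘ₗ (g : V →ₗ[k] V)) x).symm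

theorem symAct_frobPow (q : ℕ) (g : LinearMap.GeneralLinearGroup k V) :
    frobPow (irrelevant k V) q ≤ (frobPow (irrelevant k V) q).comap (symAct k V g) := by
  conv_lhs => rw [frobPow]
  rw [Ideal.span_le]
  rintro _ ⟨f, hf, rfl⟩
  exact Ideal.subset_span ⟨symAct k V g f, symAct_irrelevant g hf, (map_pow _ _ _).symm⟩

/-- The quotient representation `S / 𝔪^[q]` of `G`. -/
def quotRep (q : ℕ) : Representation k G
    (SymmetricAlgebra k V ⧸ (frobPow (irrelevant k V) q).restrictScalars k) :=
  (symRep G).quotient ((frobPow (irrelevant k V) q).restrictScalars k)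
    (fun g _ hx => symAct_frobPow q (g : LinearMap.GeneralLinearGroup k V) hx)

/-- `S / 𝔪^[q]` contains all irreducible representations of `G` over `k` as direct summands.
(`G` is finite where this is used, so that every irreducible representation is
finite-dimensional and hence isomorphic to one in the universe of `k`.) -/
def ContainsAllIrreps (q : ℕ) : Prop :=
  ∀ (U : Type u) [AddCommGroup U] [Module k U] (ρ : Representation k G U), ρ.IsIrreducible →
    ∃ (i : Representation.IntertwiningMap ρ (quotRep G q))
      (r : Representation.IntertwiningMap (quotRep G q) ρ), ∀ x : U, r (i x) = x

end QuotientSing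

end

namespace QuotientSing

section

open CategoryTheory TensorProduct RingTheory.Sequence

universe u v w

/-! ### Projective dimension of modules and global dimension. -/

section ProjDim

variable {R : Type w} [Ring R]

/-! Let `H` be the normal subgroup of `G` generated by its pseudoreflections, `B = S^H` and `Γ =
G/H`, so that `R ⊆ B ⊆ S` and `R = B^Γ`. By Chevalley–Shephard–Todd, `S` is free over `B`
(`free_of_isReflection`), and the Reynolds operator makes `B` a summand of `S`. The group `Γ` acts
on `B` without ramification in codimension one, because inertia at a prime of `S` comes from
reflections and these have been absorbed into `H`. Auslander's theorem then identifies the skew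
group ring of `Γ` over `B` with `End_R(B)` (`bijective_skewMap_fixedPoints`).

Frobenius turns the `R^q`-module `R` into the `R`-module `X = FrobTwist R p e`, that is `R` with
scalars acting through their `q`-th powers. The heart of the matter is that, for `q` large enough,
`X` and `B` are summands of finite sums of copies of each other. One direction holds because the
monomials with exponents below `q` are a basis of `S` over `S^q` and `R` splits off `S`
(`inAdd_frobTwist`). In the other direction, largeness makes `k[G]` act faithfully on `S/𝔪^[q]`.
This yields finitely many polynomials and `S^q`-coordinates that pick out the identity of `G` inside
the trace, and hence a splitting of copies of `X` onto `S` (`exists_dual_family`,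
`inAdd_mvPolynomial_frobTwist`).

The homological conclusions follow formally. The bimodule `Hom_R(B, X)`, with the Casimir element `∑
γ ⊗ γ⁻¹` divided by `#Γ`, bounds the global dimension of `End_R(X)` by that of `B`
(`globalDimension_end_le`). That of `B` is bounded by that of `S`, which is at most `d` since every
maximal ideal is generated by a regular sequence of length `d`
(`globalDimension_le_of_maxIdealsRegular`). Moreover `End_R(X)` is an `R`-summand of a finite sum of
copies of `S`. It is therefore Cohen–Macaulay over `R`, and a regular sequence of `d` central
elements forces global dimension at least `d` (`length_le_globalDimension`).

For the completion, all these ingredients are carried along the flat map from `R` to `R̂`: the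
Frobenius module commutes with completion (`nonempty_frobTwist_adicCompletion_equiv`), and `R̂ ⊗ S`
still has its maximal ideals generated by regular sequences of length `d`.

Largeness for `q ≥ #G` comes from interpolation. A product of `#G - 1` affine-linear forms vanishes
at all but one point of a free `G`-orbit, so its conjugates are linearly independent. Their degrees
are below `q`, so they remain independent modulo `𝔪^[q]` and span a regular representation
(`exists_linearIndependent_quotRep`). -/

theorem shortExact_of_exact {M N L : Type w} [AddCommGroup M] [Module R M] [AddCommGroup N]
    [Module R N] [AddCommGroup L] [Module R L] (f : M →ₗ[R] N) (g : N →ₗ[R] L)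
    (hf : Function.Injective f) (hfg : Function.Exact f g) (hg : Function.Surjective g) :
    (ShortComplex.mk (ModuleCat.ofHom f) (ModuleCat.ofHom g)
      (by ext x; exact hfg.apply_apply_eq_zero x)).ShortExact where
  exact := (ShortComplex.ShortExact.moduleCat_exact_iff_function_exact _).mpr hfg
  mono_f := (ModuleCat.mono_iff_injective _).mpr hf
  epi_g := (ModuleCat.epi_iff_surjective _).mpr hg

theorem hasProjectiveDimensionLE_of_linearRetract {M N : Type w} [AddCommGroup M] [Module R M]
    [AddCommGroup N] [Module R N] (i : M →ₗ[R] N) (r : N →ₗ[R] M) (h : r ∘ₗ i = LinearMap.id)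
    (n : ℕ) (hN : HasProjectiveDimensionLE (ModuleCat.of R N) n) :
    HasProjectiveDimensionLE (ModuleCat.of R M) n :=
  have : HasProjectiveDimensionLT (ModuleCat.of R N) (n + 1) := hN
  Retract.hasProjectiveDimensionLT
    (Y := ModuleCat.of R N) ⟨ModuleCat.ofHom i, ModuleCat.ofHom r, by
      rw [← ModuleCat.ofHom_comp, h]; rfl⟩ _

theorem projective_of_hasProjectiveDimensionLE_zero {M : Type w} [AddCommGroup M] [Module R M]
    (h : HasProjectiveDimensionLE (ModuleCat.of R M) 0) : Module.Projective R M := by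
  rwa [← projective_iff_hasProjectiveDimensionLE_zero, ← IsProjective.iff_projective] at h

theorem hasProjectiveDimensionLE_zero_of_projective {M : Type w} [AddCommGroup M] [Module R M]
    (h : Module.Projective R M) : HasProjectiveDimensionLE (ModuleCat.of R M) 0 := by
  rwa [← projective_iff_hasProjectiveDimensionLE_zero, ← IsProjective.iff_projective]

theorem globalDimension_le_iff (n : ℕ) : globalDimension R ≤ ((n : ℕ∞) : WithBot ℕ∞) ↔
    ∀ (M : Type w) [AddCommGroup M] [Module R M],
      HasProjectiveDimensionLE (ModuleCat.of R M) n := by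
  rw [globalDimension, iSup_le_iff]
  refine ⟨fun h M _ _ ↦ ?_, fun h M ↦ ?_⟩
  · exact (projectiveDimension_le_iff _ _).mp (h (ModuleCat.of R M))
  · exact (projectiveDimension_le_iff _ _).mpr (h M)

end ProjDim

/-! ### Transfer of projective dimension along a bimodule. -/

section Tensor

variable {C D : Type w} [CommRing C] [Ring D] (P : Type w) [AddCommGroup P] [Module C P]
  [Module D P] [SMulCommClass C D P]

/-- Functoriality of `P ⊗[C] -` for a `D`-`C`-bimodule `P`. -/
def tensorMap {M N : Type w} [AddCommGroup M] [Module C M] [AddCommGroup N] [Module C N]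
    (f : M →ₗ[C] N) : P ⊗[C] M →ₗ[D] P ⊗[C] N where
  toFun := f.lTensor P
  map_add' := map_add _
  map_smul' d x := by
    induction x with
    | zero => simp
    | add x y hx hy => simp only [smul_add, map_add, hx, hy]
    | tmul p m => simp [TensorProduct.smul_tmul']

@[simp]
theorem tensorMap_tmul {M N : Type w} [AddCommGroup M] [Module C M] [AddCommGroup N] [Module C N]
    (f : M →ₗ[C] N) (p : P) (m : M) : tensorMap (D := D) P f (p ⊗ₜ m) = p ⊗ₜ f m := rfl

/-- `N` is a summand of the free module on its own elements, and tensoring that free module with `P`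
gives a direct sum of copies of `P`. -/
theorem tensor_projective [Module.Projective D P] (N : Type w) [AddCommGroup N] [Module C N]
    [Module.Projective C N] : Module.Projective D (P ⊗[C] N) := by
  classical
  obtain ⟨s, hs⟩ := Module.projective_def'.mp (inferInstance : Module.Projective C N)
  let e : (N →₀ P) →ₗ[D] P ⊗[C] (N →₀ C) := Finsupp.lsum ℕ fun n ↦
    { toFun := fun p ↦ p ⊗ₜ Finsupp.single n 1
      map_add' := fun p q ↦ TensorProduct.add_tmul _ _ _
      map_smul' := fun d p ↦ (TensorProduct.smul_tmul' _ _ _).symm }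
  let e' : P ⊗[C] (N →₀ C) →ₗ[D] (N →₀ P) :=
    { toFun := TensorProduct.finsuppScalarRight C C P N
      map_add' := map_add _
      map_smul' := fun d x ↦ by
        induction x with
        | zero => simp
        | add x y hx hy => simp only [smul_add, map_add, hx, hy]
        | tmul p m =>
          ext n
          simp [TensorProduct.smul_tmul', TensorProduct.finsuppScalarRight_apply_tmul_apply,
            smul_comm] }
  have hee' : e ∘ₗ e' = LinearMap.id := by
    ext x
    induction x with
    | zero => simp
    | add x y hx hy => rw [map_add, hx, hy, map_add]
    | tmul p m =>
      induction m using Finsupp.induction_linear with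
      | zero => simp
      | add x y hx hy => rw [TensorProduct.tmul_add, map_add, hx, hy, map_add]
      | single n c =>
        simp only [LinearMap.comp_apply, LinearMap.id_apply]
        have : e' (p ⊗ₜ Finsupp.single n c) = Finsupp.single n (c • p) := by
          ext m
          simp only [e', LinearMap.coe_mk, AddHom.coe_mk]
          rw [TensorProduct.finsuppScalarRight_apply_tmul_apply]
          by_cases h : n = m
          · subst h; simp
          · simp [h]
        rw [this]
        simp only [e, Finsupp.lsum_apply, Finsupp.sum_single_index, map_zero]
        refine (TensorProduct.smul_tmul _ _ _).trans ?_
        simp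
  have : Module.Projective D (N →₀ P) :=
    Module.Projective.of_equiv (finsuppLEquivDirectSum D P N).symm
  refine Module.Projective.of_split
    (e' ∘ₗ tensorMap (D := D) P s) (tensorMap (D := D) P (Finsupp.linearCombination C id) ∘ₗ e) ?_
  have h1 : tensorMap (D := D) P (Finsupp.linearCombination C id) ∘ₗ (e ∘ₗ e') ∘ₗ
      tensorMap (D := D) P s = LinearMap.id := by
    rw [hee']
    ext x
    induction x with
    | zero => simp
    | add x y hx hy => rw [map_add, hx, hy, map_add]
    | tmul p m =>
      simp only [LinearMap.comp_apply, LinearMap.id_apply, tensorMap_tmul]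
      rw [show Finsupp.linearCombination C id (s m) = m from LinearMap.congr_fun hs m]
  rw [← h1]; rfl

theorem exists_free_presentation (N : Type w) [AddCommGroup N] [Module C N] :
    ∃ (K F : Type w) (_ : AddCommGroup K) (_ : AddCommGroup F) (_ : Module C K) (_ : Module C F)
      (f : K →ₗ[C] F) (g : F →ₗ[C] N), Module.Free C F ∧ Function.Injective f ∧
        Function.Exact f g ∧ Function.Surjective g :=
  ⟨LinearMap.ker (Finsupp.linearCombination C (id : N → N)), N →₀ C, inferInstance, inferInstance,
    inferInstance, inferInstance, Submodule.subtype _, Finsupp.linearCombination C id,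
    inferInstance, Submodule.subtype_injective _, LinearMap.exact_subtype_ker_map _,
    Finsupp.linearCombination_id_surjective C N⟩

/-- Dimension shifting: flatness keeps a free presentation exact after tensoring, and its middle
term becomes `D`-projective. -/
theorem hasProjectiveDimensionLE_tensor [Module.Flat C P] [Module.Projective D P] (n : ℕ)
    (N : Type w) [AddCommGroup N] [Module C N]
    (h : HasProjectiveDimensionLE (ModuleCat.of C N) n) :
    HasProjectiveDimensionLE (ModuleCat.of D (P ⊗[C] N)) n := by
  induction n generalizing N with
  | zero =>
    have := projective_of_hasProjectiveDimensionLE_zero h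
    exact hasProjectiveDimensionLE_zero_of_projective (tensor_projective P N)
  | succ n ih =>
    obtain ⟨K, F, _, _, _, _, f, g, hF, hf, hfg, hg⟩ := exists_free_presentation (C := C) N
    have hS := shortExact_of_exact f g hf hfg hg
    have hT := shortExact_of_exact (R := D) (tensorMap P f) (tensorMap P g)
      (Module.Flat.lTensor_preserves_injective_linearMap f hf)
      (lTensor_exact P hfg hg) (LinearMap.lTensor_surjective P hg)
    have p1 : Projective (ModuleCat.of C F) := (IsProjective.iff_projective _).mp inferInstance
    have p2 : Projective (ModuleCat.of D (P ⊗[C] F)) :=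
      (IsProjective.iff_projective _).mp (tensor_projective P _)
    exact (hT.hasProjectiveDimensionLT_X₃_iff n p2).mpr
      (ih _ ((hS.hasProjectiveDimensionLT_X₃_iff n p1).mp h))

/-- This device is used twice: for the Morita-type comparison of `End_R(X)` with `B`, and for
passing from `T` down to its summand `B`. -/
theorem globalDimension_le_of_retract_tensor [Module.Flat C P] [Module.Projective D P] (n : ℕ)
    (hC : globalDimension C ≤ ((n : ℕ∞) : WithBot ℕ∞))
    (hP : ∀ (M : Type w) [AddCommGroup M] [Module D M], ∃ (N : Type w) (_ : AddCommGroup N)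
      (_ : Module C N) (i : M →ₗ[D] P ⊗[C] N) (r : P ⊗[C] N →ₗ[D] M), r ∘ₗ i = LinearMap.id) :
    globalDimension D ≤ ((n : ℕ∞) : WithBot ℕ∞) := by
  rw [globalDimension_le_iff] at hC ⊢
  intro M _ _
  obtain ⟨N, _, _, i, r, h⟩ := hP M
  exact hasProjectiveDimensionLE_of_linearRetract i r h n
    (hasProjectiveDimensionLE_tensor P n N (hC N))

end Tensor

/-! ### Summands of finite direct sums of copies of a module. -/

section InAdd

/-- `M` is a direct summand of a finite direct sum of copies of `N`. -/
def InAdd (R : Type*) [Ring R] (M N : Type*) [AddCommGroup M] [Module R M] [AddCommGroup N]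
    [Module R N] : Prop :=
  ∃ (n : ℕ) (p : Fin n → N →ₗ[R] M) (q : Fin n → M →ₗ[R] N), ∀ x, ∑ i, p i (q i x) = x

variable {R : Type*} [Ring R] {M N L : Type*} [AddCommGroup M] [Module R M] [AddCommGroup N]
  [Module R N] [AddCommGroup L] [Module R L]

theorem InAdd.of_fintype {ι : Type*} [Fintype ι] (p : ι → N →ₗ[R] M) (q : ι → M →ₗ[R] N)
    (h : ∀ x, ∑ i, p i (q i x) = x) : InAdd R M N := by
  let e := Fintype.equivFin ι
  refine ⟨Fintype.card ι, fun i ↦ p (e.symm i), fun i ↦ q (e.symm i), fun x ↦ ?_⟩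
  exact (e.symm.sum_comp (fun i ↦ p i (q i x))).trans (h x)

theorem InAdd.of_retract (p : N →ₗ[R] M) (q : M →ₗ[R] N) (h : ∀ x, p (q x) = x) : InAdd R M N :=
  InAdd.of_fintype (ι := Unit) (fun _ ↦ p) (fun _ ↦ q) (by simpa using h)

theorem InAdd.of_equiv (e : M ≃ₗ[R] N) : InAdd R M N :=
  .of_retract e.symm e e.symm_apply_apply

theorem InAdd.trans (h : InAdd R M N) (h' : InAdd R N L) : InAdd R M L := by
  obtain ⟨n, p, q, h⟩ := h
  obtain ⟨n', p', q', h'⟩ := h'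
  refine InAdd.of_fintype (ι := Fin n × Fin n') (fun i ↦ p i.1 ∘ₗ p' i.2)
    (fun i ↦ q' i.2 ∘ₗ q i.1) fun x ↦ ?_
  rw [Fintype.sum_prod_type]
  simp only [LinearMap.comp_apply, ← map_sum, h', h]

theorem InAdd.pi {ι : Type*} [Fintype ι] : InAdd R (ι → N) N := by
  classical
  refine InAdd.of_fintype (ι := ι) (fun i ↦ LinearMap.single R (fun _ ↦ N) i)
    (fun i ↦ LinearMap.proj i) ?_
  intro x
  simp [LinearMap.single_apply, Finset.univ_sum_single]

theorem InAdd.exists_retract (h : InAdd R M N) : ∃ (n : ℕ) (p : (Fin n → N) →ₗ[R] M)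
    (q : M →ₗ[R] Fin n → N), ∀ x, p (q x) = x := by
  obtain ⟨n, p, q, h⟩ := h
  exact ⟨n, LinearMap.lsum R (fun _ ↦ N) ℕ p, LinearMap.pi q, fun x ↦ by simpa using h x⟩

theorem InAdd.projective (h : InAdd R M R) : Module.Projective R M := by
  obtain ⟨n, p, q, h⟩ := h.exists_retract
  exact Module.Projective.of_split q p (LinearMap.ext h)

theorem InAdd.finite [Module.Finite R N] (h : InAdd R M N) : Module.Finite R M := by
  obtain ⟨n, p, q, h⟩ := h.exists_retract
  exact Module.Finite.of_surjective p (fun x ↦ ⟨q x, h x⟩)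

theorem InAdd.baseChange {R : Type*} [CommRing R] {M N : Type*} [AddCommGroup M] [Module R M]
    [AddCommGroup N] [Module R N] (R' : Type*) [CommRing R'] [Algebra R R'] (h : InAdd R M N) :
    InAdd R' (R' ⊗[R] M) (R' ⊗[R] N) := by
  obtain ⟨n, p, q, h⟩ := h
  refine ⟨n, fun i ↦ (p i).baseChange R', fun i ↦ (q i).baseChange R', fun x ↦ ?_⟩
  induction x with
  | zero => simp
  | add x y hx hy => simp only [map_add, Finset.sum_add_distrib, hx, hy]
  | tmul a m => simp only [LinearMap.baseChange_tmul, ← TensorProduct.tmul_sum, h]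

end InAdd

/-! ### Endomorphism rings and skew group rings: bounding the global dimension. -/

section Morita

variable {R B X : Type w} [CommRing R] [CommRing B] [Algebra R B] [AddCommGroup X] [Module R X]
  {Γ : Type*} [Group Γ] [Fintype Γ] (ρ : Γ →* (B ≃ₐ[R] B))

/-- The `R`-linear endomorphism `∑ c γ · γ` of `B`. -/
def skewMap : (Γ → B) →+ Module.End R B where
  toFun c := ∑ γ, LinearMap.mulLeft R (c γ) ∘ₗ (ρ γ).toLinearMap
  map_zero' := by ext; simp
  map_add' c d := by ext; simp [add_mul, Finset.sum_add_distrib]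

@[simp]
theorem skewMap_apply (c : Γ → B) (b : B) : skewMap ρ c b = ∑ γ, c γ * ρ γ b := by
  simp [skewMap]

/-- `Hom_R(B, X)` as a bimodule over `End_R(X)` and `B`. -/
def HomBim (R B X : Type w) [CommRing R] [CommRing B] [Algebra R B] [AddCommGroup X]
    [Module R X] : Type w := B →ₗ[R] X

namespace HomBim

instance : AddCommGroup (HomBim R B X) := inferInstanceAs (AddCommGroup (B →ₗ[R] X))

/-- The underlying linear map. -/
def hom : HomBim R B X ≃+ (B →ₗ[R] X) := AddEquiv.refl (B →ₗ[R] X)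

theorem ext {f g : HomBim R B X} (h : ∀ b, hom f b = hom g b) : f = g :=
  LinearMap.ext h

instance : Module (Module.End R X) (HomBim R B X) where
  smul d f := hom.symm (d ∘ₗ hom f)
  one_smul _ := rfl
  mul_smul _ _ _ := rfl
  smul_zero d := LinearMap.comp_zero d
  smul_add d _ _ := LinearMap.comp_add _ _ d
  add_smul _ _ _ := LinearMap.add_comp _ _ _
  zero_smul _ := LinearMap.zero_comp _

@[simp]
theorem hom_symm_apply (f : B →ₗ[R] X) : hom (hom.symm f) = f := rfl

@[simp]
theorem hom_end_smul (d : Module.End R X) (f : HomBim R B X) (b : B) :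
    hom (d • f) b = d (hom f b) := rfl

instance : SMul B (HomBim R B X) where
  smul b f := hom.symm (hom f ∘ₗ LinearMap.mulLeft R b)

@[simp]
theorem hom_smul (b : B) (f : HomBim R B X) (x : B) : hom (b • f) x = hom f (b * x) := rfl

instance : Module B (HomBim R B X) where
  one_smul f := ext fun x ↦ by simp
  mul_smul a b f := ext fun x ↦ by simp [mul_left_comm b a, mul_assoc]
  smul_zero b := ext fun x ↦ by simp
  smul_add b f g := ext fun x ↦ by simp
  add_smul a b f := ext fun x ↦ by simp [add_mul]
  zero_smul f := ext fun x ↦ by simp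

instance : SMulCommClass B (Module.End R X) (HomBim R B X) := ⟨fun _ _ _ ↦ rfl⟩

/-- `Hom_R(B, X)` is a summand of a power of `Hom_R(B, B)`, and the latter is free for
precomposition by `B`, since `γ ∘ b = γ(b) · γ`. -/
theorem projective_right (hΓ : Function.Bijective (skewMap ρ)) (h : InAdd R X B) :
    Module.Projective B (HomBim R B X) := by
  obtain ⟨n, p, q, h⟩ := h
  let e := AddEquiv.ofBijective (skewMap ρ) hΓ
  have he (c) (b : B) : e c b = ∑ γ, c γ * ρ γ b := skewMap_apply ρ c b
  have key (f : Module.End R B) (b : B) :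
      e.symm (f ∘ₗ LinearMap.mulLeft R b) = fun γ ↦ e.symm f γ * ρ γ b := by
    rw [AddEquiv.symm_apply_eq]
    ext x
    change f (b * x) = _
    rw [he]
    nth_rewrite 1 [← e.apply_symm_apply f]
    rw [he]
    refine Finset.sum_congr rfl fun γ _ ↦ ?_
    rw [map_mul (ρ γ), mul_assoc]
  let i : HomBim R B X →ₗ[B] (Fin n → Γ → B) :=
    -- Precomposing with `b` multiplies the `γ`-coefficient by `γ(b)`. Applying `γ⁻¹` to the
    -- coefficients makes the map `B`-linear.
    { toFun f j γ := (ρ γ).symm (e.symm (q j ∘ₗ hom f) γ)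
      map_add' f g := by
        ext j γ
        simp [LinearMap.comp_add]
      map_smul' b f := by
        ext j γ
        have : q j ∘ₗ hom (b • f) = (q j ∘ₗ hom f) ∘ₗ LinearMap.mulLeft R b := rfl
        simp [this, key, mul_comm] }
  let r : (Fin n → Γ → B) →ₗ[B] HomBim R B X :=
    { toFun c := hom.symm (∑ j, p j ∘ₗ (e (fun γ ↦ ρ γ (c j γ)) : B →ₗ[R] B))
      map_add' c d := ext fun x ↦ by
        simp [he, add_mul, Finset.sum_add_distrib]
      map_smul' b c := ext fun x ↦ by
        simp [he, mul_left_comm, mul_assoc] }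
  refine Module.Projective.of_split i r (LinearMap.ext fun f ↦ ext fun x ↦ ?_)
  simp only [i, r, LinearMap.comp_apply, LinearMap.coe_mk, AddHom.coe_mk,
    AlgEquiv.apply_symm_apply, hom_symm_apply, LinearMap.sum_apply, LinearMap.id_apply]
  conv_rhs => rw [← h (hom f x)]
  refine Finset.sum_congr rfl fun j _ ↦ ?_
  change p j (e (e.symm (q j ∘ₗ hom f)) x) = _
  rw [e.apply_symm_apply]; rfl

/-- Applying `Hom_R(-, X)` to a splitting of `X^n` onto `B` exhibits `Hom_R(B, X)` as a summand of
`End_R(X)^n`. -/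
theorem projective_left (h : InAdd R B X) :
    Module.Projective (Module.End R X) (HomBim R B X) := by
  obtain ⟨n, p, q, h⟩ := h
  apply InAdd.projective
  refine ⟨n, fun j ↦
    { toFun d := hom.symm (d ∘ₗ q j)
      map_add' d e := LinearMap.add_comp _ _ _
      map_smul' d e := rfl }, fun j ↦
    { toFun f := hom f ∘ₗ p j
      map_add' d e := LinearMap.add_comp _ _ _
      map_smul' d e := rfl }, fun f ↦ ext fun x ↦ ?_⟩
  rw [map_sum, LinearMap.sum_apply]
  change ∑ j, hom f (p j (q j x)) = _
  rw [← map_sum, h]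

variable {M : Type w} [AddCommGroup M] [Module (Module.End R X) M]

/-- `Hom_D(Hom_R(B, X), M)`, `D = End_R(X)`, as a `B`-module. -/
def Dual (R B X M : Type w) [CommRing R] [CommRing B] [Algebra R B] [AddCommGroup X]
    [Module R X] [AddCommGroup M] [Module (Module.End R X) M] : Type w :=
  HomBim R B X →ₗ[Module.End R X] M

namespace Dual

instance : AddCommGroup (Dual R B X M) :=
  inferInstanceAs (AddCommGroup (HomBim R B X →ₗ[Module.End R X] M))

/-- The underlying linear map. -/
def hom : Dual R B X M ≃+ (HomBim R B X →ₗ[Module.End R X] M) :=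
  AddEquiv.refl (HomBim R B X →ₗ[Module.End R X] M)

theorem ext {f g : Dual R B X M} (h : ∀ b, hom f b = hom g b) : f = g :=
  LinearMap.ext h

@[simp]
theorem hom_symm_apply (f : HomBim R B X →ₗ[Module.End R X] M) : hom (hom.symm f) = f := rfl

instance : SMul B (Dual R B X M) where
  smul b φ := hom.symm
    { toFun p := hom φ (b • p)
      map_add' p q := by rw [smul_add, map_add]
      map_smul' d p := by rw [smul_comm, map_smul]; rfl }

@[simp]
theorem hom_smul (b : B) (φ : Dual R B X M) (p : HomBim R B X) :
    hom (b • φ) p = hom φ (b • p) := rfl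

instance : Module B (Dual R B X M) where
  one_smul f := ext fun x ↦ by simp
  mul_smul a b f := ext fun x ↦ by simp [mul_comm a b, mul_smul]
  smul_zero b := ext fun x ↦ by simp
  smul_add b f g := ext fun x ↦ by simp
  add_smul a b f := ext fun x ↦ by simp [add_smul]
  zero_smul f := ext fun x ↦ by simp

/-- The evaluation map. -/
def eval : HomBim R B X ⊗[B] Dual R B X M →ₗ[Module.End R X] M where
  toFun := TensorProduct.liftAddHom
    { toFun p := { toFun φ := hom φ p
                   map_zero' := by simp
                   map_add' φ ψ := by simp }
      map_zero' := by ext; simp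
      map_add' p q := by ext; simp } (fun b p φ ↦ rfl)
  map_add' := map_add _
  map_smul' d x := by
    induction x with
    | zero => simp
    | add x y hx hy => simp only [smul_add, map_add, hx, hy]
    | tmul p φ => exact map_smul (hom φ) d p

@[simp]
theorem eval_tmul (p : HomBim R B X) (φ : Dual R B X M) : eval (p ⊗ₜ[B] φ) = hom φ p := rfl

/-- The element `p ↦ (p f) m` of `Hom_D(Hom_R(B, X), M)`, for `f : X → B`. -/
def mk (f : X →ₗ[R] B) : M →+ Dual R B X M where
  toFun m := hom.symm
    { toFun p := (HomBim.hom p ∘ₗ f : Module.End R X) • m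
      map_add' p q := by rw [map_add, LinearMap.add_comp]; exact add_smul _ _ _
      map_smul' d p := by rw [RingHom.id_apply, ← mul_smul]; rfl }
  map_zero' := ext fun p ↦ smul_zero (A := M) _
  map_add' m n := ext fun p ↦ smul_add (A := M) _ _ _

theorem hom_mk (f : X →ₗ[R] B) (m : M) (p : HomBim R B X) :
    hom (mk f m) p = (HomBim.hom p ∘ₗ f : Module.End R X) • m := rfl

theorem smul_mk (b : B) (f : X →ₗ[R] B) (m : M) :
    b • mk f m = mk (LinearMap.mulLeft R b ∘ₗ f) m := rfl

theorem mk_smul (f : X →ₗ[R] B) (d : Module.End R X) (m : M) :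
    mk f (d • m) = mk (f ∘ₗ d) m :=
  ext fun p ↦ (mul_smul (HomBim.hom p ∘ₗ f : Module.End R X) d m).symm

theorem mk_sum {ι : Type*} (s : Finset ι) (f : ι → X →ₗ[R] B) (m : M) :
    mk (∑ i ∈ s, f i) m = ∑ i ∈ s, mk (f i) m := by
  refine ext fun p ↦ ?_
  simp only [map_sum, LinearMap.sum_apply, hom_mk]
  rw [← Finset.sum_smul]
  congr 1
  ext x
  simp

end Dual

/-- The element `γ`, twisted by `p : B → X`. -/
def tw (p : B →ₗ[R] X) : Module.End R B →+ HomBim R B X where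
  toFun f := hom.symm (p ∘ₗ f)
  map_zero' := LinearMap.comp_zero _
  map_add' f g := LinearMap.comp_add f g _

theorem hom_tw (p : B →ₗ[R] X) (f : Module.End R B) : hom (tw p f) = p ∘ₗ f := rfl

theorem smul_tw (b : B) (p : B →ₗ[R] X) (f : Module.End R B) :
    b • tw p f = tw p (f ∘ₗ LinearMap.mulLeft R b) := rfl

theorem end_smul_tw (d : Module.End R X) (p : B →ₗ[R] X) (f : Module.End R B) :
    d • tw p f = tw (d ∘ₗ p) f := rfl

theorem tw_sum {ι : Type*} (s : Finset ι) (p : ι → B →ₗ[R] X) (f : Module.End R B) :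
    tw (∑ i ∈ s, p i) f = ∑ i ∈ s, tw (p i) f := by
  refine ext fun x ↦ ?_
  simp only [map_sum, LinearMap.sum_apply, hom_tw, LinearMap.comp_apply]

/-- The Casimir element `∑ γ ⊗ γ⁻¹` commutes with all endomorphisms of `B`. -/
theorem casimir_comm (hΓ : Function.Surjective (skewMap ρ)) (p : B →ₗ[R] X) (q : X →ₗ[R] B) (m : M)
    (f : Module.End R B) :
    ∑ γ, tw p (f ∘ₗ (ρ γ).toLinearMap) ⊗ₜ[B] Dual.mk ((ρ γ⁻¹).toLinearMap ∘ₗ q) m =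
      ∑ γ, tw p (ρ γ).toLinearMap ⊗ₜ[B] Dual.mk ((ρ γ⁻¹).toLinearMap ∘ₗ f ∘ₗ q) m := by
  obtain ⟨c, rfl⟩ := hΓ f
  have hinv (γ : Γ) (b : B) : ρ γ (ρ γ⁻¹ b) = b := by
    rw [← AlgEquiv.mul_apply, ← map_mul, mul_inv_cancel, map_one, AlgEquiv.one_apply]
  have hmul (γ δ : Γ) (b : B) : ρ (γ * δ) b = ρ γ (ρ δ b) := by
    rw [map_mul, AlgEquiv.mul_apply]
  have h1 (γ : Γ) : tw p (skewMap ρ c ∘ₗ (ρ γ).toLinearMap) ⊗ₜ[B]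
      Dual.mk ((ρ γ⁻¹).toLinearMap ∘ₗ q) m =
      ∑ δ, tw p (ρ (δ * γ)).toLinearMap ⊗ₜ[B]
        Dual.mk ((ρ (δ * γ)⁻¹).toLinearMap ∘ₗ LinearMap.mulLeft R (c δ) ∘ₗ (ρ δ).toLinearMap ∘ₗ q)
          m := by
    -- The coefficient `c δ` is moved to the right of `δγ`, where it acts as a scalar of `B` and can
    -- cross the tensor sign. Reindexing `γ ↦ δγ` then matches the two sums.
    have : skewMap ρ c ∘ₗ (ρ γ).toLinearMap = ∑ δ, (ρ (δ * γ)).toLinearMap ∘ₗ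
        LinearMap.mulLeft R (ρ (δ * γ)⁻¹ (c δ)) := by
      ext x
      simp only [LinearMap.comp_apply, skewMap_apply, AlgEquiv.toLinearMap_apply,
        LinearMap.sum_apply, LinearMap.mulLeft_apply]
      refine Finset.sum_congr rfl fun δ _ ↦ ?_
      rw [map_mul (ρ (δ * γ)), hinv, hmul]
    rw [this, map_sum, TensorProduct.sum_tmul]
    refine Finset.sum_congr rfl fun δ _ ↦ ?_
    rw [← smul_tw, TensorProduct.smul_tmul, Dual.smul_mk]
    refine congrArg (fun f ↦ _ ⊗ₜ[B] Dual.mk f m) (LinearMap.ext fun x ↦ ?_)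
    simp only [LinearMap.comp_apply, AlgEquiv.toLinearMap_apply, LinearMap.mulLeft_apply]
    rw [map_mul (ρ (δ * γ)⁻¹), mul_inv_rev, hmul _ _ (ρ δ _)]
    congr 2
    rw [← hmul, inv_mul_cancel, map_one, AlgEquiv.one_apply]
  have h2 (γ : Γ) : tw p (ρ γ).toLinearMap ⊗ₜ[B]
      Dual.mk ((ρ γ⁻¹).toLinearMap ∘ₗ skewMap ρ c ∘ₗ q) m =
      ∑ δ, tw p (ρ γ).toLinearMap ⊗ₜ[B]
        Dual.mk ((ρ γ⁻¹).toLinearMap ∘ₗ LinearMap.mulLeft R (c δ) ∘ₗ (ρ δ).toLinearMap ∘ₗ q) m := by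
    rw [← TensorProduct.tmul_sum, ← Dual.mk_sum]
    refine congrArg (fun f ↦ _ ⊗ₜ[B] Dual.mk f m) (LinearMap.ext fun x ↦ ?_)
    simp
  simp only [h1, h2]
  rw [Finset.sum_comm]
  conv_rhs => rw [Finset.sum_comm]
  refine Finset.sum_congr rfl fun δ _ ↦ ?_
  exact Equiv.sum_comp (Equiv.mulLeft δ) (fun γ ↦ tw p (ρ γ).toLinearMap ⊗ₜ[B]
        Dual.mk ((ρ γ⁻¹).toLinearMap ∘ₗ LinearMap.mulLeft R (c δ) ∘ₗ (ρ δ).toLinearMap ∘ₗ q) m)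

/-- This is separability of a skew group ring with invertible group order. The Casimir element gives
an `End_R(X)`-linear map into the tensor product, and evaluating afterwards is multiplication by
`#Γ`. -/
theorem exists_retract (hΓ : Function.Surjective (skewMap ρ)) (h : InAdd R X B)
    (hu : IsUnit (Fintype.card Γ : Module.End R X)) (M : Type w) [AddCommGroup M]
    [Module (Module.End R X) M] :
    ∃ (i : M →ₗ[Module.End R X] HomBim R B X ⊗[B] Dual R B X M)
      (r : HomBim R B X ⊗[B] Dual R B X M →ₗ[Module.End R X] M), r ∘ₗ i = LinearMap.id := by
  obtain ⟨n, p, q, h⟩ := h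
  obtain ⟨u, hu⟩ := hu
  let σ : M →ₗ[Module.End R X] HomBim R B X ⊗[B] Dual R B X M :=
    { toFun m := ∑ j, ∑ γ, tw (p j) (ρ γ).toLinearMap ⊗ₜ[B]
        Dual.mk ((ρ γ⁻¹).toLinearMap ∘ₗ q j) m
      map_add' m m' := by simp [TensorProduct.tmul_add, Finset.sum_add_distrib]
      map_smul' d m := by
        -- Through the splitting, `d` becomes the matrix of endomorphisms `q l ∘ d ∘ p j` of `B`,
        -- and the Casimir identity applies to each entry.
        have hd (j) : d ∘ₗ p j = ∑ l, p l ∘ₗ (q l ∘ₗ d ∘ₗ p j) := by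
          ext x; simp [h]
        have hd' (l) : q l ∘ₗ d = ∑ j, (q l ∘ₗ d ∘ₗ p j) ∘ₗ q j := by
          ext x
          simp only [LinearMap.comp_apply, LinearMap.sum_apply]
          rw [← map_sum, ← map_sum, h]
        have e1 : ∑ l, ∑ γ, tw (p l) (ρ γ).toLinearMap ⊗ₜ[B]
            Dual.mk ((ρ γ⁻¹).toLinearMap ∘ₗ q l) (d • m) =
            ∑ l, ∑ j, ∑ γ, tw (p l) (ρ γ).toLinearMap ⊗ₜ[B]
            Dual.mk ((ρ γ⁻¹).toLinearMap ∘ₗ (q l ∘ₗ d ∘ₗ p j) ∘ₗ q j) m := by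
          refine Finset.sum_congr rfl fun l _ ↦ ?_
          rw [Finset.sum_comm]
          refine Finset.sum_congr rfl fun γ _ ↦ ?_
          rw [← TensorProduct.tmul_sum, ← Dual.mk_sum, Dual.mk_smul, LinearMap.comp_assoc, hd' l]
          refine congrArg (fun f ↦ _ ⊗ₜ[B] Dual.mk f m) (LinearMap.ext fun x ↦ ?_)
          simp
        have e2 : d • ∑ j, ∑ γ, tw (p j) (ρ γ).toLinearMap ⊗ₜ[B]
            Dual.mk ((ρ γ⁻¹).toLinearMap ∘ₗ q j) m =
            ∑ j, ∑ l, ∑ γ, tw (p l) ((q l ∘ₗ d ∘ₗ p j) ∘ₗ (ρ γ).toLinearMap) ⊗ₜ[B]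
            Dual.mk ((ρ γ⁻¹).toLinearMap ∘ₗ q j) m := by
          rw [Finset.smul_sum]
          refine Finset.sum_congr rfl fun j _ ↦ ?_
          rw [Finset.sum_comm, Finset.smul_sum]
          refine Finset.sum_congr rfl fun γ _ ↦ ?_
          rw [← TensorProduct.sum_tmul, TensorProduct.smul_tmul', end_smul_tw]
          refine congrArg (fun f ↦ f ⊗ₜ[B] _) ?_
          conv_lhs => rw [hd j, tw_sum]
          rfl
        rw [RingHom.id_apply, e1, e2, Finset.sum_comm]
        refine Finset.sum_congr rfl fun j _ ↦ Finset.sum_congr rfl fun l _ ↦ ?_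
        exact (casimir_comm ρ hΓ (p l) (q j) m (q l ∘ₗ d ∘ₗ p j)).symm }
  have hσ (m : M) : Dual.eval (σ m) = (Fintype.card Γ : Module.End R X) • m := by
    simp only [σ, LinearMap.coe_mk, AddHom.coe_mk, map_sum, Dual.eval_tmul, Dual.hom_mk, hom_tw]
    rw [Finset.sum_comm]
    have (γ : Γ) : ∑ j, ((p j ∘ₗ (ρ γ).toLinearMap) ∘ₗ (ρ γ⁻¹).toLinearMap ∘ₗ q j :
        Module.End R X) • m = m := by
      rw [← Finset.sum_smul]
      conv_rhs => rw [← one_smul (Module.End R X) m]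
      congr 1
      ext x
      simp only [LinearMap.sum_apply, LinearMap.comp_apply, AlgEquiv.toLinearMap_apply,
        ← AlgEquiv.mul_apply, ← map_mul, mul_inv_cancel, map_one, AlgEquiv.one_apply, h,
        Module.End.one_apply]
    simp only [this, Finset.sum_const, Finset.card_univ]
    rw [Nat.cast_smul_eq_nsmul]
  have hcomm (d : Module.End R X) : (↑u⁻¹ : Module.End R X) * d = d * ↑u⁻¹ := by
    rw [Units.inv_mul_eq_iff_eq_mul, ← mul_assoc, Units.eq_mul_inv_iff_mul_eq, hu]
    exact (Nat.cast_commute _ _).symm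
  let ui : M →ₗ[Module.End R X] M :=
    { toFun m := (↑u⁻¹ : Module.End R X) • m
      map_add' _ _ := smul_add _ _ _
      map_smul' d m := by rw [← mul_smul, hcomm, mul_smul]; rfl }
  refine ⟨σ, ui ∘ₗ Dual.eval, LinearMap.ext fun m ↦ ?_⟩
  simp only [LinearMap.comp_apply, hσ, ui, LinearMap.coe_mk, AddHom.coe_mk, ← mul_smul, ← hu,
    Units.inv_mul, one_smul, LinearMap.id_apply]

end HomBim

theorem globalDimension_end_le (hΓ : Function.Bijective (skewMap ρ)) (h : InAdd R X B)
    (h' : InAdd R B X) (hu : IsUnit (Fintype.card Γ : R)) (n : ℕ)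
    (hB : globalDimension B ≤ ((n : ℕ∞) : WithBot ℕ∞)) :
    globalDimension (Module.End R X) ≤ ((n : ℕ∞) : WithBot ℕ∞) := by
  have := HomBim.projective_left h'
  have := HomBim.projective_right ρ hΓ h
  refine globalDimension_le_of_retract_tensor (HomBim R B X) n hB fun M _ _ ↦
    ⟨HomBim.Dual R B X M, inferInstance, inferInstance, ?_⟩
  refine HomBim.exists_retract ρ hΓ.2 h ?_ M
  simpa using hu.map (algebraMap R (Module.End R X))

/-- The global dimension does not increase when passing from `T` to a subring `B` such that `T` is
a finitely generated projective `B`-module and `B` is a direct summand of `T`. -/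
theorem globalDimension_le_of_projective_of_retraction {T : Type w} [CommRing T] [Algebra B T]
    [Module.Projective B T] (r : T →ₗ[B] B) (hr : r 1 = 1) (n : ℕ)
    (hT : globalDimension T ≤ ((n : ℕ∞) : WithBot ℕ∞)) :
    globalDimension B ≤ ((n : ℕ∞) : WithBot ℕ∞) := by
  -- `T` plays the role of the bimodule, and `r ⊗ M` retracts `T ⊗[B] M` onto `M`.
  refine globalDimension_le_of_retract_tensor (D := B) T n hT fun M _ _ ↦
    ⟨T ⊗[B] M, inferInstance, inferInstance, ?_⟩
  let e : T ⊗[T] (T ⊗[B] M) ≃ₗ[T] T ⊗[B] M := TensorProduct.lid T _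
  let e' : T ⊗[T] (T ⊗[B] M) ≃ₗ[B] T ⊗[B] M :=
    { e with
      map_smul' b x := by
        have : b • x = algebraMap B T b • x := by
          induction x with
          | zero => simp
          | add x y hx hy => rw [smul_add, hx, hy, smul_add]
          | tmul a c =>
            rw [TensorProduct.smul_tmul', TensorProduct.smul_tmul', algebra_compatible_smul T]
        simp only [this]
        simp }
  refine ⟨e'.symm ∘ₗ TensorProduct.mk B T M 1,
    TensorProduct.lid B M ∘ₗ TensorProduct.map r (LinearMap.id (M := M)) ∘ₗ e'.toLinearMap, LinearMap.ext fun m ↦ ?_⟩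
  simp [hr]

end Morita

/-! ### Global dimension is detected on cyclic modules. -/

section CyclicModules

variable {T : Type w} [CommRing T]

/-- The obstruction to extending a map `I → N` to all of `T` lies in `Ext¹(T/I, N)`. -/
theorem baer_of_subsingleton_ext_one (N : ModuleCat.{w} T)
    (h : ∀ I : Ideal T, Subsingleton (Abelian.Ext (ModuleCat.of T (T ⧸ I)) N 1)) :
    Module.Baer T N := by
  intro I g
  have hS := shortExact_of_exact (R := T) (M := I) (N := T) (L := T ⧸ I) I.subtype I.mkQ
    (Submodule.subtype_injective _) (LinearMap.exact_subtype_mkQ I) (Submodule.mkQ_surjective I)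
  obtain ⟨x, hx⟩ := Abelian.Ext.contravariant_sequence_exact₁ hS N
    (Abelian.Ext.mk₀ (ModuleCat.ofHom g : ModuleCat.of T I ⟶ N)) (add_zero 1)
    (@Subsingleton.elim _ (h I) _ _)
  obtain ⟨f, rfl⟩ := (Abelian.Ext.mk₀_bijective _ _).2 x
  rw [Abelian.Ext.mk₀_comp_mk₀, (Abelian.Ext.mk₀_bijective _ _).1.eq_iff] at hx
  refine ⟨f.hom, fun x hxI ↦ ?_⟩
  exact congrArg (fun φ : ModuleCat.of T I ⟶ N ↦ φ.hom ⟨x, hxI⟩) hx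

/-- Embedding `N` in an injective shifts the degree down by one, until Baer's criterion applies. -/
theorem hasInjectiveDimensionLT_of_cyclic (n : ℕ) (N : ModuleCat.{w} T)
    (h : ∀ I : Ideal T, Subsingleton (Abelian.Ext (ModuleCat.of T (T ⧸ I)) N (n + 1))) :
    HasInjectiveDimensionLT N (n + 1) := by
  induction n generalizing N with
  | zero =>
    rw [zero_add, ← injective_iff_hasInjectiveDimensionLT_one,
      ← Module.injective_iff_injective_object, ← Module.Baer.iff_injective]
    exact baer_of_subsingleton_ext_one N h
  | succ n ih =>
    obtain ⟨p⟩ := EnoughInjectives.presentation N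
    have hS : (ShortComplex.mk _ _ (Limits.cokernel.condition p.f)).ShortExact :=
      { exact := ShortComplex.exact_cokernel p.f }
    refine (hS.hasInjectiveDimensionLT_X₃_iff n p.injective).mp (ih _ fun I ↦ ?_)
    refine ⟨fun a b ↦ ?_⟩
    rw [← sub_eq_zero]
    obtain ⟨y, hy⟩ := Abelian.Ext.covariant_sequence_exact₃ (ModuleCat.of T (T ⧸ I)) hS (a - b) rfl
      (@Subsingleton.elim _ (h I) _ _)
    rw [← hy, Abelian.Ext.eq_zero_of_injective y, Abelian.Ext.zero_comp]

/-- Auslander's theorem: the global dimension is determined by the cyclic modules. -/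
theorem globalDimension_le_of_cyclic (n : ℕ)
    (h : ∀ I : Ideal T, HasProjectiveDimensionLE (ModuleCat.of T (T ⧸ I)) n) :
    globalDimension T ≤ ((n : ℕ∞) : WithBot ℕ∞) := by
  rw [globalDimension_le_iff]
  intro M _ _
  have hI (N : ModuleCat.{w} T) : HasInjectiveDimensionLT N (n + 1) :=
    hasInjectiveDimensionLT_of_cyclic n N fun I ↦
      have : HasProjectiveDimensionLT (ModuleCat.of T (T ⧸ I)) (n + 1) := h I
      HasProjectiveDimensionLT.subsingleton _ (n + 1) _ le_rfl _
  refine HasProjectiveDimensionLT.mk fun i hi N e ↦ ?_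
  have := hI N
  exact Abelian.Ext.eq_zero_of_hasInjectiveDimensionLT e (n + 1) hi

end CyclicModules

/-! ### Rings whose maximal ideals are generated by regular sequences. -/

section Regular

variable {T : Type w} [CommRing T]

/-- All maximal ideals of `T` are generated by a regular sequence of length `d`. -/
def MaxIdealsRegular (T : Type w) [CommRing T] (d : ℕ) : Prop :=
  ∀ m : Ideal T, m.IsMaximal → ∃ rs : List T, rs.length = d ∧ Ideal.ofList rs = m ∧
    IsWeaklyRegular T rs

theorem hasProjectiveDimensionLE_quotSMulTop {M : Type w} [AddCommGroup M] [Module T M] (x : T)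
    (hx : IsSMulRegular M x) (n : ℕ) (hM : HasProjectiveDimensionLE (ModuleCat.of T M) n) :
    HasProjectiveDimensionLE (ModuleCat.of T (QuotSMulTop x M)) (n + 1) := by
  have hx' : IsSMulRegular (ModuleCat.of T M) x := hx
  have hM' : HasProjectiveDimensionLT (ModuleCat.of T M) (n + 1) := hM
  exact hx'.smulShortComplex_shortExact.hasProjectiveDimensionLT_X₃ (n + 1) hM
    (hasProjectiveDimensionLT_of_ge (ModuleCat.of T M) (n + 1) (n + 2) (Nat.le_succ _))

theorem hasProjectiveDimensionLE_of_equiv {M N : Type w} [AddCommGroup M] [Module T M]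
    [AddCommGroup N] [Module T N] (e : M ≃ₗ[T] N) (n : ℕ)
    (hM : HasProjectiveDimensionLE (ModuleCat.of T M) n) :
    HasProjectiveDimensionLE (ModuleCat.of T N) n :=
  hasProjectiveDimensionLE_of_linearRetract e.symm.toLinearMap e.toLinearMap (by ext; simp) n hM

theorem hasProjectiveDimensionLE_quotient_ofList (rs : List T) {M : Type w} [AddCommGroup M]
    [Module T M] (h : IsWeaklyRegular M rs) (n : ℕ)
    (hM : HasProjectiveDimensionLE (ModuleCat.of T M) n) :
    HasProjectiveDimensionLE (ModuleCat.of T (M ⧸ Ideal.ofList rs • (⊤ : Submodule T M)))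
      (n + rs.length) := by
  induction rs generalizing M n with
  | nil =>
    refine hasProjectiveDimensionLE_of_equiv (Submodule.quotEquivOfEqBot _ ?_).symm n hM
    rw [Ideal.ofList_nil, Submodule.bot_smul]
  | cons x rs ih =>
    rw [isWeaklyRegular_cons_iff] at h
    have := ih h.2 (n + 1) (hasProjectiveDimensionLE_quotSMulTop x h.1 n hM)
    rw [List.length_cons, show n + (rs.length + 1) = n + 1 + rs.length by ring]
    exact hasProjectiveDimensionLE_of_equiv
      (Submodule.quotOfListConsSMulTopEquivQuotSMulTopInner M x rs).symm _ this

theorem hasProjectiveDimensionLE_quotient_maximal {d : ℕ} (hT : MaxIdealsRegular T d)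
    (m : Ideal T) (hm : m.IsMaximal) : HasProjectiveDimensionLE (ModuleCat.of T (T ⧸ m)) d := by
  obtain ⟨rs, rfl, rfl, hrs⟩ := hT m hm
  have := hasProjectiveDimensionLE_quotient_ofList rs hrs 0
    (hasProjectiveDimensionLE_zero_of_projective inferInstance)
  rw [zero_add] at this
  refine hasProjectiveDimensionLE_of_equiv (Submodule.quotEquivOfEq _ _ ?_) _ this
  simp

/-- Nakayama at a maximal ideal containing the annihilator produces an element that kills `E` and is
congruent to `1` modulo that ideal, a contradiction. -/
theorem subsingleton_of_forall_maximal_smul_top {E : Type*} [AddCommGroup E] [Module T E]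
    [Module.Finite T E] (h : ∀ m : Ideal T, m.IsMaximal → (⊤ : Submodule T E) ≤ m • ⊤) :
    Subsingleton E := by
  by_contra hE
  have hne : Module.annihilator T E ≠ ⊤ := by
    rw [Ne, Ideal.eq_top_iff_one, Module.mem_annihilator]
    intro h1
    exact hE ⟨fun a b ↦ by rw [← one_smul T a, ← one_smul T b, h1, h1]⟩
  obtain ⟨m, hm, hle⟩ := Ideal.exists_le_maximal _ hne
  obtain ⟨r, hr, hr0⟩ := Submodule.exists_sub_one_mem_and_smul_eq_zero_of_fg_of_le_smul m
    (⊤ : Submodule T E) Module.Finite.fg_top (h m hm)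
  have hrm : r ∈ m := hle (Module.mem_annihilator.mpr fun x ↦ hr0 x trivial)
  exact hm.ne_top ((Ideal.eq_top_iff_one m).mpr (by simpa using m.sub_mem hrm hr))

theorem mk₀_smul_id_comp {M N : ModuleCat.{w} T} (x : T) {n : ℕ} (z : Abelian.Ext M N n) :
    (Abelian.Ext.mk₀ (x • 𝟙 M)).comp z (zero_add n) = x • z := by
  rw [Abelian.Ext.mk₀_smul, Abelian.Ext.smul_comp, Abelian.Ext.mk₀_id_comp]

/-- Noetherian induction on `I`, with no localization. A maximal `I` is resolved by its regular
sequence. If `I` is prime but not maximal, every maximal ideal `m` contains some `x ∉ I`. Since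
`T/(I + xT)` is covered by induction, `x` acts surjectively on `Ext^(d+1)(T/I, L)`; for finite `L`
this group is finitely generated and equal to `m` times itself for all `m`, hence zero. If `I` is
not prime, `T/I` is an extension of cyclic modules with larger annihilators. -/
theorem hasProjectiveDimensionLE_cyclic [IsNoetherianRing T] {d : ℕ} (hT : MaxIdealsRegular T d)
    (I : Ideal T) : HasProjectiveDimensionLE (ModuleCat.of T (T ⧸ I)) d := by
  induction I using WellFoundedGT.induction with
  | ind I ih =>
  have ih' (M : Type w) [AddCommGroup M] [Module T M] (φ : T →ₗ[T] M)
      (hφ : Function.Surjective φ) (a : T) (haI : a ∉ I) (ha : φ a = 0) (hI : ∀ x ∈ I, φ x = 0) :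
      HasProjectiveDimensionLE (ModuleCat.of T M) d := by
    refine hasProjectiveDimensionLE_of_equiv (φ.quotKerEquivOfSurjective hφ) d
      (ih (LinearMap.ker φ) (lt_of_le_of_ne (fun x hx ↦ hI x hx) ?_))
    rintro h
    exact haI (h ▸ (LinearMap.mem_ker.mpr ha))
  by_cases htop : I = ⊤
  · subst htop
    have := hasProjectiveDimensionLE_zero_of_projective (R := T) (M := T ⧸ (⊤ : Ideal T))
      (Module.Projective.of_free (R := T))
    exact hasProjectiveDimensionLT_of_ge _ (0 + 1) (d + 1) (by lia)
  by_cases hmax : I.IsMaximal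
  · exact hasProjectiveDimensionLE_quotient_maximal hT I hmax
  by_cases hp : I.IsPrime
  · refine ModuleCat.hasProjectiveDimensionLT_of_forall_finite _ _ fun L _ ↦ ?_
    refine subsingleton_of_forall_maximal_smul_top (T := T) fun m hm ↦ ?_
    obtain ⟨x, hxm, hxI⟩ : ∃ x ∈ m, x ∉ I := by
      by_contra! h
      exact hmax (hm.eq_of_le htop h ▸ hm)
    have reg : IsSMulRegular (ModuleCat.of T (T ⧸ I)) x := by
      refine isSMulRegular_iff_right_eq_zero_of_smul.mpr fun y hy ↦ ?_
      obtain ⟨y, rfl⟩ := Ideal.Quotient.mk_surjective y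
      have : Ideal.Quotient.mk I (x * y) = 0 := hy
      rw [Ideal.Quotient.eq_zero_iff_mem] at this ⊢
      exact (hp.mem_or_mem this).resolve_left hxI
    have hS := reg.smulShortComplex_shortExact
    have hq : HasProjectiveDimensionLT (ModuleCat.of T (QuotSMulTop x (T ⧸ I))) (d + 1) := by
      refine ih' _ (Submodule.mkQ _ ∘ₗ I.mkQ)
        ((Submodule.mkQ_surjective _).comp (Submodule.mkQ_surjective _)) x hxI ?_ fun y hy ↦ ?_
      · rw [LinearMap.comp_apply, Submodule.mkQ_apply, Submodule.Quotient.mk_eq_zero]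
        exact ⟨I.mkQ 1, trivial, (map_smul I.mkQ x 1).symm.trans (by simp)⟩
      · rw [LinearMap.comp_apply, show I.mkQ y = 0 from (Submodule.Quotient.mk_eq_zero _).mpr hy,
          map_zero]
    rintro y -
    obtain ⟨z, hz⟩ := Abelian.Ext.contravariant_sequence_exact₁ hS L y (add_comm 1 (d + 1))
      (Abelian.Ext.eq_zero_of_hasProjectiveDimensionLT (X := ModuleCat.of T (QuotSMulTop x (T ⧸ I)))
        _ (d + 1) (by lia))
    let z' : Abelian.Ext (ModuleCat.of T (T ⧸ I)) L (d + 1) := z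
    have hz' : x • z' = y := (mk₀_smul_id_comp x z').symm.trans hz
    rw [← hz']
    exact Submodule.smul_mem_smul hxm trivial
  · obtain ⟨a, haI, b, hbI, hab⟩ : ∃ a, a ∉ I ∧ ∃ b, b ∉ I ∧ a * b ∈ I := by
      by_contra! h
      refine hp ⟨htop, fun {x y} hxy ↦ ?_⟩
      by_contra! h'
      exact h x h'.1 y h'.2 hxy
    -- The image of `φ` is cyclic and killed by `I` and `b`, and its cokernel is cyclic and killed
    -- by `I` and `a`.
    let φ : T →ₗ[T] T ⧸ I := LinearMap.toSpanSingleton T _ (I.mkQ a)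
    have hφ (t : T) : φ t = I.mkQ (t * a) := by
      exact (map_smul I.mkQ t a).symm
    have hS := shortExact_of_exact (R := T) (LinearMap.range φ).subtype (LinearMap.range φ).mkQ
      (Submodule.subtype_injective _) (LinearMap.exact_subtype_mkQ _) (Submodule.mkQ_surjective _)
    refine hS.hasProjectiveDimensionLT_X₂ (d + 1)
      (ih' _ φ.rangeRestrict φ.surjective_rangeRestrict b hbI ?_ fun x hx ↦ ?_)
      (ih' _ ((LinearMap.range φ).mkQ ∘ₗ I.mkQ)
        ((Submodule.mkQ_surjective _).comp (Submodule.mkQ_surjective _)) a haI ?_ fun x hx ↦ ?_)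
    · refine Subtype.ext ?_
      change φ b = 0
      rw [hφ, Submodule.mkQ_apply, Submodule.Quotient.mk_eq_zero, mul_comm]
      exact hab
    · refine Subtype.ext ?_
      change φ x = 0
      rw [hφ, Submodule.mkQ_apply, Submodule.Quotient.mk_eq_zero, mul_comm]
      exact I.mul_mem_left _ hx
    · rw [LinearMap.comp_apply, Submodule.mkQ_apply, Submodule.Quotient.mk_eq_zero]
      exact ⟨1, by rw [hφ, one_mul]⟩
    · rw [LinearMap.comp_apply, show I.mkQ x = 0 from (Submodule.Quotient.mk_eq_zero _).mpr hx,
          map_zero]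

theorem globalDimension_le_of_maxIdealsRegular [IsNoetherianRing T] {d : ℕ}
    (hT : MaxIdealsRegular T d) : globalDimension T ≤ ((d : ℕ∞) : WithBot ℕ∞) :=
  globalDimension_le_of_cyclic d (hasProjectiveDimensionLE_cyclic hT)

end Regular

/-! ### Regular sequences in the base ring and Cohen–Macaulayness. -/

section RegularSequences

variable {R : Type*} [CommRing R]

theorem InAdd.isWeaklyRegular {M N : Type*} [AddCommGroup M] [Module R M] [AddCommGroup N]
    [Module R N] (h : InAdd R M N) (rs : List R) (hN : IsWeaklyRegular N rs) :
    IsWeaklyRegular M rs := by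
  induction rs generalizing M N with
  | nil => exact IsWeaklyRegular.nil R M
  | cons x rs ih =>
    rw [isWeaklyRegular_cons_iff] at hN ⊢
    obtain ⟨n, p, q, hpq⟩ := h
    refine ⟨fun a b hab ↦ ?_, ih ⟨n, fun i ↦ QuotSMulTop.map x (p i),
      fun i ↦ QuotSMulTop.map x (q i), fun y ↦ ?_⟩ hN.2⟩
    · rw [← hpq a, ← hpq b]
      refine Finset.sum_congr rfl fun i _ ↦ congrArg (p i) (hN.1 ?_)
      change x • q i a = x • q i b
      rw [← map_smul, ← map_smul]
      exact congrArg (q i) hab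
    · obtain ⟨y, rfl⟩ := Submodule.mkQ_surjective _ y
      conv_rhs => rw [← hpq y]
      rw [map_sum]
      rfl

theorem InAdd.hom {M N M' N' : Type*} [AddCommGroup M] [Module R M] [AddCommGroup N] [Module R N]
    [AddCommGroup M'] [Module R M'] [AddCommGroup N'] [Module R N']
    (h : InAdd R M N) (h' : InAdd R M' N') : InAdd R (M →ₗ[R] M') (N →ₗ[R] N') := by
  obtain ⟨n, p, q, hpq⟩ := h
  obtain ⟨n', p', q', hpq'⟩ := h'
  refine InAdd.of_fintype (ι := Fin n × Fin n')
    (fun i ↦ (LinearMap.lcomp R M' (q i.1)) ∘ₗ (LinearMap.compRight R (p' i.2)))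
    (fun i ↦ (LinearMap.lcomp R N' (p i.1)) ∘ₗ (LinearMap.compRight R (q' i.2))) fun f ↦ ?_
  ext x
  rw [Fintype.sum_prod_type]
  simp [← map_sum, hpq, hpq', LinearMap.sum_apply]

/-- One direction of Rees' characterization of depth, with the sequence taken in `R` and `Ext`
computed over `T`. Vanishing of `Hom` gives a regular element `x ∈ I`, and the long exact sequence
of `x : M → M` passes the remaining vanishing to `M/xM`. -/
theorem exists_isWeaklyRegular_of_subsingleton_ext [IsNoetherianRing R] {T : Type w} [CommRing T]
    [Algebra R T] [Module.Finite R T] (I : Ideal R) (n : ℕ) (M : Type w) [AddCommGroup M]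
    [Module T M] [Module.Finite T M]
    (h : ∀ i < n, Subsingleton (Abelian.Ext (ModuleCat.of T (T ⧸ I.map (algebraMap R T)))
      (ModuleCat.of T M) i)) :
    ∃ rs : List R, rs.length = n ∧ (∀ r ∈ rs, r ∈ I) ∧
      IsWeaklyRegular M (rs.map (algebraMap R T)) := by
  induction n generalizing M with
  | zero => exact ⟨[], rfl, by simp, by simp⟩
  | succ n ih =>
    let : Module R M := Module.compHom M (algebraMap R T)
    have : IsScalarTower R T M := IsScalarTower.of_algebraMap_smul fun _ _ ↦ rfl
    have : Module.Finite R M := Module.Finite.trans T M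
    have : Subsingleton ((T ⧸ I.map (algebraMap R T)) →ₗ[T] M) :=
      (Abelian.Ext.addEquiv₀.trans ModuleCat.homAddEquiv).symm.subsingleton_congr.mpr
        (h 0 n.succ_pos)
    have : Subsingleton ((R ⧸ I) →ₗ[R] M) := by
      refine subsingleton_of_forall_eq 0 fun f ↦ ?_
      have hf (x : R) (hx : x ∈ I) : x • f 1 = 0 := by
        rw [← map_smul, Algebra.smul_def, mul_one]
        rw [show algebraMap R (R ⧸ I) x = 0 from Ideal.Quotient.eq_zero_iff_mem.mpr hx, map_zero]
      let g : (T ⧸ I.map (algebraMap R T)) →ₗ[T] M :=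
        Submodule.liftQ _ (LinearMap.toSpanSingleton T M (f 1)) <| by
          rw [Ideal.map, Ideal.span, Submodule.span_le]
          rintro _ ⟨x, hx, rfl⟩
          rw [SetLike.mem_coe, LinearMap.mem_ker, LinearMap.toSpanSingleton_apply, algebraMap_smul]
          exact hf x hx
      have hg : f 1 = 0 := by
        have h1 : g (Submodule.Quotient.mk 1) = 0 := by rw [Subsingleton.elim g 0]; rfl
        rw [← h1]
        exact (one_smul T (f 1)).symm
      refine LinearMap.ext fun x ↦ ?_
      obtain ⟨x, rfl⟩ := Ideal.Quotient.mk_surjective x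
      rw [show Ideal.Quotient.mk I x = x • 1 by rw [Algebra.smul_def, mul_one]; rfl, map_smul, hg,
        smul_zero, LinearMap.zero_apply]
    obtain ⟨x, hx, hreg⟩ := IsSMulRegular.subsingleton_linearMap_iff.mp this
    rw [Ideal.annihilator_quotient] at hx
    have hreg' : IsSMulRegular (ModuleCat.of T M) (algebraMap R T x) := fun a b hab ↦
      hreg (by simpa [algebraMap_smul] using hab)
    obtain ⟨rs, hlen, hmem, hrs⟩ := ih (QuotSMulTop (algebraMap R T x) M) fun i hi ↦ by
      have zero1 := AddCommGrpCat.isZero_of_iff_subsingleton.mpr (h i (by omega))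
      have zero2 := AddCommGrpCat.isZero_of_iff_subsingleton.mpr (h (i + 1) (by omega))
      exact AddCommGrpCat.subsingleton_of_isZero <| ShortComplex.Exact.isZero_of_both_zeros
        ((Abelian.Ext.covariant_sequence_exact₃' _ hreg'.smulShortComplex_shortExact) i (i + 1) rfl)
        (zero1.eq_zero_of_src _) (zero2.eq_zero_of_tgt _)
    refine ⟨x :: rs, by simp [hlen], by simpa [hx] using hmem, ?_⟩
    rw [List.map_cons, isWeaklyRegular_cons_iff]
    exact ⟨hreg', hrs⟩

/-- Dévissage by a prime filtration: only residue fields at maximal ideals occur, and for these the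
generating regular sequence kills `Ext` below degree `d`. -/
theorem MaxIdealsRegular.subsingleton_ext {T : Type w} [CommRing T] [IsNoetherianRing T] {d : ℕ}
    (hT : MaxIdealsRegular T d) (N : Type w) [AddCommGroup N] [Module T N] [hN : Module.Finite T N]
    (h : ∀ Q : Ideal T, Q.IsPrime → Module.annihilator T N ≤ Q → Q.IsMaximal) (i : ℕ)
    (hi : i < d) :
    Subsingleton (Abelian.Ext (ModuleCat.of T N) (ModuleCat.of T T) i) := by
  induction hN using IsNoetherianRing.induction_on_isQuotientEquivQuotientPrime T with
  | subsingleton N =>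
    have : Limits.IsZero (ModuleCat.of T N) := ModuleCat.isZero_of_subsingleton _
    refine subsingleton_of_forall_eq 0 fun x ↦ ?_
    rw [← Abelian.Ext.mk₀_id_comp x, this.eq_of_src (𝟙 _) 0, Abelian.Ext.mk₀_zero,
      Abelian.Ext.zero_comp]
  | quotient N Q e =>
    have hQ : Q.1.IsMaximal := h _ Q.2 (by rw [e.annihilator_eq, Ideal.annihilator_quotient])
    obtain ⟨rs, rfl, hm, hrs⟩ := hT Q.1 hQ
    have hlt : Q.1 • (⊤ : Submodule T T) < ⊤ := by
      rw [smul_eq_mul, Ideal.mul_top]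
      exact hQ.ne_top.lt_top
    refine ModuleCat.subsingleton_ext_of_exists_isRegular Q.1 (ModuleCat.of T N) ?_
      (ModuleCat.of T T) hlt rs (fun r hr ↦ ?_) ⟨hrs, ?_⟩ i hi
    · change Module.support T N ⊆ _
      rw [e.support_eq, Module.support_eq_zeroLocus, Ideal.annihilator_quotient]
    · rw [← hm]; exact Ideal.subset_span hr
    · change (⊤ : Submodule T T) ≠ _
      rw [hm]
      exact hlt.ne'
  | exact N₁ N₂ N₃ f g hf hg hfg ih₁ ih₃ =>
    have hS := shortExact_of_exact f g hf hfg hg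
    have h₁ := ih₁ fun Q hQ hle ↦ h Q hQ ((f.annihilator_le_of_injective hf).trans hle)
    have h₃ := ih₃ fun Q hQ hle ↦ h Q hQ ((g.annihilator_le_of_surjective hg).trans hle)
    refine subsingleton_of_forall_eq 0 fun x ↦ ?_
    obtain ⟨y, rfl⟩ := Abelian.Ext.contravariant_sequence_exact₂ hS _ x
      (@Subsingleton.elim _ h₁ _ _)
    rw [@Subsingleton.elim _ h₃ y 0, Abelian.Ext.comp_zero]

/-- As `T` is integral over `R`, all primes of `T` containing `nT` are maximal, so the vanishing of
`Ext` applies to `T/nT`. -/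
theorem MaxIdealsRegular.exists_isWeaklyRegular [IsNoetherianRing R] {T : Type w} [CommRing T]
    [Algebra R T] [Module.Finite R T] {d : ℕ} (hT : MaxIdealsRegular T d) (n : Ideal R)
    [n.IsMaximal] : ∃ rs : List R, rs.length = d ∧ (∀ r ∈ rs, r ∈ n) ∧ IsWeaklyRegular T rs := by
  have : IsNoetherianRing T := IsNoetherianRing.of_finite R T
  have := exists_isWeaklyRegular_of_subsingleton_ext (T := T) n d T fun i hi ↦
    hT.subsingleton_ext _ (fun Q hQ hle ↦ ?_) i hi
  · simpa only [isWeaklyRegular_map_algebraMap_iff] using this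
  · rw [Ideal.annihilator_quotient, Ideal.map_le_iff_le_comap] at hle
    refine Ideal.isMaximal_of_isIntegral_of_isMaximal_comap (R := R) Q ?_
    rwa [← Ideal.IsMaximal.eq_of_le ‹_› (Ideal.comap_ne_top _ hQ.ne_top) hle]

theorem MaxIdealsRegular.ringKrullDim_le {T : Type w} [CommRing T] [IsNoetherianRing T] {d : ℕ}
    (hT : MaxIdealsRegular T d) : ringKrullDim T ≤ ((d : ℕ∞) : WithBot ℕ∞) := by
  classical
  rw [ringKrullDim_le_iff_isMaximal_height_le]
  intro m hm
  obtain ⟨rs, rfl, h, -⟩ := hT m hm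
  have hs : Ideal.span (rs.toFinset : Set T) = m := by rw [← h, Ideal.ofList]; simp
  have := Ideal.height_le_card_of_mem_minimalPrimes_span_finset (p := m) (s := rs.toFinset)
    (by rw [hs, Ideal.minimalPrimes_eq_subsingleton_self]; rfl)
  exact WithBot.coe_le_coe.mpr (this.trans (by exact_mod_cast rs.toFinset_card_le))

theorem ringKrullDim_le_of_isIntegral {T : Type*} [CommRing T] [Algebra R T]
    [Algebra.IsIntegral R T] (h : Function.Injective (algebraMap R T)) :
    ringKrullDim R ≤ ringKrullDim T := by
  have := (faithfulSMul_iff_algebraMap_injective R T).mpr h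
  refine iSup_le fun l ↦ ?_
  obtain ⟨P, hP⟩ := (inferInstance : Nonempty (Ideal.primesOver l.head.asIdeal T))
  have := hP.1
  have := hP.2
  obtain ⟨L, hL, -⟩ := Ideal.exists_ltSeries_of_hasGoingUp l P
  rw [← hL]
  exact Order.LTSeries.length_le_krullDim L

/-- A sequence of length `d` in `n` that is regular on `T` stays regular on the summand `M` and on
its localization. Conversely the dimension of the support is at most `dim R ≤ dim T ≤ d`. A regular
sequence is never longer than the dimension of the support, so depth and dimension are both squeezed
to `d`. -/
theorem MaxIdealsRegular.isCohenMacaulayModule [IsNoetherianRing R] {T : Type w} [CommRing T]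
    [Algebra R T] [Module.Finite R T] {d : ℕ} (hT : MaxIdealsRegular T d)
    (hinj : Function.Injective (algebraMap R T)) {M : Type*} [AddCommGroup M] [Module R M]
    (hM : InAdd R M T) : IsCohenMacaulayModule R M := by
  have : IsNoetherianRing T := IsNoetherianRing.of_finite R T
  have hfin : Module.Finite R M := hM.finite
  refine ⟨hfin, fun n _ hn ↦ ?_⟩
  obtain ⟨rs, hlen, hmem, hrs⟩ := hT.exists_isWeaklyRegular n
  have hreg := (hM.isWeaklyRegular rs hrs).isRegular_of_isLocalizedModule_of_mem
    (Localization.AtPrime n) n (LocalizedModule.mkLinearMap n.primeCompl M) hmem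
  refine le_antisymm (iSup_le fun rs' ↦ ?_) ?_
  · have := rs'.2.2.quot_ofList_smul_nontrivial
    have h1 := Module.supportDim_add_length_eq_supportDim_of_isRegular rs'.1 rs'.2.2
    rw [← h1]
    have h2 := Module.supportDim_ne_bot_of_nontrivial (Localization.AtPrime n)
      (LocalizedModule n.primeCompl M ⧸ Ideal.ofList rs'.1 •
        (⊤ : Submodule (Localization.AtPrime n) (LocalizedModule n.primeCompl M)))
    have h3 : (0 : WithBot ℕ∞) ≤ Module.supportDim (Localization.AtPrime n)
      (LocalizedModule n.primeCompl M ⧸ Ideal.ofList rs'.1 •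
        (⊤ : Submodule (Localization.AtPrime n) (LocalizedModule n.primeCompl M))) := by
      obtain ⟨a, ha⟩ := WithBot.ne_bot_iff_exists.mp h2
      rw [← ha]
      exact WithBot.coe_le_coe.mpr zero_le
    calc _ = 0 + ((rs'.1.length : ℕ∞) : WithBot ℕ∞) := (zero_add _).symm
      _ ≤ _ := add_le_add_left h3 _
  · calc Module.supportDim (Localization.AtPrime n) (LocalizedModule n.primeCompl M)
        ≤ ringKrullDim (Localization.AtPrime n) := Module.supportDim_le_ringKrullDim _ _
      _ = n.height := IsLocalization.AtPrime.ringKrullDim_eq_height n _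
      _ ≤ ringKrullDim R := Ideal.height_le_ringKrullDim_of_isPrime
      _ ≤ ringKrullDim T := ringKrullDim_le_of_isIntegral hinj
      _ ≤ ((d : ℕ∞) : WithBot ℕ∞) := hT.ringKrullDim_le
      _ = (((rs.map (algebraMap R (Localization.AtPrime n))).length : ℕ∞) : WithBot ℕ∞) := by
        rw [List.length_map, hlen]
      _ ≤ _ := le_iSup (fun rs : {rs : List (Localization.AtPrime n) //
          (∀ r ∈ rs, r ∈ IsLocalRing.maximalIdeal (Localization.AtPrime n)) ∧
            RingTheory.Sequence.IsRegular (LocalizedModule n.primeCompl M) rs} ↦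
          ((rs.1.length : ℕ∞) : WithBot ℕ∞)) ⟨_, fun r hr ↦ ?_, hreg⟩
    obtain ⟨r, hr', rfl⟩ := List.mem_map.mp hr
    exact (IsLocalization.AtPrime.to_map_mem_maximal_iff _ n r).mpr (hmem r hr')

end RegularSequences

/-! ### A lower bound for the global dimension from central regular sequences. -/

section LowerBound

variable {R : Type*} [CommRing R] {D : Type w} [Ring D] [Algebra R D]

/-- The action of `R` on the category of modules over an `R`-algebra `D`. -/
def algebraCatCenter (R : Type*) [CommRing R] (D : Type w) [Ring D] [Algebra R D] :
    R →+* CatCenter (ModuleCat.{w} D) where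
  toFun r :=
    { app M := ModuleCat.ofHom
        { toFun x := algebraMap R D r • x
          map_add' := smul_add _
          map_smul' a x := by
            rw [RingHom.id_apply, ← mul_smul, ← mul_smul, Algebra.commutes] }
      naturality M N f := by
        ext x
        exact (f.hom.map_smul _ _).symm }
  map_one' := by
    ext M x
    change algebraMap R D 1 • x = x
    rw [map_one, one_smul]
  map_zero' := by
    ext M x
    change algebraMap R D 0 • x = 0
    rw [map_zero, zero_smul]
  map_add' a b := by
    ext M x
    change algebraMap R D (a + b) • x = algebraMap R D a • x + algebraMap R D b • x
    rw [map_add, add_smul]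
  map_mul' a b := by
    ext M x
    change algebraMap R D (a * b) • x = algebraMap R D a • algebraMap R D b • x
    rw [map_mul, mul_smul]

/-- A central element acts on `Ext` in the same way through either argument, and through `N` it acts
by zero. -/
theorem mk₀_central_comp_eq_zero (r : R) (M N : ModuleCat.{w} D)
    (hN : ∀ x : N, algebraMap R D r • x = 0) {n : ℕ} (z : Abelian.Ext M N n) :
    (Abelian.Ext.mk₀ ((algebraCatCenter R D r).app M)).comp z (zero_add n) = 0 := by
  let := Linear.ofRingMorphism (algebraCatCenter R D)
  have h (L : ModuleCat.{w} D) : (algebraCatCenter R D r).app L = r • 𝟙 L :=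
    (Category.comp_id _).symm
  have hN' : (algebraCatCenter R D r).app N = 0 := by
    ext x
    exact hN x
  rw [h M, Abelian.Ext.mk₀_smul, Abelian.Ext.smul_comp, Abelian.Ext.mk₀_id_comp,
    ← Abelian.Ext.comp_mk₀_id z, ← Abelian.Ext.comp_smul, ← Abelian.Ext.mk₀_smul, ← h N, hN',
    Abelian.Ext.mk₀_zero, Abelian.Ext.comp_zero]

/-- Multiplication by `x` on `M` induces zero on `Ext(M, N)`, so the connecting map embeds `Ext^i(M,
N)` in `Ext^(i+1)(M/xM, N)`. Each element of the sequence raises the degree of a nonzero `Ext` by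
one. -/
theorem exists_nontrivial_ext (rs : List R) (M : Type w) [AddCommGroup M] [Module D M]
    [Module R M] [IsScalarTower R D M] (h : IsWeaklyRegular M rs) (N : ModuleCat.{w} D)
    (hN : ∀ r ∈ rs, ∀ x : N, algebraMap R D r • x = 0) (i : ℕ)
    (hM : Nontrivial (Abelian.Ext (ModuleCat.of D M) N i)) :
    ∃ M' : ModuleCat.{w} D, Nontrivial (Abelian.Ext M' N (i + rs.length)) := by
  induction rs generalizing M i with
  | nil => exact ⟨_, hM⟩
  | cons x rs ih =>
    rw [isWeaklyRegular_cons_iff] at h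
    let f : M →ₗ[D] M := ((algebraCatCenter R D x).app (ModuleCat.of D M)).hom
    have hf (y : M) : f y = x • y := algebraMap_smul D x y
    have hinj : Function.Injective f := fun a b hab ↦ h.1 (by simpa only [hf] using hab)
    have hS := shortExact_of_exact f (LinearMap.range f).mkQ hinj
      (LinearMap.exact_map_mkQ_range f) (Submodule.mkQ_surjective _)
    let e : QuotSMulTop x M ≃ₗ[R] M ⧸ LinearMap.range f :=
      (Submodule.quotEquivOfEq _ ((LinearMap.range f).restrictScalars R) (by
        ext y
        simp [hf, Submodule.mem_smul_pointwise_iff_exists])).trans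
        (Submodule.Quotient.restrictScalarsEquiv R (LinearMap.range f))
    obtain ⟨M', hM'⟩ := ih (M ⧸ LinearMap.range f) ((e.isWeaklyRegular_congr rs).mp h.2)
      (fun r hr ↦ hN r (List.mem_cons_of_mem _ hr)) (i + 1) (by
        by_contra hsub
        rw [not_nontrivial_iff_subsingleton] at hsub
        refine not_subsingleton_iff_nontrivial.mpr hM (subsingleton_of_forall_eq 0 fun z ↦ ?_)
        obtain ⟨y, rfl⟩ := Abelian.Ext.contravariant_sequence_exact₁ hS N z (add_comm 1 i)
          (@Subsingleton.elim _ hsub _ _)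
        exact mk₀_central_comp_eq_zero x _ N (hN x List.mem_cons_self) y)
    exact ⟨M', by rwa [List.length_cons, show i + (rs.length + 1) = i + 1 + rs.length by ring]⟩

/-- The length of a regular sequence of central elements is a lower bound for the global
dimension. -/
theorem length_le_globalDimension [Module.Finite R D] (n : Ideal R) [hn : n.IsMaximal]
    (hD : Module.annihilator R D ≤ n) (rs : List R) (hmem : ∀ r ∈ rs, r ∈ n)
    (hrs : IsWeaklyRegular D rs) : ((rs.length : ℕ∞) : WithBot ℕ∞) ≤ globalDimension D := by
  -- The generators are central, so `D/I` is killed by them on every element. Nakayama at `n` shows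
  -- that it is nonzero, hence `Hom(D, D/I) ≠ 0` starts the climb in degree.
  let I : Submodule D D := Submodule.span D {x | ∃ r ∈ rs, algebraMap R D r = x}
  have hI : I ≠ ⊤ := by
    intro htop
    obtain ⟨r, hr, hr0⟩ := Submodule.exists_sub_one_mem_and_smul_eq_zero_of_fg_of_le_smul n
      (⊤ : Submodule R D) Module.Finite.fg_top (fun x _ ↦ by
        have hx : x ∈ I := htop ▸ trivial
        induction hx using Submodule.span_induction with
        | mem x hx =>
          obtain ⟨r, hr, rfl⟩ := hx
          rw [Algebra.algebraMap_eq_smul_one]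
          exact Submodule.smul_mem_smul (hmem r hr) trivial
        | zero => exact zero_mem _
        | add x y _ _ hx hy => exact add_mem (hx trivial) (hy trivial)
        | smul a x _ hx =>
          refine Submodule.smul_induction_on (hx trivial) (fun r hr m _ ↦ ?_) fun y z hy hz ↦ ?_
          · rw [smul_eq_mul, mul_smul_comm]
            exact Submodule.smul_mem_smul hr trivial
          · rw [smul_add]
            exact add_mem hy hz)
    have hrm : r ∈ n := hD (Module.mem_annihilator.mpr fun x ↦ hr0 x trivial)
    exact hn.ne_top ((Ideal.eq_top_iff_one n).mpr (by simpa using n.sub_mem hrm hr))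
  have : Nontrivial (D ⧸ I) := Submodule.Quotient.nontrivial_iff.mpr hI
  have hE : Nontrivial (Abelian.Ext (ModuleCat.of D D) (ModuleCat.of D (D ⧸ I)) 0) := by
    refine (Abelian.Ext.addEquiv₀.trans ModuleCat.homAddEquiv).nontrivial_congr.mpr ?_
    refine nontrivial_of_ne I.mkQ 0 fun h ↦ hI ?_
    rw [← Submodule.ker_mkQ I, h, LinearMap.ker_zero]
  obtain ⟨M', hM'⟩ := exists_nontrivial_ext rs D hrs (ModuleCat.of D (D ⧸ I)) (fun r hr x ↦ by
    obtain ⟨x, rfl⟩ := Submodule.mkQ_surjective I x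
    refine (map_smul I.mkQ _ _).symm.trans ((Submodule.Quotient.mk_eq_zero I).mpr ?_)
    rw [smul_eq_mul, Algebra.commutes]
    exact I.smul_mem x (Submodule.subset_span ⟨r, hr, rfl⟩)) 0 hE
  rw [zero_add] at hM'
  by_contra! hlt
  cases hl : rs.length with
  | zero =>
    have h0 : projectiveDimension M' < 0 := by
      refine lt_of_le_of_lt (le_iSup (fun M : ModuleCat.{w} D ↦ projectiveDimension M) M') ?_
      simpa [hl, globalDimension] using hlt
    have hz : HasProjectiveDimensionLT M' 0 := (projectiveDimension_lt_iff (X := M') (n := 0)).mp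
      (by simpa using h0)
    exact not_subsingleton_iff_nontrivial.mpr hM'
      (HasProjectiveDimensionLT.subsingleton M' 0 _ (Nat.zero_le _) _)
  | succ l =>
    have h0 : projectiveDimension M' < ((l + 1 : ℕ) : WithBot ℕ∞) := by
      refine lt_of_le_of_lt (le_iSup (fun M : ModuleCat.{w} D ↦ projectiveDimension M) M') ?_
      simpa [hl, globalDimension] using hlt
    have hz : HasProjectiveDimensionLT M' (l + 1) := (projectiveDimension_lt_iff (X := M')).mp h0
    rw [hl] at hM'
    exact not_subsingleton_iff_nontrivial.mpr hM'
      (HasProjectiveDimensionLT.subsingleton M' (l + 1) _ le_rfl _)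

end LowerBound

/-- The homological part of the main theorem, for an extension `R ⊆ B ⊆ T` such that the
endomorphisms of `B` over `R` are given by the skew group ring of `Γ` over `B`. -/
theorem globalDimension_end_eq_and_isCohenMacaulayModule {R B X T : Type w} [CommRing R]
    [IsNoetherianRing R] [Nontrivial R] [CommRing B] [Algebra R B] [AddCommGroup X] [Module R X]
    [CommRing T] [Algebra R T] [Algebra B T] [IsScalarTower R B T] [Module.Finite R T]
    [Module.Projective B T] {Γ : Type*} [Group Γ] [Fintype Γ] (ρ : Γ →* (B ≃ₐ[R] B))
    (hΓ : Function.Bijective (skewMap ρ)) (h : InAdd R X B) (h' : InAdd R B X)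
    (hu : IsUnit (Fintype.card Γ : R)) (r : T →ₗ[B] B) (hr : r 1 = 1)
    (hinj : Function.Injective (algebraMap R T)) {d : ℕ} (hT : MaxIdealsRegular T d) :
    globalDimension (Module.End R X) = ((d : ℕ∞) : WithBot ℕ∞) ∧
      IsCohenMacaulayModule R (Module.End R X) := by
  have : IsNoetherianRing T := IsNoetherianRing.of_finite R T
  have hBT : InAdd R B T := InAdd.of_retract (r.restrictScalars R)
    (Algebra.linearMap B T |>.restrictScalars R) fun b ↦ by
      change r (algebraMap B T b) = b
      rw [Algebra.algebraMap_eq_smul_one, map_smul, hr, smul_eq_mul, mul_one]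
  let Φ : (Γ → B) ≃ₗ[R] Module.End R B := LinearEquiv.ofBijective
    { skewMap ρ with
      map_smul' a c := by
        ext x
        simp [Finset.smul_sum] } hΓ
  -- `End_R(X)` is a summand of copies of `End_R(B) ≅ B^Γ`, and `B` is a summand of `T`.
  have hD : InAdd R (Module.End R X) T :=
    (InAdd.hom h h).trans <| (InAdd.of_equiv Φ.symm).trans <| (InAdd.pi).trans hBT
  have hCM := hT.isCohenMacaulayModule hinj hD
  refine ⟨le_antisymm (globalDimension_end_le ρ hΓ h h' hu d
    (globalDimension_le_of_projective_of_retraction r hr d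
      (globalDimension_le_of_maxIdealsRegular hT))) ?_, hCM⟩
  have hfin := hCM.1
  have hann : Module.annihilator R (Module.End R X) ≠ ⊤ := by
    rw [Ne, Ideal.eq_top_iff_one, Module.mem_annihilator]
    intro h1
    have h1X (x : X) : x = 0 := by simpa using LinearMap.congr_fun (h1 1) x
    obtain ⟨n, p, q, hpq⟩ := h'
    have h1B : (1 : B) = 0 := by
      rw [← hpq 1]
      exact Finset.sum_eq_zero fun i _ ↦ by rw [h1X (q i 1), map_zero]
    have h1T : (1 : T) = 0 := by rw [← map_one (algebraMap B T), h1B, map_zero]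
    refine one_ne_zero (α := R) (hinj ?_)
    rw [map_one, map_zero, h1T]
  obtain ⟨n, hn, hle⟩ := Ideal.exists_le_maximal _ hann
  obtain ⟨rs, rfl, hmem, hrs⟩ := hT.exists_isWeaklyRegular n
  exact length_le_globalDimension n hle rs hmem (hD.isWeaklyRegular rs hrs)

/-! ### Frobenius powers of the irrelevant ideal. -/

section Frobenius

theorem frobPow_eq_map {A : Type*} [CommRing A] (p : ℕ) [ExpChar A p] (e : ℕ) (I : Ideal A) :
    frobPow I (p ^ e) = I.map (iterateFrobenius A p e) := by
  rw [frobPow, Ideal.map]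
  congr 1

theorem irrelevant_map_equivMvPolynomial {k : Type u} [Field k] {V : Type v} [AddCommGroup V]
    [Module k V] {ι : Type*} (b : Module.Basis ι k V) :
    (irrelevant k V).map (SymmetricAlgebra.equivMvPolynomial b : _ →+* MvPolynomial ι k) =
      Ideal.span (Set.range MvPolynomial.X) := by
  rw [irrelevant, Ideal.map_span]
  refine le_antisymm (Ideal.span_le.mpr ?_) (Ideal.span_le.mpr ?_)
  · rintro _ ⟨_, ⟨x, rfl⟩, rfl⟩
    change SymmetricAlgebra.equivMvPolynomial b (SymmetricAlgebra.ι k V x) ∈ _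
    rw [← b.linearCombination_repr x, Finsupp.linearCombination_apply, Finsupp.sum, map_sum, map_sum]
    refine sum_mem fun i _ ↦ ?_
    rw [map_smul, map_smul, SymmetricAlgebra.equivMvPolynomial_ι_apply]
    exact Submodule.smul_of_tower_mem _ _ (Ideal.subset_span ⟨i, rfl⟩)
  · rintro _ ⟨i, rfl⟩
    exact Ideal.subset_span ⟨_, ⟨b i, rfl⟩, SymmetricAlgebra.equivMvPolynomial_ι_apply b i⟩

/-- In coordinates `𝔪^[q]` is the monomial ideal generated by the `q`-th powers of the variables, so
membership is decided monomial by monomial. -/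
theorem mem_frobPow_irrelevant_iff {k : Type u} [Field k] (p : ℕ) [Fact p.Prime] [CharP k p]
    {V : Type v} [AddCommGroup V] [Module k V] {ι : Type*} (b : Module.Basis ι k V) (e : ℕ)
    (s : SymmetricAlgebra k V) : s ∈ frobPow (irrelevant k V) (p ^ e) ↔
      ∀ m ∈ (SymmetricAlgebra.equivMvPolynomial b s).support, ∃ i, p ^ e ≤ m i := by
  have : CharP (SymmetricAlgebra k V) p :=
    charP_of_injective_algebraMap (algebraMap k (SymmetricAlgebra k V)).injective p
  let φ : SymmetricAlgebra k V ≃+* MvPolynomial ι k := SymmetricAlgebra.equivMvPolynomial b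
  have h1 : s ∈ frobPow (irrelevant k V) (p ^ e) ↔
      φ s ∈ (frobPow (irrelevant k V) (p ^ e)).map (φ : _ →+* MvPolynomial ι k) := by
    constructor
    · exact fun h ↦ Ideal.mem_map_of_mem _ h
    · intro h
      obtain ⟨t, ht, h⟩ := (Ideal.mem_map_iff_of_surjective _ φ.surjective).mp h
      rwa [← φ.injective h]
  have h2 : (frobPow (irrelevant k V) (p ^ e)).map (φ : _ →+* MvPolynomial ι k) =
      Ideal.span ((fun m ↦ MvPolynomial.monomial m (1 : k)) ''
        Set.range fun i ↦ Finsupp.single i (p ^ e)) := by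
    have hc : (φ : _ →+* MvPolynomial ι k).comp (iterateFrobenius (SymmetricAlgebra k V) p e) =
        (iterateFrobenius (MvPolynomial ι k) p e).comp (φ : _ →+* MvPolynomial ι k) := by
      ext x; simp [iterateFrobenius_def]
    have h3 := irrelevant_map_equivMvPolynomial b
    change (irrelevant k V).map (φ : _ →+* MvPolynomial ι k) = _ at h3
    rw [frobPow_eq_map, Ideal.map_map, hc, ← Ideal.map_map, h3, Ideal.map_span, ← Set.range_comp,
      ← Set.range_comp]
    congr 2
    ext1 i
    simp [iterateFrobenius_def, MvPolynomial.X_pow_eq_monomial]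
  rw [h1, h2, MvPolynomial.mem_ideal_span_monomial_image]
  simp only [Set.exists_range_iff, Finsupp.single_le_iff]
  rfl

end Frobenius

/-! ### Large enough `q`: faithfulness of `S/𝔪^[q]` and the bound `q ≥ #G`. -/

section Irreps

variable {k : Type u} [Field k] {V : Type v} [AddCommGroup V] [Module k V]
  (G : Subgroup (LinearMap.GeneralLinearGroup k V))

open scoped MonoidAlgebra in
theorem ContainsAllIrreps.sum_single_smul_eq_zero
    {G : Subgroup (LinearMap.GeneralLinearGroup k V)} [Fintype G] {q : ℕ}
    (h : ContainsAllIrreps G q) (c : G → k) (hc : ∀ x, ∑ g, c g • quotRep G q g x = 0)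
    (M : Type u) [AddCommGroup M] [Module k[G] M] [hM : IsSimpleModule k[G] M] (x : M) :
    (∑ g, MonoidAlgebra.single g (c g) : k[G]) • x = 0 := by
  let : Module k M := Module.compHom M (algebraMap k k[G])
  have : IsScalarTower k k[G] M := IsScalarTower.of_algebraMap_smul fun _ _ ↦ rfl
  let σ : Representation k G M := Representation.ofModule' M
  have hσ (g : G) (x : M) : σ g x = MonoidAlgebra.single g (1 : k) • x := rfl
  have hirr : σ.IsIrreducible := by
    have : Nontrivial M := IsSimpleModule.nontrivial k[G] M
    refine { exists_pair_ne := ⟨⊥, ⊤, fun h ↦ ?_⟩, eq_bot_or_eq_top := fun W ↦ ?_ }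
    · obtain ⟨y, hy⟩ := exists_ne (0 : M)
      have : y ∈ (⊥ : Subrepresentation σ).toSubmodule := by
        rw [h]; trivial
      exact hy this
    · let N : Submodule k[G] M :=
        { W.toSubmodule with
          smul_mem' a y hy := by
            induction a using MonoidAlgebra.induction_linear with
            | zero => rw [zero_smul]; exact W.toSubmodule.zero_mem
            | add a b ha hb => rw [add_smul]; exact W.toSubmodule.add_mem ha hb
            | single g c =>
              have h1 : MonoidAlgebra.single g c =
                c • (MonoidAlgebra.single g (1 : k)) := by simp
              rw [h1, smul_assoc]
              exact W.toSubmodule.smul_mem _ (W.apply_mem_toSubmodule g hy) }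
      rcases eq_bot_or_eq_top N with h | h
      · left
        ext y
        exact (Submodule.ext_iff.mp h y)
      · right
        ext y
        exact (Submodule.ext_iff.mp h y)
  obtain ⟨i, r, hr⟩ := h M σ hirr
  have hi (z z' : M) (hz : i z = i z') : z = z' := by
    rw [← hr z, hz, hr]
  have hx : ∑ g, c g • σ g x = 0 := by
    refine hi _ _ ?_
    rw [map_zero, map_sum, ← hc (i x)]
    refine Finset.sum_congr rfl fun g _ ↦ ?_
    rw [map_smul, i.isIntertwining]
  rw [Finset.sum_smul, ← hx]
  refine Finset.sum_congr rfl fun g _ ↦ ?_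
  rw [hσ, ← smul_assoc]
  simp

open scoped MonoidAlgebra in
/-- If `S / 𝔪^[q]` contains all irreducible representations, it is a faithful `k[G]`-module. -/
theorem ContainsAllIrreps.eq_zero_of_sum_smul {G : Subgroup (LinearMap.GeneralLinearGroup k V)}
    [Fintype G] (hG : (Nat.card G : k) ≠ 0) {q : ℕ}
    (h : ContainsAllIrreps G q) (c : G → k) (hc : ∀ x, ∑ g, c g • quotRep G q g x = 0) : c = 0 := by
  classical
  have : NeZero (Nat.card G : k) := ⟨hG⟩
  let a : k[G] := ∑ g, MonoidAlgebra.single g (c g)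
  have key (L : Submodule k[G] k[G]) (hL : IsSimpleModule k[G] L) (x : k[G]) (hx : x ∈ L) :
      a • x = 0 := by
    have : Module.Finite k L := Module.Finite.of_injective (L.subtype.restrictScalars k)
      (Submodule.subtype_injective _)
    have : Small.{u} L :=
      small_of_injective (Module.finBasis k L).equivFun.injective
    -- Irreducibles are tested only in the universe of `k`, so the finite-dimensional `L` is
    -- replaced by a small copy.
    let e : Shrink.{u} L ≃ₗ[k[G]] L := Shrink.linearEquiv k[G] L
    have hs : IsSimpleModule k[G] (Shrink.{u} L) := IsSimpleModule.congr e
    have := h.sum_single_smul_eq_zero c hc _ (e.symm ⟨x, hx⟩)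
    rw [← map_smul, LinearEquiv.map_eq_zero_iff] at this
    exact congrArg Subtype.val this
  -- By Maschke `1` is a sum of elements of simple left ideals, all killed by `a`; hence `a = a · 1
  -- = 0`.
  have h1 : (1 : k[G]) ∈ sSup {L : Submodule k[G] k[G] | IsSimpleModule k[G] L} := by
    rw [IsSemisimpleModule.sSup_simples_eq_top]
    trivial
  have ha : a = 0 := by
    rw [← mul_one a, ← smul_eq_mul]
    rw [sSup_eq_iSup'] at h1
    refine Submodule.iSup_induction _ (motive := fun x ↦ a • x = 0) h1
      (fun L x hx ↦ key L.1 L.2 x hx) (smul_zero a) fun x y hx hy ↦ ?_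
    rw [smul_add, hx, hy, add_zero]
  funext g
  have := congrArg (fun x : k[G] ↦ x.coeff g) ha
  simpa [a, Finsupp.single_apply] using this

/-- The functionals fixed by a given `g ≠ 1` form a proper subspace, and over an infinite field
finitely many proper subspaces do not cover the dual. -/
theorem exists_dual_apply_ne [Infinite k] [Finite G] : ∃ ξ : Module.Dual k V, ∀ g ∈ G, g ≠ 1 →
    ∃ v : V, ξ (g.1 v) ≠ ξ v := by
  let s : Set (Submodule k (Module.Dual k V)) :=
    (fun g : G ↦ LinearMap.ker (Module.Dual.transpose (R := k) (g.1.1 - LinearMap.id))) ''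
      {g | g ≠ 1}
  have hs : s.Finite := Set.toFinite _
  have h := Subspace.biUnion_ne_univ_of_top_notMem (s := hs.toFinset) (by
    rw [Set.Finite.mem_toFinset]
    rintro ⟨g, hg, h⟩
    apply hg
    ext v
    have : (g.1.1 - LinearMap.id : V →ₗ[k] V) v = 0 := by
      rw [← Module.forall_dual_apply_eq_zero_iff k]
      intro ξ
      have : ξ ∈ LinearMap.ker (Module.Dual.transpose (R := k) (g.1.1 - LinearMap.id)) := by
        exact (show LinearMap.ker (Module.Dual.transpose (R := k) (g.1.1 - LinearMap.id)) = ⊤ from h) ▸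
          (trivial : ξ ∈ (⊤ : Submodule k (Module.Dual k V)))
      exact LinearMap.congr_fun this v
    simpa [sub_eq_zero] using this)
  obtain ⟨ξ, hξ⟩ := (Set.ne_univ_iff_exists_notMem _).mp h
  refine ⟨ξ, fun g hg hg1 ↦ ?_⟩
  by_contra! hv
  refine hξ (Set.mem_biUnion (x := LinearMap.ker (Module.Dual.transpose (R := k)
    ((⟨g, hg⟩ : G).1.1 - LinearMap.id))) (hs.mem_toFinset.mpr ⟨⟨g, hg⟩, fun h ↦ hg1 (congrArg Subtype.val h), rfl⟩) ?_)
  rw [SetLike.mem_coe, LinearMap.mem_ker]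
  ext v
  change ξ (g.1 v - v) = 0
  rw [map_sub, hv, sub_self]

theorem totalDegree_equivMvPolynomial_ι_le {ι : Type*} (b : Module.Basis ι k V) (v : V) :
    (SymmetricAlgebra.equivMvPolynomial b (SymmetricAlgebra.ι k V v)).totalDegree ≤ 1 := by
  rw [← b.linearCombination_repr v, Finsupp.linearCombination_apply, Finsupp.sum, map_sum, map_sum]
  refine MvPolynomial.totalDegree_finsetSum_le fun i _ ↦ ?_
  rw [map_smul, map_smul, SymmetricAlgebra.equivMvPolynomial_ι_apply]
  exact (MvPolynomial.totalDegree_smul_le _ _).trans (MvPolynomial.totalDegree_X _).le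

/-- There is an element of `S` whose conjugates are linearly independent modulo `𝔪^[q]`. -/
theorem exists_linearIndependent_quotRep [Infinite k] (p : ℕ) [Fact p.Prime] [CharP k p]
    [Fintype G] (e : ℕ) (he : Nat.card G ≤ p ^ e) :
    ∃ f, ∀ c : G → k, ∑ g, c g • quotRep G (p ^ e) g f = 0 → c = 0 := by
  classical
  obtain ⟨ξ, hξ⟩ := exists_dual_apply_ne G
  choose! v hv using hξ
  let ev (g : G) : SymmetricAlgebra k V →ₐ[k] k := SymmetricAlgebra.lift (ξ ∘ₗ g.1.1)
  have hev (g : G) (x : V) : ev g (SymmetricAlgebra.ι k V x) = ξ (g.1.1 x) :=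
    SymmetricAlgebra.lift_ι_apply _ x
  have hev' (g h : G) (s) : ev g (symAct k V h.1 s) = ev (g * h) s := by
    refine DFunLike.congr_fun (?_ : (ev g).comp (symAct k V h.1) = ev (g * h)) s
    apply SymmetricAlgebra.algHom_ext
    ext x
    change ev g (SymmetricAlgebra.lift (SymmetricAlgebra.ι k V ∘ₗ (h.1 : V →ₗ[k] V))
      (SymmetricAlgebra.ι k V x)) = ev (g * h) (SymmetricAlgebra.ι k V x)
    rw [SymmetricAlgebra.lift_ι_apply, hev]
    exact hev g _
  -- The factor for `g` vanishes at the point `ξ ∘ g` but not at `ξ`, so `f` separates `ξ` from the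
  -- rest of its orbit.
  let f : SymmetricAlgebra k V := ∏ g ∈ Finset.univ.erase (1 : G),
    (SymmetricAlgebra.ι k V (v g) - algebraMap k _ (ξ (g.1.1 (v g))))
  have hf0 (g : G) (hg : g ≠ 1) : ev g f = 0 := by
    rw [map_prod]
    refine Finset.prod_eq_zero (Finset.mem_erase.mpr ⟨hg, Finset.mem_univ g⟩) ?_
    rw [map_sub, hev, AlgHom.commutes, Algebra.algebraMap_self, RingHom.id_apply, sub_self]
  have hf1 : ev 1 f ≠ 0 := by
    rw [map_prod, Finset.prod_ne_zero_iff]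
    intro g hg
    rw [map_sub, hev, AlgHom.commutes, Algebra.algebraMap_self, RingHom.id_apply, sub_ne_zero]
    exact (hv g.1 g.2 fun h ↦ (Finset.mem_erase.mp hg).1 (Subtype.ext h)).symm
  let b := Module.Free.chooseBasis k V
  have hdeg (g : G) : (SymmetricAlgebra.equivMvPolynomial b (symAct k V g.1 f)).totalDegree <
      p ^ e := by
    refine lt_of_lt_of_le ?_ he
    rw [map_prod, map_prod]
    refine (MvPolynomial.totalDegree_finsetProd _ _).trans_lt ?_
    refine (Finset.sum_le_card_nsmul _ _ 1 fun h _ ↦ ?_).trans_lt ?_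
    · rw [map_sub, map_sub, AlgHom.commutes, AlgEquiv.commutes]
      refine (MvPolynomial.totalDegree_sub_C_le _ _).trans ?_
      rw [show symAct k V g.1 (SymmetricAlgebra.ι k V (v h)) = SymmetricAlgebra.ι k V (g.1.1 (v h))
        from SymmetricAlgebra.lift_ι_apply _ _]
      exact totalDegree_equivMvPolynomial_ι_le b _
    · rw [Finset.card_erase_of_mem (Finset.mem_univ _), Finset.card_univ, Nat.card_eq_fintype_card,
        smul_eq_mul, mul_one]
      exact Nat.sub_lt Fintype.card_pos one_pos
  refine ⟨Submodule.Quotient.mk f, fun c hc ↦ ?_⟩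
  have hmem : ∑ g, c g • symAct k V g.1 f ∈ frobPow (irrelevant k V) (p ^ e) := by
    have : Submodule.Quotient.mk (p := (frobPow (irrelevant k V) (p ^ e)).restrictScalars k)
        (∑ g, c g • symAct k V g.1 f) = 0 := by
      rw [← hc, ← Submodule.mkQ_apply, map_sum]
      rfl
    exact (Submodule.Quotient.mk_eq_zero _).mp this
  -- All conjugates of `f` have degree at most `#G - 1 < q`, so no exponent reaches `q` and the
  -- combination lies in `𝔪^[q]` only if it is zero.
  have hzero : ∑ g, c g • symAct k V g.1 f = 0 := by
    rw [mem_frobPow_irrelevant_iff p b] at hmem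
    rw [← map_eq_zero_iff _ (SymmetricAlgebra.equivMvPolynomial b).injective,
      ← MvPolynomial.support_eq_empty, Finset.eq_empty_iff_forall_notMem]
    intro m hm
    obtain ⟨i, hi⟩ := hmem m hm
    rw [map_sum] at hm
    obtain ⟨g, -, hg⟩ := Finset.mem_biUnion.mp (MvPolynomial.support_sum hm)
    rw [map_smul] at hg
    have h1 := MvPolynomial.le_totalDegree (MvPolynomial.support_smul hg)
    have h2 : m i ≤ m.sum fun _ e ↦ e := by
      by_cases h0 : m i = 0
      · rw [h0]; exact Nat.zero_le _
      · exact Finset.single_le_sum (f := fun i ↦ m i) (fun _ _ ↦ Nat.zero_le _)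
          (Finsupp.mem_support_iff.mpr h0)
    exact absurd (hdeg g) (not_lt.mpr (hi.trans (h2.trans h1)))
  funext g
  have := congrArg (ev g⁻¹) hzero
  rw [map_sum, map_zero, Finset.sum_eq_single g] at this
  · rw [map_smul, hev', inv_mul_cancel, smul_eq_mul] at this
    exact (mul_eq_zero.mp this).resolve_right hf1
  · intro h _ hne
    rw [map_smul, hev', hf0, smul_zero]
    rwa [Ne, inv_mul_eq_one, eq_comm]
  · simp

/-- All `q ≥ #G` are large enough. -/
theorem containsAllIrreps_of_card_le [Infinite k] (p : ℕ) [Fact p.Prime] [CharP k p] [Finite G]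
    (hG : (Nat.card G : k) ≠ 0) (e : ℕ) (he : Nat.card G ≤ p ^ e) : ContainsAllIrreps G (p ^ e) := by
  classical
  have : Fintype G := Fintype.ofFinite G
  intro U _ _ ρ hρ
  obtain ⟨f, hf⟩ := exists_linearIndependent_quotRep G p e he
  have hU : ∃ u : U, u ≠ 0 := by
    by_contra! h
    refine bot_ne_top (α := Subrepresentation ρ) ?_
    ext x
    simp [h x]
  obtain ⟨u, hu⟩ := hU
  obtain ⟨l, hl⟩ : ∃ l : Module.Dual k U, l u ≠ 0 := by
    by_contra! h
    exact hu ((Module.forall_dual_apply_eq_zero_iff k u).mp h)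
  -- The matrix coefficients of `U` along `l` map it into the span of the conjugates of `f`, which
  -- is a copy of the regular representation.
  let i : U →ₗ[k] _ := ∑ g : G, (l ∘ₗ ρ g⁻¹).smulRight (quotRep G (p ^ e) g f)
  have hi_apply (x : U) : i x = ∑ g : G, l (ρ g⁻¹ x) • quotRep G (p ^ e) g f := by
    simp [i]
  have hi (g : G) (x : U) : i (ρ g x) = quotRep G (p ^ e) g (i x) := by
    rw [hi_apply, hi_apply, map_sum, ← Equiv.sum_comp (Equiv.mulLeft g)]
    refine Finset.sum_congr rfl fun h _ ↦ ?_
    rw [map_smul, Equiv.coe_mulLeft, mul_inv_rev, ← Module.End.mul_apply, ← map_mul,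
      inv_mul_cancel_right, ← Module.End.mul_apply, ← map_mul]
  have hinj : Function.Injective i := by
    rw [← LinearMap.ker_eq_bot, LinearMap.ker_eq_bot']
    intro x hx
    rw [hi_apply] at hx
    have hx' := hf _ hx
    let W : Subrepresentation ρ :=
      { toSubmodule := ⨅ g : G, LinearMap.ker (l ∘ₗ ρ g)
        apply_mem_toSubmodule g y hy := by
          rw [Submodule.mem_iInf] at hy ⊢
          intro h
          have := hy (h * g)
          rw [LinearMap.mem_ker, LinearMap.comp_apply, map_mul] at this
          exact this }
    have hxW : x ∈ W.toSubmodule := by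
      refine (Submodule.mem_iInf _).mpr fun g ↦ ?_
      simpa using congrFun hx' g⁻¹
    rcases hρ.eq_bot_or_eq_top W with h | h
    · rw [h] at hxW
      exact hxW
    · have huW : u ∈ W.toSubmodule := by rw [h]; trivial
      have := (Submodule.mem_iInf _).mp huW 1
      rw [LinearMap.mem_ker, LinearMap.comp_apply, map_one] at this
      exact absurd this hl
  obtain ⟨π, hπ⟩ := LinearMap.exists_leftInverse_of_injective i (LinearMap.ker_eq_bot.mpr hinj)
  have hπ' (x : U) : π (i x) = x := LinearMap.congr_fun hπ x
  -- Maschke's averaging makes a linear left inverse equivariant.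
  let r : _ →ₗ[k] U := (Nat.card G : k)⁻¹ • ∑ g : G, ρ g ∘ₗ π ∘ₗ quotRep G (p ^ e) g⁻¹
  have hr_apply (x) : r x = (Nat.card G : k)⁻¹ • ∑ g : G, ρ g (π (quotRep G (p ^ e) g⁻¹ x)) := by
    simp [r]
  refine ⟨LinearMap.intertwiningMap_of_isIntertwiningMap _ _ i hi,
    LinearMap.intertwiningMap_of_isIntertwiningMap _ _ r fun g x ↦ ?_, fun x ↦ ?_⟩
  · rw [hr_apply, hr_apply, map_smul, map_sum, ← Equiv.sum_comp (Equiv.mulLeft g)]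
    congr 1
    refine Finset.sum_congr rfl fun h _ ↦ ?_
    rw [Equiv.coe_mulLeft, mul_inv_rev, ← Module.End.mul_apply (ρ g), ← map_mul,
      ← Module.End.mul_apply (quotRep G (p ^ e) _), ← map_mul, inv_mul_cancel_right]
  · change r (i x) = x
    rw [hr_apply, Finset.sum_congr rfl (g := fun _ ↦ x), Finset.sum_const, Finset.card_univ,
      ← Nat.card_eq_fintype_card, ← Nat.cast_smul_eq_nsmul k, inv_smul_smul₀ hG]
    intro g _
    rw [← hi, hπ', ← Module.End.mul_apply, ← map_mul, mul_inv_cancel, map_one, Module.End.one_apply]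

end Irreps

/-! ### Regular sequences generating the maximal ideals of a polynomial ring. -/

section PolynomialRegular

variable {k : Type u} [Field k] {ι : Type v}

theorem isSMulRegular_quotient_span_X {s : Set ι} {j : ι} (hj : j ∉ s)
    (I : Ideal (MvPolynomial ι k)) (hI : I = Ideal.span (MvPolynomial.X '' s)) :
    IsSMulRegular (MvPolynomial ι k ⧸ I • (⊤ : Submodule (MvPolynomial ι k) (MvPolynomial ι k)))
      (MvPolynomial.X j : MvPolynomial ι k) := by
  rw [smul_eq_mul, Ideal.mul_top]
  refine isSMulRegular_iff_right_eq_zero_of_smul.mpr fun y hy ↦ ?_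
  obtain ⟨y, rfl⟩ := Submodule.Quotient.mk_surjective _ y
  have hy' : MvPolynomial.X j * y ∈ I := (Submodule.Quotient.mk_eq_zero _).mp hy
  refine (Submodule.Quotient.mk_eq_zero _).mpr ?_
  rw [hI, MvPolynomial.mem_ideal_span_X_image] at hy' ⊢
  intro m hm
  obtain ⟨i, hi, hmi⟩ := hy' (Finsupp.single j 1 + m) (by
    rwa [MvPolynomial.mem_support_iff, MvPolynomial.coeff_X_mul, ← MvPolynomial.mem_support_iff])
  refine ⟨i, hi, ?_⟩
  have : i ≠ j := fun h ↦ hj (h ▸ hi)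
  simpa [Finsupp.single_apply, this.symm] using hmi

theorem isWeaklyRegular_X (l : List ι) (hl : l.Nodup) :
    IsWeaklyRegular (MvPolynomial ι k) (l.map (MvPolynomial.X : ι → MvPolynomial ι k)) := by
  rw [isWeaklyRegular_iff]
  intro i hi
  rw [List.getElem_map]
  rw [List.length_map] at hi
  refine isSMulRegular_quotient_span_X (s := {x | x ∈ l.take i}) (fun h ↦ ?_) _ ?_
  · obtain ⟨j, hj, hji⟩ := List.mem_iff_getElem.mp h
    rw [List.length_take] at hj
    rw [List.getElem_take] at hji
    have := (List.Nodup.getElem_inj_iff hl).mp hji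
    omega
  · rw [Ideal.ofList]
    congr 1
    ext x
    simp [← List.map_take]

/-- Translation by `a` is an automorphism carrying the variables to these elements. -/
theorem isWeaklyRegular_X_sub_C (l : List ι) (hl : l.Nodup) (a : ι → k) :
    IsWeaklyRegular (MvPolynomial ι k)
      (l.map fun i ↦ (MvPolynomial.X i - MvPolynomial.C (a i) : MvPolynomial ι k)) := by
  let φ : MvPolynomial ι k →ₐ[k] MvPolynomial ι k :=
    MvPolynomial.aeval fun i ↦ MvPolynomial.X i - MvPolynomial.C (a i)
  let ψ : MvPolynomial ι k →ₐ[k] MvPolynomial ι k :=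
    MvPolynomial.aeval fun i ↦ MvPolynomial.X i + MvPolynomial.C (a i)
  let e : MvPolynomial ι k ≃ₐ[k] MvPolynomial ι k := AlgEquiv.ofAlgHom φ ψ
    (by ext i; simp [φ, ψ]) (by ext i; simp [φ, ψ])
  have h := isWeaklyRegular_X (k := k) l hl
  refine (AddEquiv.isWeaklyRegular_congr (e := e.toRingEquiv.toAddEquiv) ?_).mp h
  rw [List.forall₂_map_left_iff, List.forall₂_map_right_iff, List.forall₂_same]
  intro i _ x
  simp [e, φ]

theorem maxIdealsRegular_mvPolynomial [IsAlgClosed k] [Fintype ι] :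
    MaxIdealsRegular (MvPolynomial ι k) (Fintype.card ι) := by
  intro m hm
  obtain ⟨a, ha⟩ := MvPolynomial.isMaximal_iff_eq_vanishingIdeal_singleton.mp hm
  refine ⟨Finset.univ.toList.map fun i ↦ MvPolynomial.X i - MvPolynomial.C (a i), by simp,
    ?_, isWeaklyRegular_X_sub_C _ (Finset.nodup_toList _) a⟩
  have hle : Ideal.ofList (Finset.univ.toList.map
      fun i ↦ MvPolynomial.X i - MvPolynomial.C (a i)) ≤ m := by
    rw [Ideal.ofList, Ideal.span_le]
    intro x hx
    obtain ⟨i, -, rfl⟩ := List.mem_map.mp hx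
    rw [ha, SetLike.mem_coe, MvPolynomial.mem_vanishingIdeal_singleton_iff]
    simp
  refine le_antisymm hle fun f hf ↦ ?_
  set I := Ideal.ofList (Finset.univ.toList.map
      fun i ↦ (MvPolynomial.X i - MvPolynomial.C (a i) : MvPolynomial ι k)) with hI
  have hmod (f : MvPolynomial ι k) : f - MvPolynomial.C (MvPolynomial.eval a f) ∈ I := by
    induction f using MvPolynomial.induction_on with
    | C c => simp
    | add f g hf hg =>
      convert I.add_mem hf hg using 1
      simp only [map_add]; ring
    | mul_X f i hf =>
      have hi : MvPolynomial.X i - MvPolynomial.C (a i) ∈ I :=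
        Ideal.subset_span (List.mem_map.mpr ⟨i, by simp, rfl⟩)
      convert I.add_mem (I.mul_mem_right (MvPolynomial.X i) hf)
        (I.mul_mem_left (MvPolynomial.C (MvPolynomial.eval a f)) hi) using 1
      simp only [map_mul, MvPolynomial.eval_X]; ring
  have h0 : MvPolynomial.eval a f = 0 := by
    rw [ha, MvPolynomial.mem_vanishingIdeal_singleton_iff] at hf
    simpa using hf
  simpa [h0] using hmod f

end PolynomialRegular

/-! ### Linear group actions on polynomials preserve the grading. -/

section LinearAction

variable {k : Type u} [Field k] {ι : Type v} {G : Type*} [Group G]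
  [MulSemiringAction G (MvPolynomial ι k)] [SMulCommClass G k (MvPolynomial ι k)]

open MvPolynomial

theorem smul_C_eq (g : G) (c : k) : g • (C c : MvPolynomial ι k) = C c :=
  smul_algebraMap g c

theorem smul_eq_aeval (g : G) (f : MvPolynomial ι k) :
    g • f = aeval (fun i ↦ g • (X i : MvPolynomial ι k)) f := by
  have : MulSemiringAction.toAlgHom k (MvPolynomial ι k) g =
      aeval (fun i ↦ g • (X i : MvPolynomial ι k)) := by
    ext i
    simp
  exact DFunLike.congr_fun this f

variable (hlin : ∀ (g : G) (i : ι), (g • (X i : MvPolynomial ι k)).IsHomogeneous 1)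

include hlin

theorem IsHomogeneous.smul (g : G) {f : MvPolynomial ι k} {n : ℕ} (hf : f.IsHomogeneous n) :
    (g • f).IsHomogeneous n := by
  rw [smul_eq_aeval]
  simpa using hf.aeval _ (hlin g)

theorem homogeneousComponent_smul (g : G) (f : MvPolynomial ι k) (n : ℕ) :
    homogeneousComponent n (g • f) = g • homogeneousComponent n f := by
  conv_lhs => rw [← sum_homogeneousComponent f, Finset.smul_sum, map_sum]
  have (i : ℕ) : homogeneousComponent n (g • homogeneousComponent i f) =
      if i = n then g • homogeneousComponent i f else 0 := by
    rw [homogeneousComponent_of_mem (m := n)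
      (IsHomogeneous.smul hlin g (homogeneousComponent_isHomogeneous i f))]
    simp only [eq_comm]
  simp only [this]
  rw [Finset.sum_ite_eq' ]
  split_ifs with h
  · rfl
  · rw [Finset.mem_range, not_lt, Nat.succ_le_iff] at h
    rw [homogeneousComponent_eq_zero _ _ h, smul_zero]

theorem totalDegree_smul_le (g : G) (f : MvPolynomial ι k) :
    (g • f).totalDegree ≤ f.totalDegree := by
  conv_lhs => rw [← sum_homogeneousComponent f, Finset.smul_sum]
  refine totalDegree_finsetSum_le fun i hi ↦ ?_
  exact (IsHomogeneous.smul hlin g (homogeneousComponent_isHomogeneous i f)).totalDegree_le.trans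
    (Nat.lt_succ_iff.mp (Finset.mem_range.mp hi))

theorem constantCoeff_smul (g : G) (f : MvPolynomial ι k) : coeff 0 (g • f) = coeff 0 f := by
  have := homogeneousComponent_smul hlin g f 0
  rw [homogeneousComponent_zero, homogeneousComponent_zero, smul_C_eq] at this
  exact C_injective _ _ this

end LinearAction

/-! ### The Reynolds operator and noetherianity of invariants. -/

section Invariants

variable {R P G : Type*} [CommRing R] [CommRing P] [Algebra R P] [Group G] [Fintype G]
  [MulSemiringAction G P] [SMulCommClass G R P] [Algebra.IsInvariant R P G]

/-- The Reynolds operator. -/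
theorem exists_reynolds (hinj : Function.Injective (algebraMap R P))
    (hu : IsUnit (Fintype.card G : R)) :
    ∃ r : P →ₗ[R] R, (∀ a, r (algebraMap R P a) = a) ∧
      ∀ s, algebraMap R P (r s) * (Fintype.card G : P) = ∑ g : G, g • s := by
  obtain ⟨c, hc⟩ := isUnit_iff_exists_inv.mp hu
  have hinv (s : P) : ∃ a : R, algebraMap R P a = ∑ g : G, g • s :=
    Algebra.IsInvariant.isInvariant (G := G) _ fun g ↦ by
      rw [Finset.smul_sum]
      simp only [smul_smul]
      exact Equiv.sum_comp (Equiv.mulLeft g) (fun h ↦ h • s)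
  choose t ht using hinv
  let r : P →ₗ[R] R :=
    { toFun s := c * t s
      map_add' s s' := hinj (by
        simp only [map_mul, map_add, ht, smul_add, Finset.sum_add_distrib, mul_add])
      map_smul' a s := hinj (by
        simp only [map_mul, ht, smul_comm _ a, ← Finset.smul_sum, RingHom.id_apply, smul_eq_mul]
        rw [Algebra.smul_def]
        ring) }
  have hr (s : P) : algebraMap R P (r s) = algebraMap R P c * ∑ g : G, g • s := by
    rw [← ht, ← map_mul]; rfl
  have hc' : (Fintype.card G : P) * algebraMap R P c = 1 := by
    rw [← map_natCast (algebraMap R P), ← map_mul, hc, map_one]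
  refine ⟨r, fun a ↦ hinj ?_, fun s ↦ ?_⟩
  · rw [hr]
    simp only [smul_algebraMap, Finset.sum_const, Finset.card_univ, nsmul_eq_mul]
    linear_combination (algebraMap R P a) * hc'
  · rw [hr]
    linear_combination (∑ g : G, g • s) * hc'

/-- The retraction shows that extending an ideal to `P` and contracting it gives it back, so
extension of ideals is strictly increasing. -/
theorem isNoetherianRing_of_retract [IsNoetherianRing P] (r : P →ₗ[R] R)
    (hr : ∀ a, r (algebraMap R P a) = a) : IsNoetherianRing R := by
  have h (I : Ideal R) : (I.map (algebraMap R P)).comap (algebraMap R P) = I := by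
    refine le_antisymm (fun a ha ↦ ?_) Ideal.le_comap_map
    have key (s : P) (hs : s ∈ I.map (algebraMap R P)) : r s ∈ I := by
      induction hs using Submodule.span_induction with
      | mem s hs =>
        obtain ⟨a, ha, rfl⟩ := hs
        rwa [hr]
      | zero => rw [map_zero]; exact I.zero_mem
      | add s t _ _ hs ht => rw [map_add]; exact I.add_mem hs ht
      | smul b s h hs =>
        clear hs
        rw [smul_eq_mul]
        induction h using Submodule.span_induction generalizing b with
        | mem s hs =>
          obtain ⟨a, ha, rfl⟩ := hs
          rw [mul_comm, ← Algebra.smul_def, map_smul]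
          exact I.mul_mem_right _ ha
        | zero => rw [mul_zero, map_zero]; exact I.zero_mem
        | add s t _ _ hs ht => rw [mul_add, map_add]; exact I.add_mem (hs b) (ht b)
        | smul c s _ hs => rw [smul_eq_mul, ← mul_assoc]; exact hs _
    rw [← hr a]
    exact key _ (Ideal.mem_comap.mp ha)
  refine isNoetherianRing_iff.mpr <| isNoetherian_iff'.mpr ?_
  have hmono : StrictMono fun I : Ideal R ↦ I.map (algebraMap R P) := by
    refine Monotone.strictMono_of_injective (fun I J ↦ Ideal.map_mono) fun I J hIJ ↦ ?_
    rw [← h I, ← h J]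
    exact congrArg _ hIJ
  exact hmono.wellFoundedGT

end Invariants

/-! ### Polynomials in coordinates over their `q`-th powers. -/

section FrobeniusBasis

variable {k : Type u} [Field k] (p : ℕ) [Fact p.Prime] [CharP k p] [PerfectRing k p] {ι : Type v}
  (e : ℕ)

open MvPolynomial

/-- The exponent `a + q m`. -/
noncomputable def expo (a m : ι →₀ ℕ) : ι →₀ ℕ := a + p ^ e • m

theorem expo_injective (a : ι →₀ ℕ) : Function.Injective (expo p e a) := fun m m' h ↦ by
  ext i
  have := DFunLike.congr_fun h i
  simpa [expo, (Fact.out : p.Prime).ne_zero] using this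

/-- The coordinate functions of the basis of `S` over `S^q` consisting of the monomials `x^a`. -/
noncomputable def frobCoord (a : ι →₀ ℕ) (f : MvPolynomial ι k) : MvPolynomial ι k :=
  ∑ m ∈ f.support.preimage (expo p e a) (expo_injective p e a).injOn,
    monomial m ((iterateFrobeniusEquiv k p e).symm (coeff (expo p e a m) f))

theorem coeff_frobCoord (a : ι →₀ ℕ) (f : MvPolynomial ι k) (m : ι →₀ ℕ) :
    coeff m (frobCoord p e a f) = (iterateFrobeniusEquiv k p e).symm (coeff (expo p e a m) f) := by
  classical
  rw [frobCoord, coeff_sum]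
  simp only [coeff_monomial]
  rw [Finset.sum_ite_eq']
  split_ifs with h
  · rfl
  · rw [Finset.mem_preimage, notMem_support_iff] at h
    rw [h, map_zero]

theorem frobCoord_add (a : ι →₀ ℕ) (f g : MvPolynomial ι k) :
    frobCoord p e a (f + g) = frobCoord p e a f + frobCoord p e a g := by
  ext m
  simp [coeff_frobCoord]

theorem frobCoord_pow_mul (a : ι →₀ ℕ) (ha : ∀ i, a i < p ^ e) (s f : MvPolynomial ι k) :
    frobCoord p e a (s ^ p ^ e * f) = s * frobCoord p e a f := by
  induction s using MvPolynomial.induction_on' with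
  | monomial n c =>
    ext m
    rw [monomial_pow, coeff_frobCoord, coeff_monomial_mul', coeff_monomial_mul', coeff_frobCoord]
    have h : p ^ e • n ≤ expo p e a m ↔ n ≤ m := by
      refine forall_congr' fun i ↦ ?_
      simp only [expo, Finsupp.smul_apply, Finsupp.add_apply, smul_eq_mul]
      have hi := ha i
      constructor
      · intro h
        by_contra! hlt
        have : p ^ e * (m i + 1) ≤ p ^ e * n i := Nat.mul_le_mul_left _ hlt
        rw [mul_add] at this
        omega
      · intro h
        exact (Nat.mul_le_mul_left _ h).trans (Nat.le_add_left _ _)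
    simp only [h]
    split_ifs with hnm
    · rw [map_mul]
      congr 1
      · rw [RingEquiv.symm_apply_eq, iterateFrobeniusEquiv_def]
      · congr 2
        ext i
        have := Nat.mul_le_mul_left (p ^ e) (hnm i)
        simp only [expo, Finsupp.smul_apply, Finsupp.add_apply, smul_eq_mul, Finsupp.tsub_apply,
          Nat.mul_sub]
        omega
    · rw [map_zero]
  | add s t hs ht =>
    rw [add_pow_char_pow, add_mul, frobCoord_add, hs, ht, add_mul]

/-- The exponents `a` with all `a i < q`. -/
noncomputable def digits [Finite ι] (a : ι → Fin (p ^ e)) : ι →₀ ℕ :=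
  Finsupp.equivFunOnFinite.symm fun i ↦ a i

omit [Fact p.Prime] in
theorem digits_lt [Finite ι] (a : ι → Fin (p ^ e)) (i : ι) : digits p e a i < p ^ e := (a i).2

/-- Each exponent is divided by `q` with remainder; the quotients form the coordinate, whose
coefficients are `q`-th roots, and the remainders name the basis monomial. -/
theorem sum_frobCoord_pow_mul [Fintype ι] [DecidableEq ι] (f : MvPolynomial ι k) :
    ∑ a : ι → Fin (p ^ e), frobCoord p e (digits p e a) f ^ p ^ e * monomial (digits p e a) 1 = f := by
  induction f using MvPolynomial.induction_on' with
  | monomial n c =>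
    have hq : 0 < p ^ e := pow_pos (Fact.out : p.Prime).pos e
    let a₀ : ι → Fin (p ^ e) := fun i ↦ ⟨n i % p ^ e, Nat.mod_lt _ hq⟩
    let m₀ : ι →₀ ℕ := Finsupp.equivFunOnFinite.symm fun i ↦ n i / p ^ e
    have hn : expo p e (digits p e a₀) m₀ = n := by
      ext i
      simp [expo, digits, a₀, m₀, Nat.mod_add_div]
    rw [Finset.sum_eq_single a₀]
    · have : frobCoord p e (digits p e a₀) (monomial n c) =
          monomial m₀ ((iterateFrobeniusEquiv k p e).symm c) := by
        ext m
        rw [coeff_frobCoord, coeff_monomial, coeff_monomial]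
        conv_lhs => rw [← hn]
        simp only [(expo_injective p e (digits p e a₀)).eq_iff]
        split_ifs <;> simp
      rw [this, monomial_pow, monomial_mul, mul_one, ← iterateFrobeniusEquiv_def,
        RingEquiv.apply_symm_apply]
      exact congrArg (fun n ↦ monomial n c) ((add_comm _ _).trans hn)
    · intro a _ ha
      have : frobCoord p e (digits p e a) (monomial n c) = 0 := by
        ext m
        rw [coeff_frobCoord, coeff_monomial, if_neg, map_zero, coeff_zero]
        intro h
        refine ha (funext fun i ↦ Fin.ext ?_)
        have hi : n i = a i + p ^ e * m i := by rw [h]; simp [expo, digits]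
        change _ = n i % p ^ e
        rw [hi, Nat.add_mul_mod_self_left, Nat.mod_eq_of_lt (a i).2]
      rw [this, zero_pow hq.ne', zero_mul]
    · simp
  | add f g hf hg =>
    conv_rhs => rw [← hf, ← hg]
    rw [← Finset.sum_add_distrib]
    refine Finset.sum_congr rfl fun a _ ↦ ?_
    rw [frobCoord_add, add_pow_char_pow, add_mul]

end FrobeniusBasis

/-! ### Comparing the Frobenius module of the invariants with the polynomial ring. -/

section FrobTwist

/-- The ring `R` as a module over itself via the `e`-th iterate of Frobenius. -/
def FrobTwist (R : Type*) (_ _ : ℕ) := R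

variable (R : Type*) [CommRing R] (p e : ℕ) [ExpChar R p]

instance : AddCommGroup (FrobTwist R p e) := inferInstanceAs (AddCommGroup R)

noncomputable instance : Module R (FrobTwist R p e) := Module.compHom R (iterateFrobenius R p e)

/-- The identity map. -/
def FrobTwist.equiv : FrobTwist R p e ≃+ R := AddEquiv.refl R

variable {R p e}

theorem FrobTwist.equiv_smul (r : R) (x : FrobTwist R p e) :
    FrobTwist.equiv R p e (r • x) = r ^ p ^ e * FrobTwist.equiv R p e x := rfl

variable {k : Type u} [Field k] [Fact p.Prime] [CharP k p] [PerfectRing k p] {ι : Type v}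
  [Fintype ι] [Algebra R (MvPolynomial ι k)] {G : Type*} [Group G] [Fintype G]
  [MulSemiringAction G (MvPolynomial ι k)]

open MvPolynomial

variable (ι) in
/-- The coordinate function `frobCoord` restricted to `R`. -/
noncomputable def frobCoordLinear (a : ι →₀ ℕ) (ha : ∀ i, a i < p ^ e) :
    FrobTwist R p e →ₗ[R] MvPolynomial ι k where
  toFun x := frobCoord p e a (algebraMap R _ (FrobTwist.equiv R p e x))
  map_add' x y := by rw [map_add, map_add, frobCoord_add]
  map_smul' r x := by
    rw [FrobTwist.equiv_smul, map_mul, map_pow, frobCoord_pow_mul p e a ha, RingHom.id_apply,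
      Algebra.smul_def]

/-- The map `s ↦ r (s ^ q * f)`. -/
noncomputable def powMulLinear (r : MvPolynomial ι k →ₗ[R] R) (f : MvPolynomial ι k) :
    MvPolynomial ι k →ₗ[R] FrobTwist R p e where
  toFun s := (FrobTwist.equiv R p e).symm (r (s ^ p ^ e * f))
  map_add' s t := by rw [add_pow_char_pow, add_mul, map_add, map_add]
  map_smul' a s := by
    apply (FrobTwist.equiv R p e).injective
    rw [RingHom.id_apply, FrobTwist.equiv_smul, AddEquiv.apply_symm_apply,
      AddEquiv.apply_symm_apply, smul_pow, smul_mul_assoc, map_smul, smul_eq_mul]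

/-- An invariant is expanded over the basis monomials of `S` over `S^q`, and the expansion is
projected back to `R` by `r`. -/
theorem inAdd_frobTwist (r : MvPolynomial ι k →ₗ[R] R) (hr : ∀ a, r (algebraMap R _ a) = a) :
    InAdd R (FrobTwist R p e) (MvPolynomial ι k) := by
  classical
  refine InAdd.of_fintype (ι := ι → Fin (p ^ e))
    (fun a ↦ powMulLinear r (monomial (digits p e a) 1))
    (fun a ↦ frobCoordLinear ι (digits p e a) (digits_lt p e a)) fun x ↦ ?_
  apply (FrobTwist.equiv R p e).injective
  rw [map_sum]
  conv_rhs => rw [← hr (FrobTwist.equiv R p e x),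
    ← sum_frobCoord_pow_mul p e (algebraMap R (MvPolynomial ι k) (FrobTwist.equiv R p e x)), map_sum]
  rfl

omit [CharP k p] [PerfectRing k p] in
-- Faithfulness says that the functions `g ↦ coeff a (g • x^b)`, with all exponents in `a` below
-- `q`, span all functions on `G`. In particular they express the indicator of `1`, and the
-- coefficients of that expression give the `f j`.
theorem exists_dual_family [SMulCommClass G k (MvPolynomial ι k)] [DecidableEq G]
    (hlin : ∀ (g : G) (i : ι), (g • (X i : MvPolynomial ι k)).IsHomogeneous 1)
    (hfaith : ∀ c : G → k, (∀ (f : MvPolynomial ι k) (a : ι →₀ ℕ), (∀ i, a i < p ^ e) →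
      coeff a (∑ g, c g • g • f) = 0) → c = 0) :
    ∃ (J : Type v) (_ : Fintype J) (f : J → MvPolynomial ι k) (a : J → ι →₀ ℕ),
      (∀ j i, a j i < p ^ e) ∧ ∀ (g : G) (m : ι →₀ ℕ),
        ∑ j, coeff (expo p e (a j) m) (g • f j) = if g = 1 ∧ m = 0 then 1 else 0 := by
  -- Only pairs of equal degree are kept. The others contribute nothing, as the action preserves
  -- degree, and equality of degrees makes the coefficients at `a + qm` with `m ≠ 0` vanish for
  -- free.
  let Λ : Type v := {x : (ι →₀ ℕ) × (ι →₀ ℕ) // (∀ i, x.2 i < p ^ e) ∧ x.1.degree = x.2.degree}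
  let w : Λ → G → k := fun x g ↦ coeff x.1.2 (g • monomial x.1.1 (1 : k))
  have hmon (g : G) (b : ι →₀ ℕ) (c : k) :
      g • monomial b c = c • g • (monomial b (1 : k) : MvPolynomial ι k) := by
    rw [← smul_comm g c, smul_monomial, smul_eq_mul, mul_one]
  have hhom (g : G) (b : ι →₀ ℕ) (c : k) : (g • monomial b c : MvPolynomial ι k).IsHomogeneous
      b.degree := IsHomogeneous.smul hlin g (isHomogeneous_monomial c rfl)
  have hspan : Submodule.span k (Set.range w) = ⊤ := by
    by_contra hne
    obtain ⟨φ, hφ0, hφ⟩ := Submodule.exists_le_ker_of_lt_top _ (lt_top_iff_ne_top.mpr hne)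
    have hφw (y : G → k) : φ y = ∑ g, φ (Pi.single g 1) * y g := by
      conv_lhs => rw [pi_eq_sum_univ' y, map_sum]
      refine Finset.sum_congr rfl fun g _ ↦ ?_
      rw [map_smul, smul_eq_mul, mul_comm]
    have hc : (fun g ↦ φ (Pi.single g 1)) = 0 := by
      refine hfaith _ fun f a ha ↦ ?_
      induction f using MvPolynomial.induction_on' with
      | monomial b c =>
        by_cases hab : b.degree = a.degree
        · have h0 : φ (w ⟨(b, a), ha, hab⟩) = 0 := hφ (Submodule.subset_span ⟨_, rfl⟩)
          rw [hφw] at h0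
          simp only [hmon _ b c, coeff_sum, coeff_smul, smul_eq_mul]
          simp only [mul_left_comm _ c, ← Finset.mul_sum]
          rw [h0, mul_zero]
        · rw [coeff_sum]
          refine Finset.sum_eq_zero fun g _ ↦ ?_
          rw [coeff_smul, (hhom g b c).coeff_eq_zero (Ne.symm hab), smul_zero]
      | add f f' hf hf' =>
        simp only [smul_add, Finset.sum_add_distrib, coeff_add, hf, hf', add_zero]
    refine hφ0 (LinearMap.ext fun y ↦ ?_)
    rw [hφw]
    exact Finset.sum_eq_zero fun g _ ↦ by rw [show φ (Pi.single g 1) = 0 from congrFun hc g, zero_mul]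
  have h1 : (Pi.single 1 1 : G → k) ∈ Submodule.span k (Set.range w) := hspan ▸ trivial
  obtain ⟨l, hl⟩ := (Finsupp.mem_span_range_iff_exists_finsupp).mp h1
  refine ⟨l.support, inferInstance, fun j ↦ monomial j.1.1.1 (l j), fun j ↦ j.1.1.2,
    fun j ↦ j.1.2.1, fun g m ↦ ?_⟩
  by_cases hm : m = 0
  · subst hm
    have hexpo (a : ι →₀ ℕ) : expo p e a 0 = a := by simp [expo]
    simp only [hexpo, and_true]
    have := congrFun hl g
    rw [Finsupp.sum, Finset.sum_apply, ← Finset.sum_coe_sort] at this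
    rw [Pi.single_apply] at this
    rw [← this]
    refine Finset.sum_congr rfl fun j _ ↦ ?_
    rw [hmon, coeff_smul]
    rfl
  · rw [if_neg (fun h ↦ hm h.2)]
    refine Finset.sum_eq_zero fun j _ ↦ (hhom g _ _).coeff_eq_zero ?_
    rw [j.1.2.2, expo, map_add, map_nsmul]
    have h1 : m.degree ≠ 0 := by rwa [Ne, Finsupp.degree_eq_zero_iff]
    have h2 : p ^ e ≠ 0 := pow_ne_zero _ (Fact.out : p.Prime).ne_zero
    rw [smul_eq_mul]
    exact Nat.add_eq_left.not.mpr (Nat.mul_ne_zero h2 h1)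

/-- Send `s` to the traces of `s^q f_j` and take the coordinate at `a_j`. The sum over `j` is `∑ g,
(g • s) · δ_{g,1} = s`. -/
theorem inAdd_mvPolynomial_frobTwist [SMulCommClass G k (MvPolynomial ι k)]
    (hlin : ∀ (g : G) (i : ι), (g • (X i : MvPolynomial ι k)).IsHomogeneous 1)
    (hfaith : ∀ c : G → k, (∀ (f : MvPolynomial ι k) (a : ι →₀ ℕ), (∀ i, a i < p ^ e) →
      coeff a (∑ g, c g • g • f) = 0) → c = 0) (t : MvPolynomial ι k →ₗ[R] R)
    (ht : ∀ s, algebraMap R _ (t s) = ∑ g : G, g • s) :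
    InAdd R (MvPolynomial ι k) (FrobTwist R p e) := by
  classical
  obtain ⟨J, _, f, a, ha, hfa⟩ := exists_dual_family hlin hfaith
  refine InAdd.of_fintype (ι := J) (fun j ↦ frobCoordLinear ι (a j) (ha j))
    (fun j ↦ powMulLinear t (f j)) fun s ↦ ?_
  have hsum (a : ι →₀ ℕ) (y : G → MvPolynomial ι k) :
      frobCoord p e a (∑ g, y g) = ∑ g, frobCoord p e a (y g) :=
    map_sum (AddMonoidHom.mk' (frobCoord p e a) (frobCoord_add p e a)) y _
  have h1 (j : J) : frobCoordLinear ι (a j) (ha j) (powMulLinear (e := e) (p := p) t (f j) s) =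
      ∑ g : G, (g • s) * frobCoord p e (a j) (g • f j) := by
    change frobCoord p e (a j) (algebraMap R _ (t (s ^ p ^ e * f j))) = _
    rw [ht, hsum]
    refine Finset.sum_congr rfl fun g _ ↦ ?_
    rw [smul_mul', smul_pow', frobCoord_pow_mul p e _ (ha j)]
  have h2 (g : G) : ∑ j, frobCoord p e (a j) (g • f j) = if g = 1 then 1 else 0 := by
    ext m
    rw [coeff_sum]
    simp only [coeff_frobCoord]
    rw [← map_sum, hfa]
    by_cases hg : g = 1 <;> by_cases hm : m = 0 <;> simp [hg, hm, coeff_one, eq_comm]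
  simp only [h1]
  rw [Finset.sum_comm]
  simp only [← Finset.mul_sum, h2]
  simp

end FrobTwist

/-! ### Chevalley–Shephard–Todd: freeness over the invariants of a reflection group. -/

section Chevalley

open MvPolynomial

variable {k : Type u} [Field k] {ι : Type v} {H : Type*} [Group H]
  [MulSemiringAction H (MvPolynomial ι k)] 

/-- `h` acts on the linear forms as a (pseudo)reflection or as the identity. -/
def IsReflection (h : H) : Prop :=
  ∃ l : MvPolynomial ι k, l.IsHomogeneous 1 ∧ ∀ i, ∃ c : k, h • (X i : MvPolynomial ι k) - X i = c • l

variable [SMulCommClass H k (MvPolynomial ι k)]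

/-- `f ↦ h • f - f` is a twisted derivation, so divisibility by `l` propagates from the variables to
all polynomials. -/
theorem exists_smul_sub_eq_mul (h : H) (l : MvPolynomial ι k)
    (hl : ∀ i, ∃ c : k, h • (X i : MvPolynomial ι k) - X i = c • l) (f : MvPolynomial ι k) :
    ∃ f', h • f - f = l * f' := by
  change l ∣ h • f - f
  induction f using MvPolynomial.induction_on with
  | C c => rw [smul_C_eq, sub_self]; exact dvd_zero _
  | add f g hf hg =>
    rw [smul_add, add_sub_add_comm]
    exact dvd_add hf hg
  | mul_X f i hf =>
    obtain ⟨c, hc⟩ := hl i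
    have : h • (f * X i) - f * X i = (h • f) * (h • (X i : MvPolynomial ι k) - X i) +
        (h • f - f) * X i := by rw [smul_mul']; ring
    rw [this, hc]
    exact dvd_add (Dvd.dvd.mul_left (by rw [smul_eq_C_mul]; exact dvd_mul_left _ _) _)
      (hf.mul_right _)

theorem coeff_mul_of_order_le {b t : MvPolynomial ι k} {n : ι →₀ ℕ}
    (hb : ∀ m : ι →₀ ℕ, m.degree < n.degree → coeff m b = 0) :
    coeff n (b * t) = coeff n b * coeff 0 t := by
  classical
  rw [coeff_mul, Finset.sum_eq_single (n, 0)]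
  · rintro ⟨x, y⟩ hxy hne
    replace hxy := Finset.HasAntidiagonal.mem_antidiagonal.mp hxy
    dsimp only at hxy
    have hy : y ≠ 0 := by
      rintro rfl
      exact hne (by rw [← hxy]; simp)
    rw [hb x, zero_mul]
    rw [← hxy]
    change x.degree < (x + y).degree
    have : y.degree ≠ 0 := by rwa [Ne, Finsupp.degree_eq_zero_iff]
    rw [map_add]
    omega
  · intro h
    simp at h

variable {B : Type*} [CommRing B] [Algebra B (MvPolynomial ι k)]

variable (B k ι) in
/-- The ideal generated by the invariants without constant term. -/
noncomputable def coinvariantIdeal : Ideal (MvPolynomial ι k) :=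
  Ideal.span {x | ∃ b : B, algebraMap B (MvPolynomial ι k) b = x ∧ coeff 0 x = 0}

variable [SMulCommClass H B (MvPolynomial ι k)] [Algebra.IsInvariant B (MvPolynomial ι k) H]

omit [SMulCommClass H k (MvPolynomial ι k)] [SMulCommClass H B (MvPolynomial ι k)] in
theorem mem_coinvariantIdeal_of_smul_eq (x : MvPolynomial ι k) (hx : ∀ h : H, h • x = x)
    (h0 : coeff 0 x = 0) : x ∈ coinvariantIdeal k ι B := by
  obtain ⟨b, hb⟩ := Algebra.IsInvariant.isInvariant (A := B) x hx
  exact Ideal.subset_span ⟨b, hb, h0⟩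

omit [SMulCommClass H k (MvPolynomial ι k)] [Algebra.IsInvariant B (MvPolynomial ι k) H] in
theorem smul_mem_coinvariantIdeal (h : H) {x : MvPolynomial ι k}
    (hx : x ∈ coinvariantIdeal k ι B) : h • x ∈ coinvariantIdeal k ι B := by
  induction hx using Submodule.span_induction with
  | mem x hx =>
    obtain ⟨b, rfl, h0⟩ := hx
    rw [smul_algebraMap]
    exact Ideal.subset_span ⟨b, rfl, h0⟩
  | zero => rw [smul_zero]; exact zero_mem _
  | add x y _ _ hx hy => rw [smul_add]; exact add_mem hx hy
  | smul a x _ hx => rw [smul_eq_mul, smul_mul']; exact Ideal.mul_mem_left _ _ hx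

variable (hlin : ∀ (g : H) (i : ι), (g • (X i : MvPolynomial ι k)).IsHomogeneous 1)

include hlin in
/-- Chevalley's lemma: a relation over the invariants of a reflection group gives a relation modulo
the coinvariant ideal between the initial coefficients. -/
theorem sum_coeff_mul_mem_coinvariantIdeal [Fintype H]
    (hrefl : Subgroup.closure {h : H | IsReflection (k := k) (ι := ι) h} = ⊤)
    (hcard : (Fintype.card H : k) ≠ 0) {κ : Type*} (s : Finset κ) (b : κ → B) (n : ι →₀ ℕ)
    (hb : ∀ j ∈ s, ∀ m : ι →₀ ℕ, m.degree < n.degree →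
      coeff m (algebraMap B (MvPolynomial ι k) (b j)) = 0) (N : ℕ) (f : κ → MvPolynomial ι k)
    (hf : ∀ j ∈ s, f j = 0 ∨ (f j).totalDegree < N)
    (hsum : ∑ j ∈ s, algebraMap B (MvPolynomial ι k) (b j) * f j = 0) :
    ∑ j ∈ s, C (coeff n (algebraMap B (MvPolynomial ι k) (b j))) * f j ∈ coinvariantIdeal k ι B := by
  induction N generalizing f with
  | zero =>
    refine Ideal.sum_mem _ fun j hj ↦ ?_
    rw [(hf j hj).resolve_right (Nat.not_lt_zero _), mul_zero]
    exact zero_mem _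
  | succ N ih =>
    set F := ∑ j ∈ s, C (coeff n (algebraMap B (MvPolynomial ι k) (b j))) * f j with hF
    have hsmulF (h : H) : h • F =
        ∑ j ∈ s, C (coeff n (algebraMap B (MvPolynomial ι k) (b j))) * h • f j := by
      rw [hF, Finset.smul_sum]
      exact Finset.sum_congr rfl fun j _ ↦ by rw [smul_mul', smul_C_eq]
    have hsmul (h : H) : ∑ j ∈ s, algebraMap B (MvPolynomial ι k) (b j) * h • f j = 0 := by
      have := congrArg (fun x ↦ h • x) hsum
      simpa [Finset.smul_sum, smul_mul', smul_algebraMap] using this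
    have hr (h : H) (hh : IsReflection (k := k) (ι := ι) h) : h • F - F ∈ coinvariantIdeal k ι B := by
      obtain ⟨l, hl1, hl⟩ := hh
      choose f' hf' using exists_smul_sub_eq_mul h l hl
      -- Dividing the relation's change under `h` by `l` gives a relation of lower degree with the
      -- same coefficients, to which induction applies.
      have hFF : h • F - F =
          l * ∑ j ∈ s, C (coeff n (algebraMap B (MvPolynomial ι k) (b j))) * f' (f j) := by
        rw [hsmulF, hF, ← Finset.sum_sub_distrib, Finset.mul_sum]
        refine Finset.sum_congr rfl fun j _ ↦ ?_
        rw [← mul_sub, hf']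
        ring
      by_cases hl0 : l = 0
      · rw [hFF, hl0, zero_mul]
        exact zero_mem _
      · rw [hFF]
        refine Ideal.mul_mem_left _ _ (ih (fun j ↦ f' (f j)) (fun j hj ↦ ?_) ?_)
        · by_cases h0 : f' (f j) = 0
          · exact Or.inl h0
          · right
            rcases hf j hj with hj0 | hjN
            · exfalso
              have := hf' (f j)
              rw [hj0, smul_zero, sub_zero] at this
              rw [hj0] at h0
              exact mul_ne_zero hl0 h0 this.symm
            · have h1 := totalDegree_mul_of_isDomain hl0 h0
              rw [← hf', hl1.totalDegree hl0] at h1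
              have h2 := totalDegree_sub (h • f j) (f j)
              have h3 := totalDegree_smul_le hlin h (f j)
              rw [max_eq_right h3] at h2
              omega
        · refine (mul_eq_zero.mp (?_ : l * _ = 0)).resolve_left hl0
          rw [Finset.mul_sum]
          have : ∀ j ∈ s, l * (algebraMap B (MvPolynomial ι k) (b j) * f' (f j)) =
              algebraMap B (MvPolynomial ι k) (b j) * h • f j -
                algebraMap B (MvPolynomial ι k) (b j) * f j := fun j _ ↦ by
            rw [← mul_sub, hf']; ring
          rw [Finset.sum_congr rfl this, Finset.sum_sub_distrib, hsmul, hsum, sub_zero]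
    have hall (h : H) : h • F - F ∈ coinvariantIdeal k ι B := by
      have hh : h ∈ Subgroup.closure {h : H | IsReflection (k := k) (ι := ι) h} := hrefl ▸ trivial
      induction hh using Subgroup.closure_induction with
      | mem h hh => exact hr h hh
      | one => rw [one_smul, sub_self]; exact zero_mem _
      | mul g h _ _ hg hh =>
        have := add_mem (smul_mem_coinvariantIdeal (B := B) g hh) hg
        rwa [smul_sub, smul_smul, sub_add_sub_cancel] at this
      | inv g _ hg =>
        have := neg_mem (smul_mem_coinvariantIdeal (B := B) g⁻¹ hg)
        rwa [smul_sub, inv_smul_smul, neg_sub] at this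
    have hinv (f : MvPolynomial ι k) (h : H) : h • ∑ g : H, g • f = ∑ g : H, g • f := by
      rw [Finset.smul_sum]
      simp only [smul_smul]
      exact Equiv.sum_comp (Equiv.mulLeft h) (fun g ↦ g • f)
    have havg : ∑ h : H, h • F ∈ coinvariantIdeal k ι B := by
      have h1 : ∑ h : H, h • F = ∑ j ∈ s,
          C (coeff n (algebraMap B (MvPolynomial ι k) (b j))) * ∑ h : H, h • f j := by
        simp only [hsmulF, Finset.mul_sum]
        exact Finset.sum_comm
      -- The degree-`n` coefficient of the averaged relation: it lets the constant terms of the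
      -- traces be subtracted, leaving invariants without constant term.
      have h2 : ∑ j ∈ s, coeff n (algebraMap B (MvPolynomial ι k) (b j)) *
          coeff 0 (∑ h : H, h • f j) = 0 := by
        have h3 : ∑ j ∈ s, algebraMap B (MvPolynomial ι k) (b j) * ∑ h : H, h • f j = 0 := by
          simp only [Finset.mul_sum]
          rw [Finset.sum_comm]
          exact Finset.sum_eq_zero fun h _ ↦ hsmul h
        have h4 := congrArg (coeff n) h3
        rw [coeff_sum, coeff_zero] at h4
        rw [← h4]
        exact Finset.sum_congr rfl fun j hj ↦ (coeff_mul_of_order_le (hb j hj)).symm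
      have h5 : ∑ h : H, h • F = ∑ j ∈ s,
          C (coeff n (algebraMap B (MvPolynomial ι k) (b j))) *
            (∑ h : H, h • f j - C (coeff 0 (∑ h : H, h • f j))) := by
        simp only [mul_sub, Finset.sum_sub_distrib, ← C_mul, ← map_sum C]
        rw [h1, h2, map_zero, sub_zero]
      rw [h5]
      refine Ideal.sum_mem _ fun j _ ↦ Ideal.mul_mem_left _ _
        (mem_coinvariantIdeal_of_smul_eq (H := H) _ (fun h ↦ ?_) ?_)
      · rw [smul_sub, hinv, smul_C_eq]
      · rw [coeff_sub, coeff_zero_C, sub_self]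
    have hF' : C (Fintype.card H : k) * F = ∑ h : H, h • F - ∑ h : H, (h • F - F) := by
      rw [Finset.sum_sub_distrib, Finset.sum_const, Finset.card_univ, sub_sub_cancel, nsmul_eq_mul,
        map_natCast]
    have hmem : C (Fintype.card H : k) * F ∈ coinvariantIdeal k ι B := by
      rw [hF']
      exact sub_mem havg (Ideal.sum_mem _ fun h _ ↦ hall h)
    have := Ideal.mul_mem_left _ (C (Fintype.card H : k)⁻¹) hmem
    rwa [← mul_assoc, ← C_mul, inv_mul_cancel₀ hcard, C_1, one_mul] at this

include hlin in
-- Homogeneous components of invariants are invariant, so a degree-`n` component of the coinvariant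
-- ideal is a combination of positive-degree invariants times forms of degree below `n`: the step of
-- graded Nakayama.
theorem homogeneousComponent_mem_span {S : Submodule B (MvPolynomial ι k)} (n : ℕ)
    (hS : ∀ m < n, ∀ f : MvPolynomial ι k, f.IsHomogeneous m → f ∈ S)
    (x : MvPolynomial ι k) (hx : x ∈ coinvariantIdeal k ι B) : homogeneousComponent n x ∈ S := by
  rw [← one_mul x]
  generalize (1 : MvPolynomial ι k) = a
  induction hx using Submodule.span_induction generalizing a with
  | mem x hx =>
    obtain ⟨b, rfl, h0⟩ := hx
    rw [← sum_homogeneousComponent a, ← sum_homogeneousComponent (algebraMap B _ b),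
      Finset.sum_mul_sum, map_sum]
    refine sum_mem fun i _ ↦ ?_
    rw [map_sum]
    refine sum_mem fun j _ ↦ ?_
    rw [homogeneousComponent_of_mem (m := n) (((homogeneousComponent_isHomogeneous i a).mul
      (homogeneousComponent_isHomogeneous j (algebraMap B _ b))))]
    split_ifs with hn
    · by_cases hj : j = 0
      · rw [hj, homogeneousComponent_zero, h0, map_zero, mul_zero]
        exact zero_mem _
      · obtain ⟨c, hc⟩ := Algebra.IsInvariant.isInvariant (A := B) (G := H)
          (homogeneousComponent j (algebraMap B (MvPolynomial ι k) b)) fun h ↦ by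
            rw [← homogeneousComponent_smul hlin, smul_algebraMap]
        rw [← hc, mul_comm, ← Algebra.smul_def]
        exact S.smul_mem _ (hS i (by omega) _ (homogeneousComponent_isHomogeneous i a))
    · exact zero_mem _
  | zero => rw [mul_zero, map_zero]; exact zero_mem _
  | add x y _ _ hx hy => rw [mul_add, map_add]; exact add_mem (hx a) (hy a)
  | smul c x _ hx => rw [smul_eq_mul, ← mul_assoc]; exact hx _

include hlin in
/-- The Chevalley–Shephard–Todd theorem, in the form that the polynomial ring is free over the
invariants of a finite reflection group of order prime to the characteristic. -/
theorem free_of_isReflection [Fintype H]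
    (hinj : Function.Injective (algebraMap B (MvPolynomial ι k)))
    (hrefl : Subgroup.closure {h : H | IsReflection (k := k) (ι := ι) h} = ⊤)
    (hcard : (Fintype.card H : k) ≠ 0) : Module.Free B (MvPolynomial ι k) := by
  classical
  let J := (coinvariantIdeal k ι B).restrictScalars k
  -- Monomials forming a `k`-basis of the coinvariant algebra. They are homogeneous, as the
  -- induction on degree below requires.
  obtain ⟨κ, a, -, hspan, hind⟩ := exists_linearIndependent' k
    (fun m : ι →₀ ℕ ↦ J.mkQ (monomial m 1))
  let E : κ → MvPolynomial ι k := fun j ↦ monomial (a j) 1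
  have hli : LinearIndependent B E := by
    rw [linearIndependent_iff']
    intro s g hg
    by_contra! hne
    obtain ⟨j, hjs, hj⟩ := hne
    -- The least degree in which some coefficient of the relation is nonzero; Chevalley's lemma at
    -- that exponent gives a forbidden `k`-relation.
    have hex : ∃ d, ∃ j ∈ s, ∃ n : ι →₀ ℕ, n.degree = d ∧
        coeff n (algebraMap B (MvPolynomial ι k) (g j)) ≠ 0 := by
      have : algebraMap B (MvPolynomial ι k) (g j) ≠ 0 := by
        rwa [Ne, map_eq_zero_iff _ hinj]
      obtain ⟨n, hn⟩ := ne_zero_iff.mp this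
      exact ⟨_, j, hjs, n, rfl, hn⟩
    obtain ⟨j₀, hj₀, n, hn, hne⟩ := Nat.find_spec hex
    have hmem := sum_coeff_mul_mem_coinvariantIdeal hlin hrefl hcard s g n (fun i hi m hm ↦ by
      by_contra h0
      exact Nat.find_min hex (hn ▸ hm) ⟨i, hi, m, rfl, h0⟩)
      (s.sup (fun j ↦ (E j).totalDegree) + 1) E
      (fun i hi ↦ Or.inr (Nat.lt_succ_of_le (Finset.le_sup (f := fun j ↦ (E j).totalDegree) hi)))
      (by simpa only [Algebra.smul_def] using hg)
    have h0 := (Submodule.Quotient.mk_eq_zero J).mpr hmem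
    rw [← Submodule.mkQ_apply, map_sum] at h0
    simp only [← smul_eq_C_mul, map_smul] at h0
    exact hne (linearIndependent_iff'.mp hind s _ h0 j₀ hj₀)
  have hC (c : k) (S : Submodule B (MvPolynomial ι k)) {f} (hf : f ∈ S) : c • f ∈ S := by
    obtain ⟨b, hb⟩ := Algebra.IsInvariant.isInvariant (A := B) (G := H) (C c : MvPolynomial ι k)
      fun h ↦ smul_C_eq h c
    rw [smul_eq_C_mul, ← hb, ← Algebra.smul_def]
    exact S.smul_mem b hf
  have hhom (n : ℕ) : ∀ f : MvPolynomial ι k, f.IsHomogeneous n →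
      f ∈ Submodule.span B (Set.range E) := by
    induction n using Nat.strong_induction_on with
    | _ n ih =>
      intro f hf
      have hf1 : J.mkQ f ∈ Submodule.span k (Set.range (J.mkQ ∘ E)) := by
        change _ ∈ Submodule.span k (Set.range ((fun m : ι →₀ ℕ ↦ J.mkQ (monomial m 1)) ∘ a))
        rw [hspan, ← Function.comp_def, Set.range_comp, ← Submodule.map_span]
        refine Submodule.mem_map_of_mem ?_
        rw [← coe_basisMonomials, (basisMonomials ι k).span_eq]
        trivial
      obtain ⟨l, hl⟩ := Finsupp.mem_span_range_iff_exists_finsupp.mp hf1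
      have hJ : f - l.sum (fun j c ↦ c • E j) ∈ coinvariantIdeal k ι B := by
        refine (Submodule.Quotient.mk_eq_zero J).mp ?_
        rw [← Submodule.mkQ_apply, map_sub, ← hl, Finsupp.sum, Finsupp.sum, map_sum, sub_eq_zero]
        exact Finset.sum_congr rfl fun j _ ↦ (map_smul _ _ _).symm
      have h1 := homogeneousComponent_mem_span hlin n ih _ hJ
      rw [map_sub, homogeneousComponent_eq_self hf] at h1
      have h2 : homogeneousComponent n (l.sum fun j c ↦ c • E j) ∈
          Submodule.span B (Set.range E) := by
        rw [Finsupp.sum, map_sum]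
        refine sum_mem fun j _ ↦ ?_
        rw [map_smul]
        refine hC _ _ ?_
        rw [homogeneousComponent_of_mem (m := n) (n := (a j).degree)
          (isHomogeneous_monomial (1 : k) rfl)]
        split_ifs
        · exact Submodule.subset_span ⟨j, rfl⟩
        · exact zero_mem _
      simpa using add_mem h1 h2
  refine Module.Free.of_basis (Module.Basis.mk hli fun f _ ↦ ?_)
  rw [← sum_homogeneousComponent f]
  exact sum_mem fun n _ ↦ hhom n _ (homogeneousComponent_isHomogeneous n f)

end Chevalley

/-! ### A criterion for `End_R(B)` to be the skew group ring. -/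

section SkewBijective

variable {R B : Type w} {Γ : Type*} [CommRing R] [CommRing B] [IsDomain B] [Algebra R B] [Group Γ] [Fintype Γ]
  [MulSemiringAction Γ B] [SMulCommClass Γ R B]

omit [IsDomain B] [Fintype Γ] in
-- Expand `∏ (δ b_δ ⊗ 1 - 1 ⊗ b_δ)` in `B ⊗ B`, and multiply after applying `γ` to the second
-- factor. The result vanishes for `γ ∈ S`.
theorem exists_sum_mul_smul_eq_prod (b : Γ → B) (S : Finset Γ) :
    ∃ (J : Type) (_ : Fintype J) (x y : J → B), ∀ γ : Γ,
      ∑ j, x j * γ • y j = ∏ δ ∈ S, (δ • b δ - γ • b δ) := by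
  classical
  induction S using Finset.induction_on with
  | empty => exact ⟨Unit, inferInstance, fun _ ↦ 1, fun _ ↦ 1, fun γ ↦ by simp⟩
  | insert δ S hδ ih =>
    obtain ⟨J, _, x, y, h⟩ := ih
    refine ⟨J ⊕ J, inferInstance, Sum.elim (fun j ↦ (δ • b δ) * x j) (fun j ↦ - x j),
      Sum.elim y (fun j ↦ b δ * y j), fun γ ↦ ?_⟩
    rw [Finset.prod_insert hδ, Fintype.sum_sum_type, ← h]
    simp only [Sum.elim_inl, Sum.elim_inr, smul_mul']
    rw [sub_mul, Finset.mul_sum, Finset.mul_sum, ← Finset.sum_sub_distrib,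
      ← Finset.sum_add_distrib]
    exact Finset.sum_congr rfl fun j _ ↦ by ring

variable (R) in
omit [IsDomain B] [SMulCommClass Γ R B] in
-- The product `u` satisfies `u z = ∑ tr(y_j z) x_j`. Traces are scalars for `f`, so `f(u z)`
-- expands in the conjugates of `z`.
theorem exists_apply_mul_eq_sum [DecidableEq Γ] [Algebra.IsInvariant R B Γ] (f : Module.End R B)
    (b : Γ → B) : ∃ c : Γ → B, ∀ x,
      f ((∏ δ ∈ Finset.univ.erase 1, (δ • b δ - b δ)) * x) = ∑ γ, c γ * γ • x := by
  obtain ⟨J, _, x, y, h⟩ := exists_sum_mul_smul_eq_prod b (Finset.univ.erase 1)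
  have hinv (z : B) : ∃ a : R, algebraMap R B a = ∑ γ : Γ, γ • z :=
    Algebra.IsInvariant.isInvariant (G := Γ) _ fun g ↦ by
      rw [Finset.smul_sum]
      simp only [smul_smul]
      exact Equiv.sum_comp (Equiv.mulLeft g) (fun h ↦ h • z)
  choose t ht using hinv
  refine ⟨fun γ ↦ ∑ j, f (x j) * γ • y j, fun z ↦ ?_⟩
  have h1 : (∏ δ ∈ Finset.univ.erase 1, (δ • b δ - b δ)) * z = ∑ j, t (y j * z) • x j := by
    simp only [Algebra.smul_def, ht, Finset.sum_mul, smul_mul']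
    rw [Finset.sum_comm, Finset.sum_eq_single 1]
    · have := h 1
      simp only [one_smul] at this ⊢
      rw [← this, Finset.sum_mul]
      exact Finset.sum_congr rfl fun j _ ↦ by ring
    · intro γ _ hγ
      have : ∑ j, x j * γ • y j = 0 := by
        rw [h γ]
        exact Finset.prod_eq_zero (Finset.mem_erase.mpr ⟨hγ, Finset.mem_univ _⟩) (sub_self _)
      rw [← zero_mul (γ • z), ← this, Finset.sum_mul]
      exact Finset.sum_congr rfl fun j _ ↦ by ring
    · simp
  rw [h1, map_sum]
  simp only [map_smul]
  simp only [Algebra.smul_def, ht, Finset.sum_mul, smul_mul']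
  rw [Finset.sum_comm]
  exact Finset.sum_congr rfl fun γ _ ↦ Finset.sum_congr rfl fun j _ ↦ by ring

omit [SMulCommClass Γ R B] in
-- Dedekind's independence of characters.
theorem eq_zero_of_sum_mul_smul_eq_zero [FaithfulSMul Γ B] (c : Γ → B)
    (h : ∀ x, ∑ γ, c γ * γ • x = 0) : c = 0 := by
  have hinj : Function.Injective fun γ : Γ ↦ (MulDistribMulAction.toMonoidHom B γ : B →* B) :=
    fun γ δ h ↦ FaithfulSMul.eq_of_smul_eq_smul fun x ↦ DFunLike.congr_fun h x
  have := (linearIndependent_monoidHom B B).comp _ hinj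
  rw [Fintype.linearIndependent_iff] at this
  funext γ
  refine this c (funext fun x ↦ ?_) γ
  simpa using h x

/-- A criterion for the skew group ring of `Γ` over `B` to be the endomorphism ring of `B`. -/
theorem bijective_skewMap [DecidableEq Γ] [Algebra.IsInvariant R B Γ] [FaithfulSMul Γ B]
    (hdvd : ∀ a c : B, a ≠ 0 →
      (∀ b : Γ → B, a ∣ c * ∏ δ ∈ Finset.univ.erase 1, (δ • b δ - b δ)) → a ∣ c) :
    Function.Bijective (skewMap (MulSemiringAction.toAlgAut Γ R B)) := by
  have hsk (c : Γ → B) (x : B) :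
      skewMap (MulSemiringAction.toAlgAut Γ R B) c x = ∑ γ, c γ * γ • x := skewMap_apply _ _ _
  constructor
  · rw [injective_iff_map_eq_zero]
    intro c hc
    exact eq_zero_of_sum_mul_smul_eq_zero c fun x ↦ by rw [← hsk, hc, LinearMap.zero_apply]
  · intro f
    have hb (γ : Γ) : ∃ b : B, γ ≠ 1 → γ • b - b ≠ 0 := by
      by_contra! h
      refine (h 0).1 (FaithfulSMul.eq_of_smul_eq_smul (α := B) fun x ↦ ?_)
      rw [one_smul]
      exact sub_eq_zero.mp (h x).2
    choose b₀ hb₀ using hb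
    set u₀ : B := ∏ δ ∈ Finset.univ.erase 1, (δ • b₀ δ - b₀ δ) with hu₀
    have hu₀0 : u₀ ≠ 0 := Finset.prod_ne_zero_iff.mpr fun δ hδ ↦ hb₀ δ (Finset.ne_of_mem_erase hδ)
    obtain ⟨c₀, hc₀⟩ := exists_apply_mul_eq_sum R f b₀
    -- Formally `f` has coefficients `c₀ γ / γ(u₀)`. Comparing with the expansion for another
    -- product `u` gives `c₀ γ · γ(u) = c γ · γ(u₀)`, and the divisibility hypothesis clears the
    -- denominator.
    have hd (γ : Γ) : ∃ d : B, c₀ γ = d * γ • u₀ := by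
      obtain ⟨d, hd⟩ : u₀ ∣ γ⁻¹ • c₀ γ := by
        refine hdvd _ _ hu₀0 fun b ↦ ?_
        obtain ⟨c, hc⟩ := exists_apply_mul_eq_sum R f b
        set u : B := ∏ δ ∈ Finset.univ.erase 1, (δ • b δ - b δ) with hu
        have h1 : (fun γ ↦ c₀ γ * γ • u - c γ * γ • u₀) = 0 := by
          refine eq_zero_of_sum_mul_smul_eq_zero _ fun x ↦ ?_
          have h2 := hc₀ (u * x)
          have h3 := hc (u₀ * x)
          rw [mul_left_comm, h3] at h2
          simp only [sub_mul, Finset.sum_sub_distrib, mul_assoc, ← smul_mul']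
          rw [h2, sub_self]
        have h2 := congrArg (γ⁻¹ • ·) (sub_eq_zero.mp (congrFun h1 γ))
        simp only [smul_mul', inv_smul_smul] at h2
        rw [h2]
        exact dvd_mul_left _ _
      refine ⟨γ • d, ?_⟩
      rw [← smul_mul', mul_comm d, ← hd, smul_inv_smul]
    choose d hd using hd
    refine ⟨d, LinearMap.ext fun x ↦ ?_⟩
    have hker (x : B) : f (u₀ * x) = ∑ γ, d γ * γ • (u₀ * x) := by
      rw [hc₀]
      exact Finset.sum_congr rfl fun γ _ ↦ by rw [hd, smul_mul', mul_assoc]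
    -- The norm of `u₀` is a nonzero scalar divisible by `u₀`, so the formula on multiples of `u₀`
    -- extends to all of `B`.
    obtain ⟨N, hN⟩ : ∃ N : R, algebraMap R B N = ∏ γ : Γ, γ • u₀ :=
      Algebra.IsInvariant.isInvariant (G := Γ) _ fun g ↦ by
        rw [Finset.smul_prod']
        simp only [smul_smul]
        exact Equiv.prod_comp (Equiv.mulLeft g) (fun h ↦ h • u₀)
    have hN0 : algebraMap R B N ≠ 0 := by
      rw [hN]
      refine Finset.prod_ne_zero_iff.mpr fun γ _ ↦ ?_
      rwa [Ne, smul_eq_zero_iff_eq]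
    obtain ⟨y, hy⟩ : u₀ ∣ algebraMap R B N := by
      rw [hN]
      conv_lhs => rw [← one_smul Γ u₀]
      exact Finset.dvd_prod_of_mem (fun γ : Γ ↦ γ • u₀) (Finset.mem_univ 1)
    refine mul_left_cancel₀ hN0 ?_
    have h3 : algebraMap R B N * f x = f (u₀ * (y * x)) := by
      rw [← Algebra.smul_def, ← map_smul, Algebra.smul_def, hy, mul_assoc]
    rw [hsk, h3, hker, ← mul_assoc, ← hy, Finset.mul_sum]
    refine Finset.sum_congr rfl fun γ _ ↦ ?_
    rw [smul_mul', smul_algebraMap, mul_left_comm]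

end SkewBijective

/-! ### Divisibility tested against elements without a common prime factor. -/

section UFD

theorem dvd_of_forall_dvd_mul {P : Type*} [CommRing P] [IsDomain P] [UniqueFactorizationMonoid P]
    (U : Set P) (hU : ∀ π : P, Prime π → ∃ u ∈ U, ¬ π ∣ u) (a c : P) (ha : a ≠ 0)
    (h : ∀ u ∈ U, a ∣ c * u) : a ∣ c := by
  induction a using UniqueFactorizationMonoid.induction_on_prime generalizing c with
  | h₁ => exact absurd rfl ha
  | h₂ x hx => exact hx.dvd
  | h₃ a π ha0 hπ ih =>
    obtain ⟨u, hu, hπu⟩ := hU π hπ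
    obtain ⟨c, rfl⟩ := (hπ.dvd_or_dvd ((dvd_mul_right π a).trans (h u hu))).resolve_right hπu
    refine mul_dvd_mul_left π (ih c ha0 fun u hu ↦ ?_)
    have := h u hu
    rw [mul_assoc] at this
    exact (mul_dvd_mul_iff_left hπ.ne_zero).mp this

end UFD

/-! ### Inertia at primes of height one is generated by reflections. -/

section Inertia

open MvPolynomial

variable {k : Type u} [Field k] {ι : Type v}

/-- If `π` divides a nonzero linear form, the cofactor is a constant by degree, so all such forms
are proportional to `π`. -/
theorem exists_linear_of_prime (π : MvPolynomial ι k) (hπ : Prime π) :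
    ∃ l : MvPolynomial ι k, l.IsHomogeneous 1 ∧ ∀ f : MvPolynomial ι k, f.IsHomogeneous 1 → π ∣ f →
      ∃ c : k, f = c • l := by
  by_cases h : ∃ f : MvPolynomial ι k, f.IsHomogeneous 1 ∧ π ∣ f ∧ f ≠ 0
  · have hconst (f : MvPolynomial ι k) (hf : f.IsHomogeneous 1) (hπf : π ∣ f) :
        ∃ c : k, f = C c * π := by
      obtain ⟨a, rfl⟩ := hπf
      by_cases ha : a = 0
      · exact ⟨0, by rw [ha, mul_zero, map_zero, zero_mul]⟩
      have h1 := totalDegree_mul_of_isDomain hπ.ne_zero ha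
      rw [hf.totalDegree (mul_ne_zero hπ.ne_zero ha)] at h1
      have h2 : π.totalDegree ≠ 0 := by
        intro h0
        rw [totalDegree_eq_zero_iff_eq_C] at h0
        refine hπ.not_isUnit ?_
        rw [h0]
        refine IsUnit.map C (IsUnit.mk0 _ fun h00 ↦ hπ.ne_zero ?_)
        rw [h0, h00, C_0]
      have h3 : a.totalDegree = 0 := by omega
      rw [totalDegree_eq_zero_iff_eq_C] at h3
      exact ⟨_, by rw [mul_comm, ← h3]⟩
    obtain ⟨l, hl, hπl, hl0⟩ := h
    obtain ⟨c₀, hc₀⟩ := hconst l hl hπl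
    have hc₀0 : c₀ ≠ 0 := by
      rintro rfl
      exact hl0 (by rw [hc₀, C_0, zero_mul])
    refine ⟨l, hl, fun f hf hπf ↦ ?_⟩
    obtain ⟨c, hc⟩ := hconst f hf hπf
    refine ⟨c * c₀⁻¹, ?_⟩
    rw [hc, hc₀, smul_eq_C_mul, ← mul_assoc, ← C_mul, inv_mul_cancel_right₀ hc₀0]
  · push Not at h
    exact ⟨0, isHomogeneous_zero _ _ _, fun f hf hπf ↦ ⟨0, by rw [h f hf hπf, smul_zero]⟩⟩

variable {G : Type*} [Group G] [MulSemiringAction G (MvPolynomial ι k)]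

/-- The polynomial `∏ (Y - h • s)` has `H`-invariant coefficients, which `g` fixes modulo `π`. Since
`g • s` is a root of its `g`-conjugate, it is a root of the polynomial itself modulo `π`. -/
theorem dvd_prod_smul_sub_smul (H : Subgroup G) [Fintype H] (g : G) (π : MvPolynomial ι k)
    (hg : ∀ b : MvPolynomial ι k, (∀ h : H, h • b = b) → π ∣ g • b - b) (s : MvPolynomial ι k) :
    π ∣ ∏ h : H, (g • s - h • s) := by
  let q := MulSemiringAction.charpoly H s
  let φ : MvPolynomial ι k →+* MvPolynomial ι k := MulSemiringAction.toRingHom G _ g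
  have h1 : (q.map φ).eval (g • s) = 0 := by
    have h2 : φ (q.eval s) = (q.map φ).eval (φ s) := (Polynomial.eval_map_apply φ s).symm
    rw [MulSemiringAction.eval_charpoly, map_zero] at h2
    exact h2.symm
  obtain ⟨r, hr⟩ : Polynomial.C π ∣ q.map φ - q := by
    rw [Polynomial.C_dvd_iff_dvd_coeff]
    intro n
    rw [Polynomial.coeff_sub, Polynomial.coeff_map]
    exact hg _ fun h ↦ MulSemiringAction.smul_coeff_charpoly s n h
  have h3 := congrArg (Polynomial.eval (g • s)) hr
  rw [Polynomial.eval_sub, h1, Polynomial.eval_mul, Polynomial.eval_C, zero_sub,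
    show q = _ from MulSemiringAction.charpoly_eq H s, Polynomial.eval_prod] at h3
  simp only [Polynomial.eval_sub, Polynomial.eval_X, Polynomial.eval_C] at h3
  exact dvd_neg.mp ⟨_, h3⟩

variable [SMulCommClass G k (MvPolynomial ι k)]
  (hlin : ∀ (g : G) (i : ι), (g • (X i : MvPolynomial ι k)).IsHomogeneous 1)

include hlin

/-- For each linear form `s`, `g • s ≡ h • s` modulo `π` for some `h ∈ H`. A vector space over an
infinite field is not a finite union of proper subspaces, so one `h` serves all `s`, and `h⁻¹ g`
moves linear forms only along a line. -/
theorem exists_isReflection_of_forall_dvd [Fintype ι] [Infinite k] (H : Subgroup G) [Fintype H]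
    (g : G) (π : MvPolynomial ι k) (hπ : Prime π)
    (hg : ∀ b : MvPolynomial ι k, (∀ h : H, h • b = b) → π ∣ g • b - b) :
    ∃ h ∈ H, IsReflection (k := k) (ι := ι) (h⁻¹ * g) := by
  classical
  let s : (ι → k) →ₗ[k] MvPolynomial ι k := ∑ i, (LinearMap.proj i).smulRight (X i)
  let act (g : G) : MvPolynomial ι k →ₗ[k] MvPolynomial ι k :=
    (MulSemiringAction.toAlgHom k (MvPolynomial ι k) g).toLinearMap
  let W (h : H) : Submodule k (ι → k) :=
    ((Ideal.span {π}).restrictScalars k).comap ((act g - act h) ∘ₗ s)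
  have hW (h : H) (a : ι → k) : a ∈ W h ↔ π ∣ g • s a - h • s a := Ideal.mem_span_singleton
  obtain ⟨h, hh⟩ : ∃ h, W h = ⊤ := by
    by_contra! hne
    refine Subspace.biUnion_ne_univ_of_top_notMem (s := Finset.univ.image W) (by simpa using hne)
      (Set.eq_univ_of_forall fun a ↦ ?_)
    obtain ⟨h, -, hh⟩ := hπ.exists_mem_finset_dvd (dvd_prod_smul_sub_smul H g π hg (s a))
    exact Set.mem_biUnion (x := W h) (by simp) ((hW h a).mpr hh)
  have hX (i : ι) : π ∣ g • (X i : MvPolynomial ι k) - h • (X i : MvPolynomial ι k) := by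
    have h1 : (Pi.single i 1 : ι → k) ∈ W h := hh ▸ trivial
    rw [hW] at h1
    have : s (Pi.single i 1) = X i := by
      simp [s, Pi.single_apply]
    rwa [this] at h1
  obtain ⟨l, hl, hπl⟩ := exists_linear_of_prime π hπ
  refine ⟨h, h.2, (h : G)⁻¹ • l, IsHomogeneous.smul hlin _ hl, fun i ↦ ?_⟩
  obtain ⟨c, hc⟩ := hπl _ ((hlin g i).sub (hlin h i)) (hX i)
  refine ⟨c, ?_⟩
  rw [← smul_comm, ← hc, smul_sub, mul_smul]
  congr 1
  exact (inv_smul_smul (h : G) _).symm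

omit hlin in
theorem exists_smul_sub_eq_smul_of_isHomogeneous (g : G) (l : MvPolynomial ι k)
    (hl : ∀ i, ∃ c : k, g • (X i : MvPolynomial ι k) - X i = c • l) (f : MvPolynomial ι k)
    (hf : f.IsHomogeneous 1) : ∃ c : k, g • f - f = c • l := by
  have : f ∈ homogeneousSubmodule ι k 1 := hf
  rw [homogeneousSubmodule_one_eq_span_X] at this
  clear hf
  induction this using Submodule.span_induction with
  | mem x hx =>
    obtain ⟨i, rfl⟩ := hx
    exact hl i
  | zero => exact ⟨0, by simp⟩
  | add x y _ _ hx hy =>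
    obtain ⟨c, hc⟩ := hx
    obtain ⟨d, hd⟩ := hy
    exact ⟨c + d, by rw [smul_add, add_smul, ← hc, ← hd]; ring⟩
  | smul a x _ hx =>
    obtain ⟨c, hc⟩ := hx
    exact ⟨a * c, by rw [mul_smul, ← hc, smul_comm, smul_sub]⟩

theorem normal_closure_isReflection :
    (Subgroup.closure {g : G | IsReflection (k := k) (ι := ι) g}).Normal := by
  refine ⟨fun x hx g ↦ ?_⟩
  induction hx using Subgroup.closure_induction with
  | mem x hx =>
    obtain ⟨l, hl, hx⟩ := hx
    refine Subgroup.subset_closure ⟨g • l, IsHomogeneous.smul hlin g hl, fun i ↦ ?_⟩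
    obtain ⟨c, hc⟩ := exists_smul_sub_eq_smul_of_isHomogeneous x l hx _ (hlin g⁻¹ i)
    exact ⟨c, by rw [← smul_comm g c l, ← hc, smul_sub, smul_inv_smul, mul_smul, mul_smul]⟩
  | one => simp
  | mul x y _ _ hx hy =>
    have := mul_mem hx hy
    rwa [conj_mul] at this
  | inv x _ hx =>
    have := inv_mem hx
    rwa [conj_inv] at this

end Inertia

/-! ### Auslander's theorem for the quotient by the reflection subgroup. -/

section Auslander

open MvPolynomial

variable {k : Type u} [Field k] {ι : Type v} [Fintype ι]
  {R : Type (max u v)} [CommRing R] [Algebra R (MvPolynomial ι k)]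
  {G : Type*} [Group G] [Finite G] [MulSemiringAction G (MvPolynomial ι k)]
  [SMulCommClass G k (MvPolynomial ι k)] [SMulCommClass G R (MvPolynomial ι k)]
  [FaithfulSMul G (MvPolynomial ι k)]
  (hlin : ∀ (g : G) (i : ι), (g • (X i : MvPolynomial ι k)).IsHomogeneous 1)
  (H : Subgroup G) [H.Normal] (hH : ∀ g : G, IsReflection (k := k) (ι := ι) g → g ∈ H)

include hlin hH

omit [FaithfulSMul G (MvPolynomial ι k)] in
theorem exists_not_dvd_smul_sub [Infinite k] {γ : G ⧸ H} (hγ : γ ≠ 1) (π : MvPolynomial ι k)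
    (hπ : Prime π) : ∃ b : FixedPoints.subalgebra R (MvPolynomial ι k) H,
      ¬ π ∣ ((γ • b - b : FixedPoints.subalgebra R (MvPolynomial ι k) H) : MvPolynomial ι k) := by
  have := Fintype.ofFinite H
  obtain ⟨g, rfl⟩ := QuotientGroup.mk_surjective γ
  by_contra! h
  obtain ⟨x, hx, hr⟩ := exists_isReflection_of_forall_dvd hlin H g π hπ fun b hb ↦ h ⟨b, hb⟩
  refine hγ ((QuotientGroup.eq_one_iff g).mpr ?_)
  have := H.mul_mem hx (hH _ hr)
  rwa [mul_inv_cancel_left] at this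

theorem faithfulSMul_fixedPoints [Infinite k] :
    FaithfulSMul (G ⧸ H) (FixedPoints.subalgebra R (MvPolynomial ι k) H) := by
  refine ⟨fun {γ δ} h ↦ ?_⟩
  by_contra hne
  have h1 : δ⁻¹ * γ ≠ 1 := fun h1 ↦ hne (inv_mul_eq_one.mp h1).symm
  rcases isEmpty_or_nonempty ι with hι | ⟨⟨i⟩⟩
  · have : Subsingleton G := ⟨fun g g' ↦ FaithfulSMul.eq_of_smul_eq_smul (α := MvPolynomial ι k)
      fun x ↦ by
        obtain ⟨c, rfl⟩ := C_surjective (σ := ι) (R := k) x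
        rw [smul_C_eq, smul_C_eq]⟩
    exact h1 (Subsingleton.elim _ _)
  · obtain ⟨b, hb⟩ := exists_not_dvd_smul_sub (R := R) hlin H hH h1 _ (X_prime (i := i))
    refine hb ?_
    rw [mul_smul, h, inv_smul_smul, sub_self]
    exact dvd_zero _

/-- The divisibility criterion is checked in the factorial ring `S`: no prime of `S` divides all `γ
b - b` for a given `γ ≠ 1`. The quotient obtained in `S` is again `H`-invariant, so divisibility
descends to `B`. -/
theorem bijective_skewMap_fixedPoints [Infinite k] [Fintype (G ⧸ H)]
    [Algebra.IsInvariant R (MvPolynomial ι k) G] :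
    Function.Bijective (skewMap (MulSemiringAction.toAlgAut (G ⧸ H) R
      (FixedPoints.subalgebra R (MvPolynomial ι k) H))) := by
  classical
  have := faithfulSMul_fixedPoints (R := R) hlin H hH
  refine bijective_skewMap fun a c ha h ↦ ?_
  have h0 : (a : MvPolynomial ι k) ≠ 0 := by simpa using ha
  obtain ⟨d, hd⟩ : (a : MvPolynomial ι k) ∣ c := by
    refine dvd_of_forall_dvd_mul (Set.range fun b : G ⧸ H → FixedPoints.subalgebra R
      (MvPolynomial ι k) H ↦ ((∏ δ ∈ Finset.univ.erase 1, (δ • b δ - b δ) :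
        FixedPoints.subalgebra R (MvPolynomial ι k) H) : MvPolynomial ι k)) (fun π hπ ↦ ?_) _ _ h0 ?_
    · have h1 (γ : G ⧸ H) : ∃ b : FixedPoints.subalgebra R (MvPolynomial ι k) H, γ ≠ 1 →
          ¬ π ∣ ((γ • b - b : FixedPoints.subalgebra R (MvPolynomial ι k) H) :
            MvPolynomial ι k) := by
        by_cases hγ : γ = 1
        · exact ⟨0, fun h ↦ (h hγ).elim⟩
        · obtain ⟨b, hb⟩ := exists_not_dvd_smul_sub (R := R) hlin H hH hγ π hπ
          exact ⟨b, fun _ ↦ hb⟩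
      choose b hb using h1
      refine ⟨_, ⟨b, rfl⟩, fun hdvd ↦ ?_⟩
      simp only [SubmonoidClass.coe_finsetProd] at hdvd
      obtain ⟨γ, hγ, h2⟩ := hπ.exists_mem_finset_dvd hdvd
      exact hb γ (Finset.ne_of_mem_erase hγ) h2
    · rintro _ ⟨b, rfl⟩
      obtain ⟨d, hd⟩ := h b
      exact ⟨d, congrArg Subtype.val hd⟩
  refine ⟨⟨d, fun x ↦ mul_left_cancel₀ h0 ?_⟩, Subtype.ext hd⟩
  rw [← hd, ← c.2 x, hd, smul_mul', a.2 x]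

end Auslander

/-! ### Flat base change of the whole configuration. -/

section BaseChange

variable {R B X T : Type w} [CommRing R] [CommRing B] [Algebra R B] [AddCommGroup X] [Module R X]
  [CommRing T] [Algebra R T] (R' : Type w) [CommRing R'] [Algebra R R']
  {Γ : Type*} [Group Γ] (ρ : Γ →* (B ≃ₐ[R] B))

/-- The base change of a group action by algebra automorphisms. -/
noncomputable def autBaseChange : Γ →* (R' ⊗[R] B ≃ₐ[R'] R' ⊗[R] B) where
  toFun γ := Algebra.TensorProduct.congr AlgEquiv.refl (ρ γ)
  map_one' := by
    ext x
    induction x with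
    | zero => simp
    | add x y hx hy => rw [map_add, map_add, hx, hy]
    | tmul a b => simp
  map_mul' γ δ := by
    ext x
    induction x with
    | zero => simp
    | add x y hx hy => rw [map_add, map_add, hx, hy]
    | tmul a b => simp

@[simp]
theorem autBaseChange_tmul (γ : Γ) (a : R') (b : B) :
    autBaseChange R' ρ γ (a ⊗ₜ b) = a ⊗ₜ ρ γ b := rfl

/-- Formation of `End_R(B)` commutes with flat base change when `B` is finitely presented. -/
theorem bijective_skewMap_baseChange [Fintype Γ] [Module.Flat R R'] [Module.FinitePresentation R B]
    (h : Function.Bijective (skewMap ρ)) :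
    Function.Bijective (skewMap (autBaseChange R' ρ)) := by
  classical
  let s : (Γ → B) ≃ₗ[R] Module.End R B := LinearEquiv.ofBijective
    { skewMap ρ with
      map_smul' r c := by
        ext b
        change skewMap ρ (r • c) b = r • skewMap ρ c b
        simp only [skewMap_apply, Pi.smul_apply, smul_mul_assoc, Finset.smul_sum] } h
  let e := (TensorProduct.piRight R R' R' (fun _ : Γ ↦ B)).symm ≪≫ₗ s.baseChange R R' _ _ ≪≫ₗ
    (Module.FinitePresentation.isBaseChange_map (R := R) B B R').equiv
  have he : ⇑(skewMap (autBaseChange R' ρ)) = e := by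
    funext c
    induction c using Pi.single_induction with
    | zero => simp
    | add x y hx hy => rw [map_add, map_add, hx, hy]
    | single γ x =>
      induction x with
      | zero => simp
      | add x y hx hy => rw [Pi.single_add, map_add, map_add, hx, hy]
      | tmul a b =>
        refine TensorProduct.AlgebraTensorModule.curry_injective (LinearMap.ext fun a' ↦
          LinearMap.ext fun b' ↦ ?_)
        have h1 : (TensorProduct.piRight R R' R' fun _ : Γ ↦ B).symm (Pi.single γ (a ⊗ₜ[R] b)) =
            a ⊗ₜ[R] Pi.single γ b := by
          rw [LinearEquiv.symm_apply_eq]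
          ext j
          rcases eq_or_ne j γ with rfl | hj
          · simp
          · simp [hj]
        have h2 : s (Pi.single γ b) b' = b * ρ γ b' := by
          change skewMap ρ _ b' = _
          rw [skewMap_apply, Finset.sum_eq_single γ (fun δ _ hδ ↦ by simp [hδ]) (by simp)]
          simp
        change skewMap (autBaseChange R' ρ) (Pi.single γ (a ⊗ₜ b)) (a' ⊗ₜ b') = e _ _
        rw [skewMap_apply, Finset.sum_eq_single γ (fun δ _ hδ ↦ by simp [hδ]) (by simp)]
        simp only [e, LinearEquiv.trans_apply, h1, LinearEquiv.baseChange_tmul,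
          IsBaseChange.equiv_tmul, LinearMap.smul_apply, LinearMap.baseChangeHom_apply]
        simp [h2, TensorProduct.smul_tmul']
  rw [he]
  exact e.bijective

variable [Algebra B T] [IsScalarTower R B T]

/-- The `R' ⊗[R] B`-algebra structure of `R' ⊗[R] T`. -/
noncomputable abbrev algebraBaseChange : Algebra (R' ⊗[R] B) (R' ⊗[R] T) :=
  (Algebra.TensorProduct.map (AlgHom.id R' R') (IsScalarTower.toAlgHom R B T)).toAlgebra

attribute [local instance] algebraBaseChange

theorem algebraBaseChange_smul (a a' : R') (b : B) (t : T) :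
    (a ⊗ₜ[R] b) • (a' ⊗ₜ[R] t) = (a * a') ⊗ₜ[R] (b • t) := by
  rw [Algebra.smul_def, Algebra.smul_def]
  exact Algebra.TensorProduct.tmul_mul_tmul _ _ _ _

theorem isScalarTower_algebraBaseChange : IsScalarTower R' (R' ⊗[R] B) (R' ⊗[R] T) :=
  .of_algebraMap_eq' ((Algebra.TensorProduct.map (AlgHom.id R' R')
    (IsScalarTower.toAlgHom R B T)).comp_algebraMap).symm

theorem exists_linearMap_baseChange (f : T →ₗ[B] B) :
    ∃ f' : R' ⊗[R] T →ₗ[R' ⊗[R] B] R' ⊗[R] B, ∀ a t, f' (a ⊗ₜ t) = a ⊗ₜ f t := by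
  let f₀ := (f.restrictScalars R).baseChange R'
  refine ⟨{ f₀ with map_smul' := fun x y ↦ ?_ }, fun a t ↦ rfl⟩
  change f₀ (x • y) = x • f₀ y
  induction x with
  | zero => simp
  | add x x' hx hx' => rw [add_smul, add_smul, map_add, hx, hx']
  | tmul a b =>
    induction y with
    | zero => simp
    | add y y' hy hy' => rw [smul_add, map_add, map_add, smul_add, hy, hy']
    | tmul a' t =>
      rw [algebraBaseChange_smul]
      simp [f₀]

theorem projective_baseChange [Module.Finite B T] [Module.Projective B T] :
    Module.Projective (R' ⊗[R] B) (R' ⊗[R] T) := by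
  obtain ⟨n, p, hp⟩ := Module.Finite.exists_fin' B T
  obtain ⟨s, hs⟩ := Module.projective_lifting_property p LinearMap.id hp
  choose f hf using fun i : Fin n ↦
    exists_linearMap_baseChange (R := R) R' (LinearMap.proj i ∘ₗ s)
  let s' : R' ⊗[R] T →ₗ[R' ⊗[R] B] (Fin n → R' ⊗[R] B) := LinearMap.pi f
  let p' : (Fin n → R' ⊗[R] B) →ₗ[R' ⊗[R] B] R' ⊗[R] T :=
    Fintype.linearCombination _ fun i ↦ 1 ⊗ₜ p (Pi.single i 1)
  refine Module.Projective.of_split s' p' (LinearMap.ext fun x ↦ ?_)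
  induction x with
  | zero => simp
  | add x y hx hy => rw [map_add, map_add, hx, hy]
  | tmul a t =>
    have h1 : ∑ i, s t i • p (Pi.single i 1) = t := by
      conv_rhs => rw [← LinearMap.id_apply (R := B) t, ← hs, LinearMap.comp_apply,
        LinearMap.pi_apply_eq_sum_univ p]
      refine Finset.sum_congr rfl fun i _ ↦ ?_
      congr 2
      ext j
      simp [Pi.single_apply, eq_comm]
    simp only [LinearMap.comp_apply, p', s', Fintype.linearCombination_apply, LinearMap.pi_apply,
      hf, algebraBaseChange_smul, mul_one, LinearMap.proj_apply, ← TensorProduct.tmul_sum, h1,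
      LinearMap.id_apply]

/-- The main structural result after a flat base change. -/
theorem globalDimension_end_baseChange [IsNoetherianRing R] [IsNoetherianRing R'] [Nontrivial R']
    [Module.Flat R R'] [Module.Finite R T] [Module.Projective B T] [Fintype Γ]
    (hΓ : Function.Bijective (skewMap ρ)) (h : InAdd R X B) (h' : InAdd R B X)
    (hu : IsUnit (Fintype.card Γ : R)) (r : T →ₗ[B] B) (hr : r 1 = 1)
    (hinj : Function.Injective (algebraMap R T)) {d : ℕ}
    (hT : MaxIdealsRegular (R' ⊗[R] T) d) {X' : Type w} [AddCommGroup X'] [Module R' X']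
    (eX : X' ≃ₗ[R'] R' ⊗[R] X) :
    globalDimension (Module.End R' X') = ((d : ℕ∞) : WithBot ℕ∞) ∧
      IsCohenMacaulayModule R' (Module.End R' X') := by
  have : Module.Finite B T := .of_restrictScalars_finite R B T
  have : Module.Finite R B := .of_surjective (r.restrictScalars R) fun b ↦ ⟨algebraMap B T b, by
    rw [LinearMap.restrictScalars_apply, Algebra.algebraMap_eq_smul_one, map_smul, hr, smul_eq_mul,
      mul_one]⟩
  have : Module.FinitePresentation R B := Module.finitePresentation_of_finite R B
  have := isScalarTower_algebraBaseChange (R := R) (B := B) (T := T) R'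
  have := projective_baseChange (R := R) (B := B) (T := T) R'
  obtain ⟨r', hr'⟩ := exists_linearMap_baseChange (R := R) R' r
  refine globalDimension_end_eq_and_isCohenMacaulayModule (T := R' ⊗[R] T) (autBaseChange R' ρ)
    (bijective_skewMap_baseChange R' ρ hΓ) ((InAdd.of_equiv eX).trans (h.baseChange R'))
    ((h'.baseChange R').trans (InAdd.of_equiv eX.symm)) ?_ r' ?_ ?_ hT
  · simpa using hu.map (algebraMap R R')
  · rw [Algebra.TensorProduct.one_def, hr', hr, Algebra.TensorProduct.one_def]
  · exact Algebra.TensorProduct.includeLeft_injective (S := R') hinj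

end BaseChange

/-! ### Noetherianity of adic completions. -/

section Completion

variable {R : Type*} [CommRing R] (I : Ideal R)

/-- Generators of `I` present the completion as a quotient of a power series ring over `R`;
surjectivity is checked modulo the ideal of the variables. -/
theorem isNoetherianRing_adicCompletion [IsNoetherianRing R] :
    IsNoetherianRing (AdicCompletion I R) := by
  obtain ⟨n, f, hf⟩ := Submodule.fg_iff_exists_fin_generating_family.mp (IsNoetherian.noetherian I)
  let A := MvPolynomial (Fin n) R
  let J : Ideal A := MvPolynomial.idealOfVars (Fin n) R
  let φ : A →+* R := (MvPolynomial.aeval f : A →ₐ[R] R)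
  have hφJ : J.map φ = I := by
    simp only [J, Ideal.map_span, ← Set.range_comp]
    rw [← hf]
    congr 2
    ext i
    exact MvPolynomial.aeval_X f i
  have hJ (n : ℕ) : J ^ n ≤ (I ^ n).comap φ := by
    rw [← Ideal.map_le_iff_le_comap, Ideal.map_pow, hφJ]
  let Φ : AdicCompletion J A →+* AdicCompletion I R := AdicCompletion.liftRingHom I
    (fun n ↦ (Ideal.quotientMap (I ^ n) φ (hJ n)).comp (AdicCompletion.evalₐ J n : _ →+* _)) <| by
      intro m n hmn
      ext x
      obtain ⟨x, rfl⟩ := AdicCompletion.mk_surjective J A x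
      simp only [RingHom.comp_apply, RingHom.coe_coe, AdicCompletion.evalₐ_mk,
        Ideal.quotientMap_mk]
      change Ideal.Quotient.mk (I ^ m) _ = _
      rw [Ideal.Quotient.eq, ← map_sub]
      refine hJ m ?_
      rw [← Ideal.Quotient.eq]
      exact AdicCompletion.Ideal.mk_eq_mk J hmn x
  have hΦ (a : A) : Φ (algebraMap A _ a) = algebraMap R _ (φ a) := by
    apply AdicCompletion.ext_evalₐ
    intro n
    simp only [Φ, AdicCompletion.evalₐ_liftRingHom]
    change Ideal.quotientMap _ _ (hJ n) (AdicCompletion.evalₐ J n (AdicCompletion.of J A a)) =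
      AdicCompletion.evalₐ I n (AdicCompletion.of I R _)
    rw [AdicCompletion.evalₐ_of, AdicCompletion.evalₐ_of]
    exact Ideal.quotientMap_mk (H := hJ n)
  have : IsNoetherianRing (AdicCompletion J A) :=
    isNoetherianRing_of_ringEquiv (MvPowerSeries (Fin n) R)
      (MvPowerSeries.toAdicCompletionAlgEquiv (Fin n) R).toRingEquiv
  have hmap : (J.map (algebraMap A (AdicCompletion J A))).map Φ = I.map (algebraMap R _) := by
    rw [Ideal.map_map, show Φ.comp (algebraMap A _) = (algebraMap R _).comp φ from
      RingHom.ext hΦ, ← Ideal.map_map, hφJ]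
  have : IsPrecomplete (J.map (algebraMap A (AdicCompletion J A))) (AdicCompletion J A) := by
    have := AdicCompletion.isAdicComplete (M := A) (MvPolynomial.idealOfVars_fg (Fin n) R)
    rw [IsPrecomplete.map_algebraMap_iff]
    exact this.toIsPrecomplete
  have : IsHausdorff ((J.map (algebraMap A (AdicCompletion J A))).map Φ) (AdicCompletion I R) := by
    rw [hmap, IsHausdorff.map_algebraMap_iff]
    infer_instance
  refine isNoetherianRing_of_surjective _ _ Φ (surjective_of_mk_map_comp_surjective Φ
    (I := J.map (algebraMap A (AdicCompletion J A))) fun y ↦ ?_)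
  obtain ⟨y, rfl⟩ := Ideal.Quotient.mk_surjective y
  obtain ⟨r, hr⟩ := Ideal.Quotient.mk_surjective (AdicCompletion.evalOneₐ I y)
  refine ⟨algebraMap A _ (algebraMap R A r), ?_⟩
  rw [RingHom.comp_apply, hΦ, Ideal.Quotient.eq, hmap,
    ← AdicCompletion.ker_evalOneₐ_eq_map I (IsNoetherian.noetherian I), RingHom.mem_ker, map_sub,
    sub_eq_zero]
  change AdicCompletion.evalOneₐ I (AdicCompletion.of I R _) = AdicCompletion.evalOneₐ I y
  rw [AdicCompletion.evalOneₐ_of, ← hr]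
  simp [φ]

end Completion

/-! ### Frobenius commutes with completion. -/

section FrobTwist

variable (R : Type*) [CommRing R] (p e : ℕ) [ExpChar R p] (I : Ideal R)

variable {R p e I} in
theorem FrobTwist.mem_of_mem_pow_smul_top {n : ℕ} {r : R}
    (h : (FrobTwist.equiv R p e).symm r ∈ (I ^ n • ⊤ : Submodule R (FrobTwist R p e))) :
    r ∈ I ^ n := by
  suffices H : ∀ x ∈ (I ^ n • ⊤ : Submodule R (FrobTwist R p e)),
      FrobTwist.equiv R p e x ∈ I ^ n by simpa using H _ h
  intro x hx
  induction hx using Submodule.smul_induction_on' with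
  | smul r hr x hx =>
    rw [FrobTwist.equiv_smul]
    exact Ideal.mul_mem_right _ _
      (Ideal.pow_mem_of_mem _ hr _ (pow_pos (expChar_pos R p) e))
  | add x _ y _ hx hy => rw [map_add]; exact add_mem hx hy

variable {R p e} in
/-- Multiplication by `a` on `FrobTwist R p e`. -/
noncomputable def FrobTwist.mulLeft (a : R) : FrobTwist R p e →ₗ[R] FrobTwist R p e where
  toFun x := (FrobTwist.equiv R p e).symm (a * FrobTwist.equiv R p e x)
  map_add' x y := by rw [map_add, mul_add, map_add]
  map_smul' r x := by
    apply (FrobTwist.equiv R p e).injective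
    rw [RingHom.id_apply, AddEquiv.apply_symm_apply, FrobTwist.equiv_smul, FrobTwist.equiv_smul,
      AddEquiv.apply_symm_apply, mul_left_comm]

theorem FrobTwist.mem_smul_top (J : Ideal R) (r : R)
    (hr : r ∈ J.map (iterateFrobenius R p e)) :
    (FrobTwist.equiv R p e).symm r ∈ (J • ⊤ : Submodule R (FrobTwist R p e)) := by
  refine Submodule.span_induction (p := fun r _ ↦
    (FrobTwist.equiv R p e).symm r ∈ (J • ⊤ : Submodule R (FrobTwist R p e))) ?_ ?_ ?_ ?_ hr
  · rintro _ ⟨s, hs, rfl⟩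
    have h1 : (FrobTwist.equiv R p e).symm (iterateFrobenius R p e s) =
        s • (FrobTwist.equiv R p e).symm 1 := by
      apply (FrobTwist.equiv R p e).injective
      rw [FrobTwist.equiv_smul, AddEquiv.apply_symm_apply, AddEquiv.apply_symm_apply, mul_one,
        iterateFrobenius_def]
    rw [h1]
    exact Submodule.smul_mem_smul hs trivial
  · rw [map_zero]; exact zero_mem _
  · intro x y _ _ hx hy
    rw [map_add]
    exact add_mem hx hy
  · intro a x _ hx
    exact Submodule.smul_top_le_comap_smul_top J (FrobTwist.mulLeft a) hx

theorem FrobTwist.exists_pow_le [IsNoetherianRing R] (n : ℕ) : ∃ K, n ≤ K ∧ ∀ r ∈ I ^ K,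
    (FrobTwist.equiv R p e).symm r ∈ (I ^ n • ⊤ : Submodule R (FrobTwist R p e)) := by
  obtain ⟨N, hN⟩ : ∃ N, (I ^ n) ^ N ≤ (I ^ n).map (iterateFrobenius R p e) := by
    refine Ideal.exists_pow_le_of_le_radical_of_fg (fun r hr ↦ ?_) (IsNoetherian.noetherian _)
    refine Ideal.mem_radical_iff.mpr ⟨p ^ e, ?_⟩
    have := Ideal.mem_map_of_mem (iterateFrobenius R p e) hr
    rwa [iterateFrobenius_def] at this
  -- `N + 1` rather than `N`, so that `n ≤ K` also when `N = 0`.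
  refine ⟨n * (N + 1), ?_, fun r hr ↦ FrobTwist.mem_smul_top R p e _ r (hN ?_)⟩
  · exact Nat.le_mul_of_pos_right _ (Nat.succ_pos _)
  · rw [pow_mul] at hr
    exact Ideal.pow_le_pow_right (I := I ^ n) (Nat.le_succ N) hr

variable [ExpChar (AdicCompletion I R) p]

/-- The left side is the completion of the finite module `FrobTwist R p e`, whose topology is given
by the ideals generated by `q`-th powers of elements of `I ^ n`. These are cofinal with the powers
of `I`, so both sides have the same Cauchy sequences. -/
theorem nonempty_frobTwist_adicCompletion_equiv [IsNoetherianRing R] [Module.Finite R (FrobTwist R p e)] :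
    Nonempty (AdicCompletion I R ⊗[R] FrobTwist R p e ≃ₗ[AdicCompletion I R]
      FrobTwist (AdicCompletion I R) p e) := by
  let A := AdicCompletion I R
  let F := FrobTwist R p e
  let u := FrobTwist.equiv R p e
  let v := FrobTwist.equiv A p e
  let _ : Module R (FrobTwist A p e) := Module.compHom _ (algebraMap R A)
  have : IsScalarTower R A (FrobTwist A p e) := .of_algebraMap_smul fun _ _ ↦ rfl
  let g : F →ₗ[R] FrobTwist A p e :=
    { toFun x := v.symm (algebraMap R A (u x))
      map_add' x y := by rw [map_add, map_add, map_add]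
      map_smul' r x := by
        apply v.injective
        change v (v.symm _) = v (algebraMap R A r • v.symm _)
        rw [FrobTwist.equiv_smul, AddEquiv.apply_symm_apply, FrobTwist.equiv_smul, map_mul, map_pow]
        congr 1 }
  let f : A ⊗[R] F →ₗ[A] FrobTwist A p e := g.liftBaseChange A
  have hf (a : A) (x : F) : v (f (a ⊗ₜ x)) = a ^ p ^ e * algebraMap R A (u x) := by
    simp only [f, LinearMap.liftBaseChange_tmul]
    rw [FrobTwist.equiv_smul]
    rfl
  have key {n K : ℕ} (hnK : n ≤ K) (hK : ∀ r ∈ I ^ K, u.symm r ∈ (I ^ n • ⊤ : Submodule R F))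
      (z : A ⊗[R] F) (r : R) (hr : AdicCompletion.evalₐ I K (v (f z)) = Ideal.Quotient.mk _ r) :
      AdicCompletion.eval I F n (AdicCompletion.ofTensorProduct I F z) =
        Submodule.Quotient.mk (u.symm r) := by
    induction z generalizing r with
    | zero =>
      rw [map_zero, map_zero, map_zero, eq_comm, Ideal.Quotient.eq_zero_iff_mem] at hr
      rw [map_zero, map_zero, eq_comm, Submodule.Quotient.mk_eq_zero]
      exact hK r hr
    | add z z' hz hz' =>
      obtain ⟨s, hs⟩ := Ideal.Quotient.mk_surjective (AdicCompletion.evalₐ I K (v (f z)))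
      have h1 := hz s hs.symm
      have h2 := hz' (r - s) (by
        rw [map_sub, hs, ← hr, map_add, map_add, map_add, add_sub_cancel_left])
      rw [map_add, map_add, h1, h2, ← Submodule.Quotient.mk_add, ← map_add, add_sub_cancel]
    | tmul a x =>
      obtain ⟨c, rfl⟩ := AdicCompletion.mk_surjective I R a
      rw [hf, map_mul, map_pow, AdicCompletion.evalₐ_mk, AlgHom.commutes] at hr
      change Ideal.Quotient.mk _ _ ^ _ * Ideal.Quotient.mk _ _ = _ at hr
      rw [← map_pow, ← map_mul, Ideal.Quotient.eq] at hr
      have h1 := hK _ hr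
      rw [map_sub] at h1
      have h2 : AdicCompletion.eval I F n (AdicCompletion.ofTensorProduct I F
          (AdicCompletion.mk I R c ⊗ₜ x)) = Submodule.Quotient.mk (c K • x) := by
        have h3 : c n - c K ∈ I ^ n := by
          rw [← Ideal.Quotient.eq]
          exact (AdicCompletion.Ideal.mk_eq_mk I hnK c).symm
        rw [AdicCompletion.ofTensorProduct_tmul]
        change Submodule.Quotient.mk (c n • x) = _
        rw [Submodule.Quotient.eq, ← sub_smul]
        exact Submodule.smul_mem_smul h3 trivial
      rw [h2, Submodule.Quotient.eq]
      exact h1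
  choose K hnK hK using FrobTwist.exists_pow_le R p e I
  have hbij := AdicCompletion.ofTensorProduct_bijective_of_finite_of_isNoetherian I F
  refine ⟨LinearEquiv.ofBijective f ⟨?_, fun y ↦ ?_⟩⟩
  · rw [injective_iff_map_eq_zero]
    intro z hz
    refine (map_eq_zero_iff _ hbij.1).mp (AdicCompletion.ext fun n ↦ ?_)
    rw [← AdicCompletion.eval_apply, key (hnK n) (hK n) z 0 (by rw [hz]; simp), map_zero]
    rfl
  · obtain ⟨c, hc⟩ := AdicCompletion.mk_surjective I R (v y)
    let b : AdicCompletion.AdicCauchySequence I F := ⟨fun n ↦ u.symm (c (K n)), fun {m n} hmn ↦ by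
      rw [SModEq.sub_mem, ← map_sub]
      rcases le_total (K m) (K n) with h | h
      · refine hK m _ ?_
        rw [← Ideal.Quotient.eq]
        exact (AdicCompletion.Ideal.mk_eq_mk I h c).symm
      · refine Submodule.smul_mono_left (Ideal.pow_le_pow_right hmn) (hK n _ ?_)
        rw [← Ideal.Quotient.eq]
        exact AdicCompletion.Ideal.mk_eq_mk I h c⟩
    obtain ⟨z, hz⟩ := hbij.2 (AdicCompletion.mk I F b)
    refine ⟨z, v.injective (AdicCompletion.ext_evalₐ fun n ↦ ?_)⟩
    obtain ⟨c', hc'⟩ := AdicCompletion.mk_surjective I R (v (f z))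
    have h1 := key (hnK n) (hK n) z (c' (K n)) (by rw [← hc', AdicCompletion.evalₐ_mk])
    rw [hz] at h1
    change Submodule.Quotient.mk (u.symm (c (K n))) = _ at h1
    rw [Submodule.Quotient.eq, ← map_sub] at h1
    have h2 := FrobTwist.mem_of_mem_pow_smul_top h1
    rw [← hc, ← hc', AdicCompletion.evalₐ_mk, AdicCompletion.evalₐ_mk]
    have h3 := AdicCompletion.Ideal.mk_eq_mk I (hnK n) c
    have h4 := AdicCompletion.Ideal.mk_eq_mk I (hnK n) c'
    rw [← h3, ← h4, eq_comm, Ideal.Quotient.eq]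
    exact h2

end FrobTwist

/-! ### Regularity of the completed polynomial ring. -/

section CompletionRegular

variable {R P : Type w} [CommRing R] [IsNoetherianRing R] [CommRing P] [Algebra R P]
  [Module.Finite R P]

attribute [local instance] Algebra.TensorProduct.rightAlgebra

/-- The only possible maximal ideal is `mT`. Indeed `I` lies in the Jacobson radical of the
completion and `T` is integral over it, so a maximal ideal contains `I` and hence `m`, which is
nilpotent modulo `I`. Conversely, every element of `T` is congruent to one of `R` modulo `mT`.
Regularity passes along the flat map `P → T`. -/
theorem maxIdealsRegular_adicCompletion_tensor (m : Ideal P) (rs : List P)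
    (hrs : Ideal.ofList rs = m) (hreg : IsWeaklyRegular P rs) (I : Ideal R) [I.IsMaximal]
    (hI : m ≤ (I.map (algebraMap R P)).radical) (hIm : I.map (algebraMap R P) ≤ m)
    (hsurj : ∀ s : P, ∃ r : R, s - algebraMap R P r ∈ m) :
    MaxIdealsRegular (AdicCompletion I R ⊗[R] P) rs.length := by
  intro N hN
  let A := AdicCompletion I R
  let T := A ⊗[R] P
  let ι : P →+* T := algebraMap P T
  have hιR (r : R) : ι (algebraMap R P r) = algebraMap A T (algebraMap R A r) := by
    change (1 : A) ⊗ₜ[R] algebraMap R P r = algebraMap R A r ⊗ₜ[R] 1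
    rw [Algebra.algebraMap_eq_smul_one, Algebra.algebraMap_eq_smul_one, TensorProduct.tmul_smul,
      TensorProduct.smul_tmul']
  have hIN (r : R) (hr : r ∈ I) : ι (algebraMap R P r) ∈ N := by
    have := AdicCompletion.isAdicComplete (M := R) (IsNoetherian.noetherian I)
    have := (IsAdicComplete.map_algebraMap_iff (S := A) I A).mpr this
    have h1 := IsAdicComplete.le_jacobson_bot (I.map (algebraMap R A))
    have h2 : (N.comap (algebraMap A T)).IsMaximal :=
      Ideal.isMaximal_comap_of_isIntegral_of_isMaximal N
    rw [hιR]
    have h3 : Ideal.jacobson ⊥ ≤ N.comap (algebraMap A T) := sInf_le ⟨bot_le, h2⟩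
    exact h3 (h1 (Ideal.mem_map_of_mem _ hr))
  have hmN : m.map ι ≤ N := by
    rw [Ideal.map_le_iff_le_comap]
    refine hI.trans ?_
    have := hN.isPrime
    rw [Ideal.IsPrime.radical_le_iff (Ideal.IsPrime.comap ι), Ideal.map_le_iff_le_comap]
    exact hIN
  have hIJ (r : R) (hr : r ∈ I) : algebraMap A T (algebraMap R A r) ∈ m.map ι := by
    rw [← hιR]
    exact Ideal.mem_map_of_mem _ (hIm (Ideal.mem_map_of_mem _ hr))
  have hrep (x : T) : ∃ r : R, x - algebraMap A T (algebraMap R A r) ∈ m.map ι := by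
    induction x using TensorProduct.induction_on with
    | zero => exact ⟨0, by simp⟩
    | add x y hx hy =>
      obtain ⟨r, hr⟩ := hx
      obtain ⟨s, hs⟩ := hy
      refine ⟨r + s, ?_⟩
      rw [map_add, map_add, add_sub_add_comm]
      exact add_mem hr hs
    | tmul a s =>
      obtain ⟨r, hr⟩ := hsurj s
      obtain ⟨t, ht⟩ := Ideal.Quotient.mk_surjective (AdicCompletion.evalOneₐ I a)
      have h1 : a - algebraMap R A t ∈ I.map (algebraMap R A) := by
        rw [← AdicCompletion.ker_evalOneₐ_eq_map I (IsNoetherian.noetherian I), RingHom.mem_ker,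
          map_sub, sub_eq_zero]
        exact ht.symm
      refine ⟨t * r, ?_⟩
      have h2 : a ⊗ₜ[R] s - algebraMap A T (algebraMap R A (t * r)) =
          algebraMap A T a * ι (s - algebraMap R P r) +
            algebraMap A T (a - algebraMap R A t) * algebraMap A T (algebraMap R A r) := by
        have h3 : a ⊗ₜ[R] s = algebraMap A T a * ι s := by
          change a ⊗ₜ[R] s = (a ⊗ₜ[R] 1) * ((1 : A) ⊗ₜ[R] s)
          rw [Algebra.TensorProduct.tmul_mul_tmul, mul_one, one_mul]
        rw [h3, map_sub ι, hιR, map_sub (algebraMap A T), map_mul (algebraMap R A),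
          map_mul (algebraMap A T)]
        ring
      rw [h2]
      refine add_mem (Ideal.mul_mem_left _ _ (Ideal.mem_map_of_mem _ hr))
        (Ideal.mul_mem_right _ _ ?_)
      have h4 : (I.map (algebraMap R A)).map (algebraMap A T) ≤ m.map ι := by
        rw [Ideal.map_map, Ideal.map_le_iff_le_comap]
        exact hIJ
      exact h4 (Ideal.mem_map_of_mem _ h1)
  have hNm : N = m.map ι := by
    refine le_antisymm (fun x hx ↦ ?_) hmN
    obtain ⟨r, hr⟩ := hrep x
    have h1 : algebraMap A T (algebraMap R A r) ∈ N := by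
      have := N.sub_mem hx (hmN hr)
      rwa [sub_sub_cancel] at this
    have h2 : r ∈ I := by
      have h3 : I ≤ N.comap ((algebraMap A T).comp (algebraMap R A)) := fun r hr ↦ hmN (hIJ r hr)
      have h4 := Ideal.IsMaximal.eq_of_le ‹I.IsMaximal›
        (Ideal.comap_ne_top _ hN.ne_top) h3
      rw [h4]
      exact h1
    rw [← sub_add_cancel x (algebraMap A T (algebraMap R A r))]
    exact add_mem hr (hIJ r h2)
  have hflat : Module.Flat P T :=
    Module.Flat.of_linearEquiv (Algebra.TensorProduct.commRight R P A).toLinearEquiv.symm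
  refine ⟨rs.map ι, by simp, ?_, ?_⟩
  · rw [hNm, ← hrs, Ideal.map_ofList]
  · exact IsWeaklyRegular.of_flat hreg

end CompletionRegular

/-! ### Frobenius as an isomorphism onto the subring of `q`-th powers. -/

section Frobenius

theorem MaxIdealsRegular.of_ringEquiv {T T' : Type w} [CommRing T] [CommRing T'] {d : ℕ}
    (h : MaxIdealsRegular T d) (e : T ≃+* T') : MaxIdealsRegular T' d := by
  intro m hm
  obtain ⟨rs, hd, hrs, hreg⟩ := h (m.comap e) (Ideal.comap_isMaximal_of_equiv e)
  refine ⟨rs.map e, by simpa using hd, ?_, ?_⟩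
  · have := Ideal.map_ofList (e : T →+* T') rs
    rw [hrs] at this
    exact this.symm.trans (Ideal.map_comap_of_surjective _ e.surjective _)
  · let _ : Algebra T T' := e.toRingHom.toAlgebra
    have : Module.Flat T T' := .of_linearEquiv (M := T)
      ({ e with map_smul' := fun a b ↦ map_mul e a b } : T ≃ₗ[T] T').symm
    exact IsWeaklyRegular.of_flat hreg

variable {R : Type*} [CommRing R] {p e : ℕ} [ExpChar R p]

/-- This avoids proving separately that the completion is reduced: `r ↦ r^q` is an injection `R →
FrobTwist R p e`, and flatness preserves it. -/
theorem injective_pow_of_equiv [IsReduced R] {A : Type*} [CommRing A] [Algebra R A]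
    [Module.Flat R A] [ExpChar A p] (e0 : A ⊗[R] FrobTwist R p e ≃ₗ[A] FrobTwist A p e) :
    Function.Injective (iterateFrobenius A p e) := by
  let f : R →ₗ[R] FrobTwist R p e := LinearMap.toSpanSingleton R _ ((FrobTwist.equiv R p e).symm 1)
  have hf : Function.Injective f := by
    rw [injective_iff_map_eq_zero]
    intro r hr
    have h1 := congrArg (FrobTwist.equiv R p e) hr
    rw [LinearMap.toSpanSingleton_apply, FrobTwist.equiv_smul, AddEquiv.apply_symm_apply, mul_one,
      map_zero] at h1
    exact eq_zero_of_pow_eq_zero h1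
  have hfA := Module.Flat.lTensor_preserves_injective_linearMap (M := A) f hf
  rw [injective_iff_map_eq_zero]
  intro a ha
  rw [iterateFrobenius_def] at ha
  have h1 : a ⊗ₜ[R] f 1 = 0 := by
    apply e0.injective
    have h2 : a ⊗ₜ[R] f 1 = a • ((1 : A) ⊗ₜ[R] f 1) := by
      rw [TensorProduct.smul_tmul', smul_eq_mul, mul_one]
    apply (FrobTwist.equiv A p e).injective
    rw [h2, map_smul, FrobTwist.equiv_smul, ha, zero_mul, map_zero, map_zero]
  have h3 : a ⊗ₜ[R] (1 : R) = 0 := hfA (by rw [LinearMap.lTensor_tmul, h1, map_zero])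
  simpa using congrArg (TensorProduct.rid R A) h3

/-- The Frobenius isomorphism of `A` onto its subring of `q`-th powers. -/
noncomputable def powEquiv (k : Type*) [Field k] [Fact p.Prime] [CharP k p] {A : Type*} [CommRing A]
    [Algebra k A] [ExpChar A p] (h : Function.Injective (iterateFrobenius A p e)) :
    A ≃+* powSubring k p e A :=
  RingEquiv.ofBijective ((iterateFrobenius A p e).codRestrict (powSubring k p e A)
    fun x ↦ ⟨x, (iterateFrobenius_def p e x).symm⟩)
    ⟨fun _ _ hxy ↦ h (congrArg Subtype.val hxy), fun ⟨_, x, hx⟩ ↦ ⟨x, Subtype.ext hx⟩⟩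

end Frobenius

/-! ### Assembly for invariants of a polynomial ring. -/

section PolynomialInvariants

open MvPolynomial

variable {k : Type u} [Field k] [IsAlgClosed k] {p : ℕ} [Fact p.Prime] [CharP k p]
  {ι : Type v} [Fintype ι] {R : Type (max u v)} [CommRing R] [Algebra k R]
  [Algebra R (MvPolynomial ι k)] [IsScalarTower k R (MvPolynomial ι k)]
  {G : Type*} [Group G] [Fintype G] [MulSemiringAction G (MvPolynomial ι k)]
  [SMulCommClass G k (MvPolynomial ι k)] [SMulCommClass G R (MvPolynomial ι k)]
  [Algebra.IsInvariant R (MvPolynomial ι k) G]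

theorem inAdd_of_projective {R B T : Type*} [CommRing R] [CommRing B] [Algebra R B] [AddCommGroup T]
    [Module R T] [Module B T] [IsScalarTower R B T] [Module.Finite B T] [Module.Projective B T] :
    InAdd R T B := by
  obtain ⟨n, f, hf⟩ := Module.Finite.exists_fin' B T
  obtain ⟨s, hs⟩ := Module.projective_lifting_property f LinearMap.id hf
  exact (InAdd.of_retract (f.restrictScalars R) (s.restrictScalars R)
    fun x ↦ DFunLike.congr_fun hs x).trans InAdd.pi

variable (k ι R G) in
omit [IsAlgClosed k] [SMulCommClass G k (MvPolynomial ι k)]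
  [SMulCommClass G R (MvPolynomial ι k)] in
include k G in
theorem finite_of_isInvariant : Module.Finite R (MvPolynomial ι k) := by
  have := Algebra.IsInvariant.isIntegral R (MvPolynomial ι k) G
  have : Algebra.FiniteType R (MvPolynomial ι k) := .of_restrictScalars_finiteType k R _
  exact Algebra.IsIntegral.finite

omit [IsAlgClosed k] in
theorem isUnit_natCast_of_dvd {A : Type*} [CommRing A] [Algebra k A] {m n : ℕ} (h : m ∣ n)
    (hn : (n : k) ≠ 0) : IsUnit (m : A) := by
  have hm : (m : k) ≠ 0 := by
    rintro h0
    obtain ⟨c, rfl⟩ := h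
    exact hn (by rw [Nat.cast_mul, h0, zero_mul])
  simpa using (IsUnit.mk0 _ hm).map (algebraMap k A)

variable [FaithfulSMul G (MvPolynomial ι k)]
  (hinj : Function.Injective (algebraMap R (MvPolynomial ι k)))
  (hcard : (Fintype.card G : k) ≠ 0)

include hinj hcard in
omit [IsAlgClosed k] [IsScalarTower k R (MvPolynomial ι k)] [SMulCommClass G k (MvPolynomial ι k)]
  [FaithfulSMul G (MvPolynomial ι k)] in
theorem isNoetherianRing_of_isInvariant : IsNoetherianRing R := by
  obtain ⟨r, hr, -⟩ := exists_reynolds (G := G) hinj (isUnit_natCast_of_dvd (A := R) dvd_rfl hcard)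
  exact isNoetherianRing_of_retract r hr

variable
  (hlin : ∀ (g : G) (i : ι), (g • (X i : MvPolynomial ι k)).IsHomogeneous 1)
  {e : ℕ}
  (hfaith : ∀ c : G → k, (∀ (f : MvPolynomial ι k) (a : ι →₀ ℕ), (∀ i, a i < p ^ e) →
    coeff a (∑ g, c g • g • f) = 0) → c = 0)

include hinj hcard hlin hfaith

/-- Everything meets here for `R ⊆ S^H ⊆ S` with `H` generated by the reflections: freeness over
`S^H`, the skew group ring of `G/H`, and the mutual splitting of `FrobTwist R p e` and `S^H`. -/
theorem globalDimension_end_of_frobTwist [ExpChar R p] (R' : Type (max u v)) [CommRing R']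
    [Algebra R R'] [IsNoetherianRing R'] [Nontrivial R'] [Module.Flat R R'] {d : ℕ}
    (hT : MaxIdealsRegular (R' ⊗[R] MvPolynomial ι k) d) {X' : Type (max u v)} [AddCommGroup X']
    [Module R' X'] (eX : X' ≃ₗ[R'] R' ⊗[R] FrobTwist R p e) :
    globalDimension (Module.End R' X') = ((d : ℕ∞) : WithBot ℕ∞) ∧
      IsCohenMacaulayModule R' (Module.End R' X') := by
  classical
  let H : Subgroup G := Subgroup.closure {g : G | IsReflection (k := k) (ι := ι) g}
  have : H.Normal := normal_closure_isReflection hlin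
  let B := FixedPoints.subalgebra R (MvPolynomial ι k) H
  have : Algebra.IsInvariant B (MvPolynomial ι k) H := ⟨fun b hb ↦ ⟨⟨b, hb⟩, rfl⟩⟩
  have := isNoetherianRing_of_isInvariant hinj hcard
  have := finite_of_isInvariant k ι R G
  have hBinj : Function.Injective (algebraMap B (MvPolynomial ι k)) := Subtype.val_injective
  have hHG : Fintype.card H ∣ Fintype.card G := by
    rw [← Nat.card_eq_fintype_card, ← Nat.card_eq_fintype_card]
    exact Subgroup.card_subgroup_dvd_card H
  have hcH : (Fintype.card H : k) ≠ 0 :=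
    (isUnit_natCast_of_dvd (A := k) hHG hcard).ne_zero
  have : Module.Free B (MvPolynomial ι k) := by
    refine free_of_isReflection (H := H) (fun h i ↦ hlin h i) hBinj ?_ hcH
    exact Subgroup.closure_closure_coe_preimage
  have : Module.Finite B (MvPolynomial ι k) := .of_restrictScalars_finite R B _
  obtain ⟨r, hr, hr'⟩ := exists_reynolds (R := R) (P := MvPolynomial ι k) (G := G) hinj
    (isUnit_natCast_of_dvd (A := R) dvd_rfl hcard)
  obtain ⟨s, hs, -⟩ := exists_reynolds (R := B) (P := MvPolynomial ι k) (G := H) hBinj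
    (by simpa using (isUnit_natCast_of_dvd (A := R) hHG hcard).map (algebraMap R B))
  have hs1 : s 1 = 1 := by simpa using hs 1
  refine globalDimension_end_baseChange (B := B) (T := MvPolynomial ι k) R'
    (MulSemiringAction.toAlgAut (G ⧸ H) R B)
    (bijective_skewMap_fixedPoints hlin H fun g hg ↦ Subgroup.subset_closure hg)
    ((inAdd_frobTwist r hr).trans inAdd_of_projective)
    ((InAdd.of_retract (s.restrictScalars R)
      (IsScalarTower.toAlgHom R B (MvPolynomial ι k)).toLinearMap hs).trans
      (inAdd_mvPolynomial_frobTwist hlin hfaith ((Fintype.card G : R) • r) fun x ↦ ?_)) ?_ s hs1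
    hinj hT eX
  · rw [← hr', LinearMap.smul_apply, smul_eq_mul, map_mul, map_natCast, mul_comm]
  · refine isUnit_natCast_of_dvd ?_ hcard
    rw [← Nat.card_eq_fintype_card, ← Nat.card_eq_fintype_card]
    exact Subgroup.card_quotient_dvd_card H

/-- Frobenius identifies `A` with `A^q`. Viewing `A^q` as an `R`-algebra in this way makes the
`A^q`-module `A` the base change of `FrobTwist R p e`. -/
theorem globalDimension_diffOp [ExpChar R p] [IsReduced R] (A : Type (max u v)) [CommRing A]
    [Algebra k A] [Algebra R A] [IsNoetherianRing A] [Nontrivial A] [Module.Flat R A]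
    [ExpChar A p] (e0 : A ⊗[R] FrobTwist R p e ≃ₗ[A] FrobTwist A p e) {d : ℕ}
    (hT : MaxIdealsRegular (A ⊗[R] MvPolynomial ι k) d) :
    globalDimension (DiffOp k p e A) = ((d : ℕ∞) : WithBot ℕ∞) ∧
      DiffOpIsCohenMacaulay k p e A := by
  let A' := powSubring k p e A
  let φ : A ≃+* A' := powEquiv k (injective_pow_of_equiv e0)
  have hφ (a : A) : (φ a : A) = a ^ p ^ e := rfl
  let _ : Algebra R A' := (φ.toRingHom.comp (algebraMap R A)).toAlgebra
  let σ : A ≃ₐ[R] A' := { φ with commutes' := fun r ↦ rfl }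
  have : Module.Flat R A' := .of_linearEquiv σ.symm.toLinearEquiv
  have : IsNoetherianRing A' := isNoetherianRing_of_ringEquiv A φ
  have : Nontrivial A' := φ.symm.toEquiv.nontrivial
  let e1 : A' ⊗[R] FrobTwist R p e ≃+ A :=
    ((TensorProduct.congr σ.symm.toLinearEquiv (.refl R _)).toAddEquiv.trans e0.toAddEquiv).trans
      (FrobTwist.equiv A p e)
  have he1 (a : A') (x : A' ⊗[R] FrobTwist R p e) : e1 (a • x) = a • e1 x := by
    obtain ⟨a, rfl⟩ := φ.surjective a
    have h1 : TensorProduct.congr σ.symm.toLinearEquiv (.refl R _) (φ a • x) =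
        a • TensorProduct.congr σ.symm.toLinearEquiv (.refl R _) x := by
      induction x with
      | zero => simp
      | add x y hx hy => rw [smul_add, map_add, hx, hy, map_add, smul_add]
      | tmul b x =>
        rw [TensorProduct.smul_tmul', TensorProduct.congr_tmul, TensorProduct.congr_tmul,
          TensorProduct.smul_tmul']
        congr 1
        change φ.symm (φ a * b) = a * φ.symm b
        rw [map_mul, φ.symm_apply_apply]
    change FrobTwist.equiv A p e (e0 (TensorProduct.congr σ.symm.toLinearEquiv (.refl R _)
      (φ a • x))) = (φ a : A) * FrobTwist.equiv A p e
        (e0 (TensorProduct.congr σ.symm.toLinearEquiv (.refl R _) x))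
    rw [h1, map_smul, FrobTwist.equiv_smul, hφ]
  exact globalDimension_end_of_frobTwist hinj hcard hlin hfaith A'
    (hT.of_ringEquiv (Algebra.TensorProduct.congr σ .refl).toRingEquiv)
    { e1 with map_smul' := he1 : A' ⊗[R] FrobTwist R p e ≃ₗ[A'] A }.symm

end PolynomialInvariants

/-! ### The invariant ring and its completion. -/

section PolynomialInvariants

open MvPolynomial
open scoped Pointwise

variable {k : Type u} [Field k] [IsAlgClosed k] {p : ℕ} [Fact p.Prime] [CharP k p]
  {ι : Type v} [Fintype ι] {R : Type (max u v)} [CommRing R] [Algebra k R]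
  [Algebra R (MvPolynomial ι k)] [IsScalarTower k R (MvPolynomial ι k)]
  {G : Type*} [Group G] [Fintype G] [MulSemiringAction G (MvPolynomial ι k)]
  [SMulCommClass G k (MvPolynomial ι k)] [SMulCommClass G R (MvPolynomial ι k)]
  [Algebra.IsInvariant R (MvPolynomial ι k) G]

omit [IsAlgClosed k] [Fintype ι] in
theorem isMaximal_ker_constantCoeff :
    (RingHom.ker (constantCoeff : MvPolynomial ι k →+* k)).IsMaximal :=
  RingHom.ker_isMaximal_of_surjective _ fun c ↦ ⟨C c, constantCoeff_C _ c⟩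

omit [IsAlgClosed k] [Fintype ι] [Algebra k R]
  [IsScalarTower k R (MvPolynomial ι k)] in
-- Primes of `S` over the same prime of `R` are `G`-conjugate, and the homogeneous maximal ideal is
-- stable under `G`.
theorem ker_constantCoeff_le_radical
    (hlin : ∀ (g : G) (i : ι), (g • (X i : MvPolynomial ι k)).IsHomogeneous 1) :
    RingHom.ker (constantCoeff : MvPolynomial ι k →+* k) ≤
      (((RingHom.ker (constantCoeff : MvPolynomial ι k →+* k)).comap
        (algebraMap R (MvPolynomial ι k))).map (algebraMap R (MvPolynomial ι k))).radical := by
  set m := RingHom.ker (constantCoeff : MvPolynomial ι k →+* k) with hm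
  have hmax : m.IsMaximal := isMaximal_ker_constantCoeff
  have := Algebra.IsInvariant.isIntegral R (MvPolynomial ι k) G
  have hI : (m.comap (algebraMap R (MvPolynomial ι k))).IsMaximal :=
    Ideal.isMaximal_comap_of_isIntegral_of_isMaximal m
  rw [Ideal.radical_eq_sInf]
  refine le_sInf fun Q ⟨hQ, hQp⟩ ↦ ?_
  have hu : m.under R = Q.under R :=
    hI.eq_of_le (Ideal.comap_ne_top _ hQp.ne_top) (Ideal.map_le_iff_le_comap.mp hQ)
  obtain ⟨g, rfl⟩ := Algebra.IsInvariant.exists_smul_of_under_eq R (MvPolynomial ι k) G m Q hu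
  intro x hx
  rw [Ideal.mem_pointwise_smul_iff_inv_smul_mem, hm, RingHom.mem_ker, constantCoeff_eq,
    constantCoeff_smul hlin]
  exact hx

variable [FaithfulSMul G (MvPolynomial ι k)]
  (hinj : Function.Injective (algebraMap R (MvPolynomial ι k)))
  (hcard : (Fintype.card G : k) ≠ 0)
  (hlin : ∀ (g : G) (i : ι), (g • (X i : MvPolynomial ι k)).IsHomogeneous 1)
  {e : ℕ}
  (hfaith : ∀ c : G → k, (∀ (f : MvPolynomial ι k) (a : ι →₀ ℕ), (∀ i, a i < p ^ e) →
    coeff a (∑ g, c g • g • f) = 0) → c = 0)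

include hinj hcard hlin hfaith

theorem globalDimension_diffOp_invariants :
    globalDimension (DiffOp k p e R) = ((Fintype.card ι : ℕ∞) : WithBot ℕ∞) ∧
      DiffOpIsCohenMacaulay k p e R := by
  have : Nontrivial R := (algebraMap R (MvPolynomial ι k)).domain_nontrivial
  have : ExpChar R p := expChar_of_injective_algebraMap (algebraMap k R).injective p
  have : IsReduced R := isReduced_of_injective _ hinj
  have := isNoetherianRing_of_isInvariant hinj hcard
  exact globalDimension_diffOp hinj hcard hlin hfaith R (TensorProduct.lid R _)
    (maxIdealsRegular_mvPolynomial.of_ringEquiv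
      (Algebra.TensorProduct.lid R (MvPolynomial ι k)).symm.toRingEquiv)

theorem globalDimension_diffOp_completion (I : Ideal R)
    (hI : I = (RingHom.ker (constantCoeff : MvPolynomial ι k →+* k)).comap
      (algebraMap R (MvPolynomial ι k))) :
    globalDimension (DiffOp k p e (AdicCompletion I R)) =
        ((Fintype.card ι : ℕ∞) : WithBot ℕ∞) ∧
      DiffOpIsCohenMacaulay k p e (AdicCompletion I R) := by
  have : Nontrivial R := (algebraMap R (MvPolynomial ι k)).domain_nontrivial
  have : ExpChar R p := expChar_of_injective_algebraMap (algebraMap k R).injective p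
  have : IsReduced R := isReduced_of_injective _ hinj
  have := isNoetherianRing_of_isInvariant hinj hcard
  have := finite_of_isInvariant k ι R G
  have := isNoetherianRing_adicCompletion I
  have hmax := isMaximal_ker_constantCoeff (k := k) (ι := ι)
  have := Algebra.IsInvariant.isIntegral R (MvPolynomial ι k) G
  have hImax : I.IsMaximal := hI ▸ Ideal.isMaximal_comap_of_isIntegral_of_isMaximal _
  have : Nontrivial (AdicCompletion I R) :=
    have : Nontrivial (R ⧸ I) := Ideal.Quotient.nontrivial_iff.mpr hImax.ne_top
    (AdicCompletion.evalOneₐ I : _ →+* R ⧸ I).domain_nontrivial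
  have : ExpChar (AdicCompletion I R) p :=
    expChar_of_injective_algebraMap (algebraMap k (AdicCompletion I R)).injective p
  obtain ⟨r, hr, -⟩ := exists_reynolds (R := R) (P := MvPolynomial ι k) (G := G) hinj
    (isUnit_natCast_of_dvd (A := R) dvd_rfl hcard)
  have : Module.Finite R (FrobTwist R p e) := (inAdd_frobTwist r hr).finite
  obtain ⟨e0⟩ := nonempty_frobTwist_adicCompletion_equiv R p e I
  refine globalDimension_diffOp hinj hcard hlin hfaith (AdicCompletion I R) e0 ?_
  obtain ⟨rs, hd, hrs, hreg⟩ := maxIdealsRegular_mvPolynomial _ hmax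
  rw [← hd]
  refine maxIdealsRegular_adicCompletion_tensor _ rs hrs hreg I
    (hI ▸ ker_constantCoeff_le_radical hlin) (hI ▸ Ideal.map_comap_le) fun s ↦ ?_
  refine ⟨algebraMap k R (constantCoeff s), ?_⟩
  rw [← IsScalarTower.algebraMap_apply, RingHom.mem_ker, map_sub, algebraMap_eq, constantCoeff_C,
    sub_self]

end PolynomialInvariants

/-! ### From the symmetric algebra to polynomials in a basis. -/

section SymmetricAlgebra

open MvPolynomial

variable {k : Type u} [Field k] {V : Type v} [AddCommGroup V] [Module k V]

theorem symAct_ι (g : LinearMap.GeneralLinearGroup k V) (x : V) :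
    symAct k V g (SymmetricAlgebra.ι k V x) = SymmetricAlgebra.ι k V (g.1 x) :=
  SymmetricAlgebra.lift_ι_apply (SymmetricAlgebra.ι k V ∘ₗ (g : V →ₗ[k] V)) x

theorem ι_injective : Function.Injective (SymmetricAlgebra.ι k V) := by
  intro x y h
  refine (Module.Free.chooseBasis k V).ext_elem fun i ↦ ?_
  have := congrArg (SymmetricAlgebra.lift ((Module.Free.chooseBasis k V).coord i)) h
  rwa [SymmetricAlgebra.lift_ι_apply, SymmetricAlgebra.lift_ι_apply] at this

theorem isHomogeneous_equivMvPolynomial_ι {ι : Type*} (b : Module.Basis ι k V) (x : V) :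
    (SymmetricAlgebra.equivMvPolynomial b (SymmetricAlgebra.ι k V x)).IsHomogeneous 1 := by
  rw [← b.linearCombination_repr x, Finsupp.linearCombination_apply, Finsupp.sum, map_sum, map_sum]
  refine MvPolynomial.IsHomogeneous.sum _ _ _ fun i _ ↦ ?_
  rw [map_smul, map_smul, SymmetricAlgebra.equivMvPolynomial_ι_apply]
  exact (homogeneousSubmodule ι k 1).smul_mem _ (isHomogeneous_X k i)

theorem mem_irrelevant_iff {ι : Type*} (b : Module.Basis ι k V) (s : SymmetricAlgebra k V) :
    constantCoeff (SymmetricAlgebra.equivMvPolynomial b s) = 0 ↔ s ∈ irrelevant k V := by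
  have h : (irrelevant k V).map (SymmetricAlgebra.equivMvPolynomial b : _ →+* MvPolynomial ι k) =
      RingHom.ker constantCoeff := by
    rw [irrelevant_map_equivMvPolynomial, ← Set.image_univ]
    ext f
    rw [mem_ideal_span_X_image, RingHom.mem_ker, constantCoeff_eq, ← notMem_support_iff]
    refine ⟨fun hf h0 ↦ ?_, fun hf m hm ↦ ?_⟩
    · obtain ⟨i, -, hi⟩ := hf 0 h0
      exact hi rfl
    · by_contra! hi
      have : m = 0 := Finsupp.ext fun i ↦ hi i trivial
      exact hf (this ▸ hm)
  rw [← RingHom.mem_ker, ← h]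
  refine ⟨fun hs ↦ ?_, fun hs ↦ Ideal.mem_map_of_mem _ hs⟩
  obtain ⟨x, hx, hxs⟩ :=
    (Ideal.mem_map_of_equiv (SymmetricAlgebra.equivMvPolynomial b).toRingEquiv _).mp hs
  rwa [← (SymmetricAlgebra.equivMvPolynomial b).injective hxs]

variable (G : Subgroup (LinearMap.GeneralLinearGroup k V)) {ι : Type*} (b : Module.Basis ι k V)

/-- The action of `G` on the polynomial ring in the coordinates given by a basis. -/
noncomputable abbrev polyAction : MulSemiringAction G (MvPolynomial ι k) where
  smul g f := SymmetricAlgebra.equivMvPolynomial b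
    (symAct k V g.1 ((SymmetricAlgebra.equivMvPolynomial b).symm f))
  one_smul f := by
    change SymmetricAlgebra.equivMvPolynomial b (symAct k V (1 : G).1 _) = f
    rw [OneMemClass.coe_one, map_one, AlgHom.one_apply, AlgEquiv.apply_symm_apply]
  mul_smul g h f := by
    change SymmetricAlgebra.equivMvPolynomial b (symAct k V (g * h : G).1 _) =
      SymmetricAlgebra.equivMvPolynomial b (symAct k V g.1
        ((SymmetricAlgebra.equivMvPolynomial b).symm (SymmetricAlgebra.equivMvPolynomial b _)))
    rw [Subgroup.coe_mul, map_mul, AlgHom.mul_apply, AlgEquiv.symm_apply_apply]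
  smul_zero g := by
    change SymmetricAlgebra.equivMvPolynomial b (symAct k V g.1 _) = 0
    simp only [map_zero]
  smul_add g f f' := by
    change SymmetricAlgebra.equivMvPolynomial b (symAct k V g.1 _) = _
    simp only [map_add]
    rfl
  smul_one g := by
    change SymmetricAlgebra.equivMvPolynomial b (symAct k V g.1 _) = 1
    simp only [map_one]
  smul_mul g f f' := by
    change SymmetricAlgebra.equivMvPolynomial b (symAct k V g.1 _) = _
    simp only [map_mul]
    rfl

theorem globalDimension_diffOp_symmetric [IsAlgClosed k] (p : ℕ) [Fact p.Prime] [CharP k p]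
    [FiniteDimensional k V] [Finite G] (hG : (Nat.card G : k) ≠ 0) (e : ℕ)
    (h : ContainsAllIrreps G (p ^ e)) :
    (globalDimension (DiffOp k p e (invariantRing G)) =
        ((Module.finrank k V : ℕ∞) : WithBot ℕ∞) ∧
      DiffOpIsCohenMacaulay k p e (invariantRing G)) ∧
    (globalDimension (DiffOp k p e (completedInvariantRing G)) =
        ((Module.finrank k V : ℕ∞) : WithBot ℕ∞) ∧
      DiffOpIsCohenMacaulay k p e (completedInvariantRing G)) := by
  have := Fintype.ofFinite G
  let b := Module.Free.chooseBasis k V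
  let ι := Module.Free.ChooseBasisIndex k V
  let E := SymmetricAlgebra.equivMvPolynomial b
  let _ := polyAction G b
  have hsmul (g : G) (f : MvPolynomial ι k) : g • f = E (symAct k V g.1 (E.symm f)) := rfl
  let _ : Algebra (invariantRing G) (MvPolynomial ι k) :=
    ((E : SymmetricAlgebra k V →+* MvPolynomial ι k).comp
      (algebraMap (invariantRing G) (SymmetricAlgebra k V))).toAlgebra
  have halg (r : invariantRing G) : algebraMap (invariantRing G) (MvPolynomial ι k) r = E r := rfl
  have : IsScalarTower k (invariantRing G) (MvPolynomial ι k) :=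
    .of_algebraMap_eq fun c ↦ (E.commutes c).symm
  have : SMulCommClass G k (MvPolynomial ι k) := ⟨fun g c f ↦ by
    rw [hsmul, hsmul, map_smul, map_smul, map_smul]⟩
  have : SMulCommClass G (invariantRing G) (MvPolynomial ι k) := ⟨fun g r f ↦ by
    rw [Algebra.smul_def, Algebra.smul_def, hsmul, hsmul, halg, map_mul, map_mul, map_mul,
      E.symm_apply_apply, r.2 g.1 g.2]⟩
  have : Algebra.IsInvariant (invariantRing G) (MvPolynomial ι k) G := ⟨fun f hf ↦
    ⟨⟨E.symm f, fun g hg ↦ E.injective ((hf ⟨g, hg⟩).trans (E.apply_symm_apply f).symm)⟩,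
      E.apply_symm_apply f⟩⟩
  have : FaithfulSMul G (MvPolynomial ι k) := ⟨fun {g g'} hgg ↦ by
    refine Subtype.ext (Units.ext (LinearMap.ext fun x ↦ ι_injective (k := k) (V := V) ?_))
    have := E.injective (hgg (E (SymmetricAlgebra.ι k V x)))
    rwa [E.symm_apply_apply, symAct_ι, symAct_ι] at this⟩
  have hinj : Function.Injective (algebraMap (invariantRing G) (MvPolynomial ι k)) :=
    E.injective.comp Subtype.val_injective
  have hcard : (Fintype.card G : k) ≠ 0 := by rwa [← Nat.card_eq_fintype_card]
  have hlin (g : G) (i : ι) : (g • (X i : MvPolynomial ι k)).IsHomogeneous 1 := by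
    rw [hsmul, SymmetricAlgebra.equivMvPolynomial_symm_X, symAct_ι]
    exact isHomogeneous_equivMvPolynomial_ι b _
  have hfaith (c : G → k) (hc : ∀ (f : MvPolynomial ι k) (a : ι →₀ ℕ), (∀ i, a i < p ^ e) →
      coeff a (∑ g, c g • g • f) = 0) : c = 0 := by
    refine h.eq_zero_of_sum_smul hG c fun x ↦ ?_
    obtain ⟨s, rfl⟩ := Submodule.Quotient.mk_surjective _ x
    have h1 : ∑ g, c g • quotRep G (p ^ e) g (Submodule.Quotient.mk s) =
        Submodule.Quotient.mk (∑ g, c g • symAct k V g.1 s) := by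
      rw [← Submodule.mkQ_apply _ (∑ g, c g • symAct k V g.1 s), map_sum]
      rfl
    rw [h1, Submodule.Quotient.mk_eq_zero, Submodule.restrictScalars_mem,
      mem_frobPow_irrelevant_iff p b]
    intro m hm
    by_contra! hlt
    refine mem_support_iff.mp hm ?_
    have h2 := hc (E s) m hlt
    simp only [hsmul, E.symm_apply_apply] at h2
    rw [map_sum]
    simpa only [map_smul] using h2
  have hI : invariantIdeal G = (RingHom.ker (constantCoeff : MvPolynomial ι k →+* k)).comap
      (algebraMap (invariantRing G) (MvPolynomial ι k)) := by
    have h1 : irrelevant k V =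
        (RingHom.ker (constantCoeff : MvPolynomial ι k →+* k)).comap E := by
      ext s
      rw [← mem_irrelevant_iff b]
      rfl
    rw [invariantIdeal, h1]
    rfl
  rw [Module.finrank_eq_card_chooseBasisIndex]
  exact ⟨globalDimension_diffOp_invariants hinj hcard hlin hfaith,
    globalDimension_diffOp_completion hinj hcard hlin hfaith _ hI⟩

end SymmetricAlgebra

end

end QuotientSing

theorem mainTheorem2 {k : Type*} [Field k] [IsAlgClosed k] (p : ℕ) [Fact p.Prime] [CharP k p]
    {V : Type*} [AddCommGroup V] [Module k V] [FiniteDimensional k V]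
    (G : Subgroup (LinearMap.GeneralLinearGroup k V)) [Finite G] (hG : ¬ p ∣ Nat.card G) :
    (∃ e₀ : ℕ, ∀ e : ℕ, e₀ ≤ e → QuotientSing.ContainsAllIrreps G (p ^ e)) ∧
    ((∀ g ∈ G, ∀ h ∈ G, g * h = h * g) →
      ∀ e : ℕ, Nat.card G ≤ p ^ e → QuotientSing.ContainsAllIrreps G (p ^ e)) ∧
    ∀ e : ℕ, QuotientSing.ContainsAllIrreps G (p ^ e) →
      (QuotientSing.globalDimension
          (QuotientSing.DiffOp k p e (QuotientSing.invariantRing G)) =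
        ((Module.finrank k V : ℕ∞) : WithBot ℕ∞) ∧
      QuotientSing.DiffOpIsCohenMacaulay k p e (QuotientSing.invariantRing G)) ∧
      (QuotientSing.globalDimension
          (QuotientSing.DiffOp k p e (QuotientSing.completedInvariantRing G)) =
        ((Module.finrank k V : ℕ∞) : WithBot ℕ∞) ∧
      QuotientSing.DiffOpIsCohenMacaulay k p e (QuotientSing.completedInvariantRing G)) := by
  have hG' : (Nat.card G : k) ≠ 0 := by rwa [Ne, CharP.cast_eq_zero_iff k p]
  -- The threshold `e₀ = #G` suffices because `e < p ^ e`.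
  refine ⟨⟨Nat.card G, fun e he ↦ QuotientSing.containsAllIrreps_of_card_le G p hG' e
    (he.trans (Nat.lt_pow_self (Fact.out : p.Prime).one_lt).le)⟩, fun _ e he ↦
    QuotientSing.containsAllIrreps_of_card_le G p hG' e he, fun e h ↦
    QuotientSing.globalDimension_diffOp_symmetric G p hG' e h⟩
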